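/- Let $\mathcal X\subset\mathbb R^d$ be compact, let $\alpha,\beta$ be probability measures on $\mathcal X$, let $C\colon\mathcal X\times\mathcal X\to\mathbb R$ be Lipschitz, and let $\epsilon>0$. Let $(f^*,g^*)$ be a pair of optimal potentials: continuous functions maximising $\int f\,d\alpha+\int g\,d\beta-\epsilon\int e^{(f(x)+g(y)-C(x,y))/\epsilon}\,d\alpha(x)\,d\beta(y)$, extended to all of $\mathcal X$ by the optimality relations $f^*=-\epsilon\log\int e^{(g^*(y)-C(\cdot,y))/\epsilon}d\beta(y)$ and $g^*=-\epsilon\log\int e^{(f^*(x)-C(x,\cdot))/\epsilon}d\alpha(x)$. Let $-1<b<-\tfrac12$, $a-b>1$, $\zeta>0$, and put $\eta_t=(t+s)^b$, $b_t=(t+s)^{2a}$ (rounded up to an integer), where the integer $s\ge 0$ fixes the numbering ($s=0$: $\eta_t=t^b$, $b_t=t^{2a}$; $s=1$: $\eta_t=(t+1)^b$, $b_t=(t+1)^{2a}$), and $m_1=b_1$, $m_t=t^{(a-b)/\zeta}$ (rounded up) for $t\ge2$. Compressed online Sinkhorn: write $\hat f_t=-\epsilon\log\sum_{i=1}^{m_t}e^{(\hat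 q_{i,t}-C(\cdot,\hat y_{i,t}))/\epsilon}$ and $\hat g_t=-\epsilon\log\sum_{i=1}^{m_t}e^{(\hat p_{i,t}-C(\hat x_{i,t},\cdot))/\epsilon}$. Start with $\hat q_{i,1}=\hat p_{i,1}=0$ and i.i.d. samples $\hat x_{i,1}\sim\alpha$, $\hat y_{i,1}\sim\beta$. In iteration $t\ge1$ draw fresh independent samples $x_1,\dots,x_{b_t}\sim\alpha$, $y_1,\dots,y_{b_t}\sim\beta$ and set $$e^{-f_{t+1}/\epsilon}=(1-\eta_t)e^{-\hat f_t/\epsilon}+\frac{\eta_t}{b_t}\sum_{j=1}^{b_t}e^{(\hat g_t(y_j)-C(\cdot,y_j))/\epsilon},\qquad e^{-g_{t+1}/\epsilon}=(1-\eta_t)e^{-\hat g_t/\epsilon}+\frac{\eta_t}{b_t}\sum_{j=1}^{b_t}e^{(f_{t+1}(x_j)-C(x_j,\cdot))/\epsilon};$$ then replace $f_{t+1},g_{t+1}$ by compressed potentials $\hat f_{t+1},\hat g_{t+1}$ of the above form with $m_{t+1}$ points in $\mathcal X$, chosen without knowledge of future samples. Assume that for a constant $K$, almost surely, $\sup_x|f_{t}-\hat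 f_{t}|\le Km_{t}^{-\zeta}$ and $\sup_y|g_{t}-\hat g_{t}|\le Km_{t}^{-\zeta}$ for all $t\ge2$. Let $\|h\|_{var}=\sup h-\inf h$, let $t(N)$ be the first $t$ with $\sum_{i=1}^t b_i>N$, and let $\hat\delta_N=\|(\hat f_{t(N)}-f^*)/\epsilon\|_{var}+\|(\hat g_{t(N)}-g^*)/\epsilon\|_{var}$. Then there are constants $c,A,B>0$, depending on neither $N$ nor the run (probability space, samples, compression scheme with the given $K$), such that for all $N\ge1$ the error $\hat\delta_N$ is integrable and $$\mathbb E\,\hat\delta_N\le A\Big(\exp\big(-cN^{\frac{b+1}{2a+1}}\big)+N^{-\frac{a}{2a+1}}\Big)\le B\,N^{-\frac{a}{2a+1}}.$$ -/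

import Mathlib

open MeasureTheory ProbabilityTheory
open scoped NNReal

namespace COS

noncomputable section

/-- The variation seminorm `sup h - inf h`. -/
def varNorm {X : Type*} (h : X → ℝ) : ℝ := (⨆ x, h x) - ⨅ x, h x

/-- The soft `c`-transform `x ↦ -ε log ∫ exp ((h y - c x y) / ε) dμ(y)`. -/
def softTransform {X : Type*} [MeasurableSpace X] (ε : ℝ) (c : X → X → ℝ) (μ : Measure X)
    (h : X → ℝ) (x : X) : ℝ :=
  -ε * Real.log (∫ y, Real.exp ((h y - c x y) / ε) ∂μ)

/-- The dual objective of entropically regularised optimal transport. -/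
def dualObjective {X : Type*} [MeasurableSpace X] (ε : ℝ) (C : X → X → ℝ) (α β : Measure X)
    (f g : X → ℝ) : ℝ :=
  (∫ x, f x ∂α) + (∫ y, g y ∂β)
    - ε * ∫ z, Real.exp ((f z.1 + g z.2 - C z.1 z.2) / ε) ∂(α.prod β)

/-- `(f, g)` is a pair of optimal potentials: continuous functions that maximise the dual objective
over all pairs of continuous functions. Maximality determines `f` and `g` only on the supports
of `α` and `β`; off the supports they are given by the optimality relations
`f = T_β g`, `g = T_α f`, required at every point. -/
structure IsOptimalPotentials {X : Type*} [TopologicalSpace X] [MeasurableSpace X]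
    (ε : ℝ) (C : X → X → ℝ) (α β : Measure X) (f g : X → ℝ) : Prop where
  continuous_left : Continuous f
  continuous_right : Continuous g
  isMax : ∀ f' g' : X → ℝ, Continuous f' → Continuous g' →
    dualObjective ε C α β f' g' ≤ dualObjective ε C α β f g
  left_eq : ∀ x, f x = softTransform ε C β g x
  right_eq : ∀ y, g y = softTransform ε (fun y x => C x y) α f y

/-- The potential `-ε log ∑ i, exp ((w i - c(·, z i)) / ε)` carried by finitely many weighted
points. -/
def atomicPotential {X : Type*} (ε : ℝ) (c : X → X → ℝ) {m : ℕ} (w : Fin m → ℝ) (z : Fin m → X)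
    (x : X) : ℝ :=
  -ε * Real.log (∑ i, Real.exp ((w i - c x (z i)) / ε))

/-- One (uncompressed) online Sinkhorn half-step. The old points `z i` get the weights
`w i + ε log (1 - η)`, i.e. `exp (w i / ε)` is multiplied by `1 - η`; the `n` new points `ξ j`
get the weights `ε log (η / n) + h (ξ j)`. (In this multiplicative form `η = 1` is allowed.) -/
def onlineUpdate {X : Type*} (ε : ℝ) (c : X → X → ℝ) (η : ℝ) {m n : ℕ} (w : Fin m → ℝ)
    (z : Fin m → X) (h : X → ℝ) (ξ : Fin n → X) (x : X) : ℝ :=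
  -ε * Real.log ((∑ i, (1 - η) * Real.exp ((w i - c x (z i)) / ε))
    + ∑ j, (η / n) * Real.exp ((h (ξ j) - c x (ξ j)) / ε))

/-- Number of samples from each distribution used before iteration `t ≥ 1`:
`n_1 = b_1`, `n_{t+1} = n_t + b_t`. -/
def sampleCount (bs : ℕ → ℕ) (t : ℕ) : ℕ := bs 1 + ∑ i ∈ Finset.Ico 1 t, bs i

/-- A run of compressed online Sinkhorn on a probability space `(Ω, P)`, with learning rates `η`,
batch sizes `bs` and compression sizes `m`. Iterations are numbered `t = 1, 2, …`. The compression
step is not prescribed: its output is any measurable collection of `m t` weighted points which,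
like everything that the algorithm computes, does not look into the future. -/
structure Run {X : Type*} [MeasurableSpace X] (α β : Measure X)
    (η : ℕ → ℝ) (bs m : ℕ → ℕ) {Ω : Type*} [MeasurableSpace Ω] (P : Measure Ω) where
  /-- the samples from `α` -/
  x : ℕ → Ω → X
  /-- the samples from `β` -/
  y : ℕ → Ω → X
  measurable_x : ∀ i, Measurable (x i)
  measurable_y : ∀ i, Measurable (y i)
  law_x : ∀ i, P.map (x i) = α
  law_y : ∀ i, P.map (y i) = β
  /-- all the samples are mutually independent -/
  indep_samples : iIndepFun (Sum.elim x y) P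
  /-- the points and weights that represent the compressed potential `g` -/
  xhat : (t : ℕ) → Ω → Fin (m t) → X
  phat : (t : ℕ) → Ω → Fin (m t) → ℝ
  /-- the points and weights that represent the compressed potential `f` -/
  yhat : (t : ℕ) → Ω → Fin (m t) → X
  qhat : (t : ℕ) → Ω → Fin (m t) → ℝ
  measurable_xhat : ∀ t, 1 ≤ t → Measurable (xhat t)
  measurable_phat : ∀ t, 1 ≤ t → Measurable (phat t)
  measurable_yhat : ∀ t, 1 ≤ t → Measurable (yhat t)
  measurable_qhat : ∀ t, 1 ≤ t → Measurable (qhat t)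
  /-- initialisation with the first samples and zero weights -/
  init_xhat : ∀ ω i, xhat 1 ω i = x i ω
  init_phat : ∀ ω i, phat 1 ω i = 0
  init_yhat : ∀ ω i, yhat 1 ω i = y i ω
  init_qhat : ∀ ω i, qhat 1 ω i = 0
  /-- the state at iteration `t` is independent of the samples not yet drawn -/
  nonanticipating : ∀ t, 1 ≤ t →
    IndepFun (fun ω => (xhat t ω, phat t ω, yhat t ω, qhat t ω))
      (fun ω (i : ℕ) => (x (sampleCount bs t + i) ω, y (sampleCount bs t + i) ω)) P

namespace Run

variable {X : Type*} [MeasurableSpace X] {α β : Measure X} {η : ℕ → ℝ} {bs m : ℕ → ℕ}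
  {Ω : Type*} [MeasurableSpace Ω] {P : Measure Ω}

/-- The compressed potential `f̂_t`. -/
def fhat (R : Run α β η bs m P) (ε : ℝ) (C : X → X → ℝ) (t : ℕ) (ω : Ω) : X → ℝ :=
  atomicPotential ε C (R.qhat t ω) (R.yhat t ω)

/-- The compressed potential `ĝ_t`. -/
def ghat (R : Run α β η bs m P) (ε : ℝ) (C : X → X → ℝ) (t : ℕ) (ω : Ω) : X → ℝ :=
  atomicPotential ε (fun y x => C x y) (R.phat t ω) (R.xhat t ω)

/-- The potential `f_{t+1}` before compression, computed in iteration `t` from `f̂_t`, `ĝ_t` and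
a new batch of samples from `β`. -/
def fnext (R : Run α β η bs m P) (ε : ℝ) (C : X → X → ℝ) (t : ℕ) (ω : Ω) : X → ℝ :=
  onlineUpdate ε C (η t) (R.qhat t ω) (R.yhat t ω) (R.ghat ε C t ω)
    (fun j : Fin (bs t) => R.y (sampleCount bs t + j) ω)

/-- The potential `g_{t+1}` before compression, computed in iteration `t` from `ĝ_t`, `f_{t+1}`
and a new batch of samples from `α`. -/
def gnext (R : Run α β η bs m P) (ε : ℝ) (C : X → X → ℝ) (t : ℕ) (ω : Ω) : X → ℝ :=
  onlineUpdate ε (fun y x => C x y) (η t) (R.phat t ω) (R.xhat t ω) (R.fnext ε C t ω)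
    (fun j : Fin (bs t) => R.x (sampleCount bs t + j) ω)

/-- The compression errors are at most `K * m_t ^ (-ζ)` in supremum norm, almost surely. -/
def CompressionErrorBound (R : Run α β η bs m P) (ε : ℝ) (C : X → X → ℝ) (ζ K : ℝ) : Prop :=
  ∀ᵐ ω ∂P, ∀ t, 1 ≤ t →
    (∀ x, |R.fnext ε C t ω x - R.fhat ε C (t + 1) ω x| ≤ K * (m (t + 1) : ℝ) ^ (-ζ)) ∧
    (∀ y, |R.gnext ε C t ω y - R.ghat ε C (t + 1) ω y| ≤ K * (m (t + 1) : ℝ) ^ (-ζ))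

/-- `t(N)`: the first iteration number `t` for which `b_1 + ⋯ + b_t > N`. -/
def firstIter (bs : ℕ → ℕ) (N : ℕ) : ℕ := sInf {t : ℕ | N < ∑ i ∈ Finset.Icc 1 t, bs i}

/-- The error `‖(f̂_{t(N)} - f*) / ε‖_var + ‖(ĝ_{t(N)} - g*) / ε‖_var`. -/
def errorAt (R : Run α β η bs m P) (ε : ℝ) (C : X → X → ℝ) (fs gs : X → ℝ) (N : ℕ) (ω : Ω) : ℝ :=
  varNorm (fun x => (R.fhat ε C (firstIter bs N) ω x - fs x) / ε)
    + varNorm (fun y => (R.ghat ε C (firstIter bs N) ω y - gs y) / ε)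

end Run

/-- Learning rates `η_t = (t + s) ^ b`. -/
def stepSize (b : ℝ) (s t : ℕ) : ℝ := ((t + s : ℕ) : ℝ) ^ b

/-- Batch sizes `b_t = (t + s) ^ (2a)`, rounded up to an integer. -/
def batchSize (a : ℝ) (s t : ℕ) : ℕ := ⌈((t + s : ℕ) : ℝ) ^ (2 * a)⌉₊

/-- Compression sizes `m_t = t ^ ((a - b) / ζ)`, rounded up to an integer, for `t ≥ 2`; the
uncompressed initial state has `m_1 = b_1` points. -/
def compressionSize (a b ζ : ℝ) (s t : ℕ) : ℕ :=
  if t ≤ 1 then batchSize a s 1 else ⌈(t : ℝ) ^ ((a - b) / ζ)⌉₊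

end

end COS

/-! Write u = exp(-f/ε), v = exp(-g/ε), and us, vs for the same expressions in the optimal
potentials. In these variables a half-step is a convex combination: u becomes (1 - η) u + η q, where
q is an empirical version of ∫ k(x, y) / v(y) dμ(y) and k is the Gibbs kernel. The error is measured
by the least M such that the values of u/us differ by a factor of at most 1 + M; this ignores the
multiplicative constant up to which u is determined, and since log (1 + M) ≤ M it dominates the
variation seminorm.

The exact target, divided by us, is an average of vs/v against a probability kernel that is bounded
below, so it shrinks M by a factor 1 - c₀ (`integral_ratioLE_of_doeblin`). Mixing it in with weight
η shrinks M by 1 - ηc, provided that q is not negligible compared with u (`update_ratioLE`). This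
holds because u(x₀) v(x₀), which does not change under u ↦ λu, v ↦ v/λ, stays in a fixed interval:
each half-step averages it with a quantity confined by the kernel bounds, and compression moves it
by factors exp(±2δ_t) with ∑ δ_t finite, as b - a < -1. The scale need not converge. All iterates
are positive combinations of kernel sections, so they have an a priori ratio bound, which makes all
constants uniform (`fullStep`).

The sampling error is an empirical process over a Lipschitz family indexed by the compact space.
Chaining bounds its expected supremum by O(b_t^(-1/2)) = O(t^(-a)), also for a random integrand that
is independent of the batch (`integral_supDeviation_le`). A pathwise majorant of the error
(`relative_ratioLE_errorMajorant`) then has expectation d with d(t+1) ≤ (1 - c t^b) d(t) + C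
t^(b-a), and b > -1 gives d(t) = O(t^(-a)) (`exists_rate_of_recursion`). Since N samples are
exhausted after about N^(1/(2a+1)) iterations, the rate follows; the exponential term of the bound
is not even needed. -/

namespace COS

noncomputable section

/-! ### Uniform deviations of empirical means: sub-Gaussian bounds, dyadic nets, chaining. -/

/-- Maximal inequality for finitely many sub-Gaussian variables, with an explicit majorant. -/
theorem exists_majorant_of_subgaussian {Ω ι : Type*} [MeasurableSpace Ω] {P : Measure Ω}
    [IsProbabilityMeasure P] (S : Finset ι) (Z : ι → Ω → ℝ) {σ Λ : ℝ} (hσ : 0 < σ)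
    (hint : ∀ i ∈ S, ∀ t, Integrable (fun ω => Real.exp (t * Z i ω)) P)
    (hmgf : ∀ i ∈ S, ∀ t, mgf (Z i) P t ≤ Real.exp (σ ^ 2 * t ^ 2 / 2))
    (hS : (S.card : ℝ) ≤ Real.exp Λ) :
    ∃ G : Ω → ℝ, Integrable G P ∧ (∀ i ∈ S, ∀ ω, |Z i ω| ≤ G ω) ∧
      ∫ ω, G ω ∂P ≤ σ * (Λ + 2) := by
  have hσ' : σ ≠ 0 := hσ.ne'
  have hI : ∀ i ∈ S, Integrable (fun ω => Real.exp (σ⁻¹ * Z i ω) + Real.exp (-σ⁻¹ * Z i ω)) P :=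
    fun i hi => (hint i hi _).add (hint i hi _)
  have hsum := integrable_finsetSum S hI
  -- The majorant comes from y ≤ exp(y - (Λ + 2)) + Λ + 1 at y = |Z i| / σ, with the exponential
  -- replaced by the sum over all indices and both signs. The shift Λ + 2 makes the expectation of
  -- the exponential part at most 1, because card S · 2 exp(1/2) ≤ exp(Λ + 2). An explicit majorant,
  -- unlike a supremum, adds up over the levels of a chain without measurability questions.
  refine ⟨fun ω => σ * ((∑ i ∈ S, (Real.exp (σ⁻¹ * Z i ω) + Real.exp (-σ⁻¹ * Z i ω)))
    * Real.exp (-(Λ + 2)) + (Λ + 1)), ((hsum.mul_const _).add (integrable_const _)).const_mul _,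
    fun i hi ω => ?_, ?_⟩
  · have h1 : Real.exp (σ⁻¹ * |Z i ω|) ≤
        ∑ i ∈ S, (Real.exp (σ⁻¹ * Z i ω) + Real.exp (-σ⁻¹ * Z i ω)) := by
      refine le_trans ?_ (Finset.single_le_sum (f := fun i =>
        Real.exp (σ⁻¹ * Z i ω) + Real.exp (-σ⁻¹ * Z i ω)) (fun j _ => by positivity) hi)
      rcases abs_cases (Z i ω) with ⟨h, _⟩ | ⟨h, _⟩ <;> rw [h]
      · linarith [Real.exp_pos (-σ⁻¹ * Z i ω)]
      · rw [mul_neg, ← neg_mul]; linarith [Real.exp_pos (σ⁻¹ * Z i ω)]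
    have h2 := mul_le_mul_of_nonneg_right h1 (Real.exp_pos (-(Λ + 2))).le
    rw [← Real.exp_add] at h2
    have h3 := Real.add_one_le_exp (σ⁻¹ * |Z i ω| + -(Λ + 2))
    calc |Z i ω| = σ * (σ⁻¹ * |Z i ω|) := by field_simp
      _ ≤ _ := mul_le_mul_of_nonneg_left (by linarith) hσ.le
  · have hE : ∫ ω, ∑ i ∈ S, (Real.exp (σ⁻¹ * Z i ω) + Real.exp (-σ⁻¹ * Z i ω)) ∂P
        ≤ Real.exp (Λ + 2) := by
      rw [integral_finsetSum S hI]
      calc ∑ i ∈ S, ∫ ω, (Real.exp (σ⁻¹ * Z i ω) + Real.exp (-σ⁻¹ * Z i ω)) ∂P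
          ≤ ∑ i ∈ S, Real.exp 2 := by
            refine Finset.sum_le_sum fun i hi => ?_
            rw [integral_add (hint i hi _) (hint i hi _)]
            have h1 := hmgf i hi σ⁻¹
            have h2 := hmgf i hi (-σ⁻¹)
            have e : σ ^ 2 * σ⁻¹ ^ 2 / 2 = 1 / 2 := by field_simp
            rw [neg_sq] at h2
            rw [e] at h1 h2
            have h3 : Real.exp 2 = Real.exp (1 / 2) * Real.exp (3 / 2) := by
              rw [← Real.exp_add]; norm_num
            have h4 := Real.add_one_le_exp (3 / 2 : ℝ)
            have h5 := Real.exp_pos (1 / 2 : ℝ)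
            simp only [mgf] at h1 h2
            nlinarith
        _ ≤ Real.exp (Λ + 2) := by
            rw [Finset.sum_const, nsmul_eq_mul, Real.exp_add]; gcongr
    rw [integral_const_mul, integral_add (hsum.mul_const _) (integrable_const _),
      integral_mul_const]
    simp only [integral_const, probReal_univ, one_smul]
    have h2 := mul_le_mul_of_nonneg_right hE (Real.exp_pos (-(Λ + 2))).le
    rw [← Real.exp_add, add_neg_cancel, Real.exp_zero] at h2
    exact mul_le_mul_of_nonneg_left (by linarith) hσ.le

/-- The deviation of the empirical mean of `ψ` from its expectation. -/
def empiricalDeviation {Y : Type*} [MeasurableSpace Y] (μ : Measure Y) (ψ : Y → ℝ) {n : ℕ}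
    (ξ : Fin n → Y) : ℝ :=
  (∑ j, ψ (ξ j)) / n - ∫ y, ψ y ∂μ

theorem empiricalDeviation_sub {Y : Type*} [MeasurableSpace Y] {μ : Measure Y} {ψ ψ' : Y → ℝ}
    (h : Integrable ψ μ) (h' : Integrable ψ' μ) {n : ℕ} (ξ : Fin n → Y) :
    empiricalDeviation μ (fun y => ψ y - ψ' y) ξ
      = empiricalDeviation μ ψ ξ - empiricalDeviation μ ψ' ξ := by
  simp only [empiricalDeviation, Finset.sum_sub_distrib, integral_sub h h']
  ring

theorem abs_empiricalDeviation_le {Y : Type*} [MeasurableSpace Y] {μ : Measure Y}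
    [IsProbabilityMeasure μ] {ψ : Y → ℝ} {M : ℝ} (hM : ∀ y, |ψ y| ≤ M) {n : ℕ} (hn : 1 ≤ n)
    (ξ : Fin n → Y) : |empiricalDeviation μ ψ ξ| ≤ 2 * M := by
  have hn' : (0 : ℝ) < n := by exact_mod_cast hn
  have h1 : |(∑ j, ψ (ξ j)) / n| ≤ M := by
    rw [abs_div, abs_of_pos hn', div_le_iff₀ hn']
    refine (Finset.abs_sum_le_sum_abs _ _).trans ((Finset.sum_le_sum fun j _ => hM (ξ j)).trans ?_)
    simp [mul_comm]
  have h2 : |∫ y, ψ y ∂μ| ≤ M := by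
    have := norm_integral_le_of_norm_le_const (μ := μ) (f := ψ) (C := M)
      (Filter.Eventually.of_forall hM)
    simpa using this
  unfold empiricalDeviation
  exact (abs_sub _ _).trans (by linarith)

/-- Hoeffding: a variable with values in an interval of length 2M has variance proxy M², and
averaging n independent copies divides it by n. -/
theorem hasSubgaussianMGF_empiricalDeviation {Y : Type*} [MeasurableSpace Y] {μ : Measure Y}
    [IsProbabilityMeasure μ] {ψ : Y → ℝ} (hψ : Measurable ψ) {M : ℝ}
    (hM : ∀ y, |ψ y| ≤ M) {n : ℕ} (hn : 1 ≤ n) (t : ℝ) :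
    Integrable (fun ξ : Fin n → Y => Real.exp (t * empiricalDeviation μ ψ ξ))
        (Measure.pi fun _ => μ) ∧
      mgf (fun ξ : Fin n → Y => empiricalDeviation μ ψ ξ) (Measure.pi fun _ => μ) t
        ≤ Real.exp ((M / Real.sqrt n) ^ 2 * t ^ 2 / 2) := by
  have hn' : (0 : ℝ) < n := by exact_mod_cast hn
  have h1 := hasSubgaussianMGF_of_mem_Icc (μ := μ) (X := ψ) (a := -M) (b := M) hψ.aemeasurable
    (Filter.Eventually.of_forall fun y => abs_le.mp (hM y))
  have hind : iIndepFun (fun (i : Fin n) (ξ : Fin n → Y) => ψ (ξ i) - ∫ y, ψ y ∂μ)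
      (Measure.pi fun _ => μ) :=
    iIndepFun_pi (X := fun _ y => ψ y - ∫ y, ψ y ∂μ)
      (fun i => (hψ.sub measurable_const).aemeasurable)
  have h2 : ∀ i ∈ (Finset.univ : Finset (Fin n)), HasSubgaussianMGF
      (fun ξ : Fin n → Y => ψ (ξ i) - ∫ y, ψ y ∂μ) ((‖M - -M‖₊ / 2) ^ 2)
      (Measure.pi fun _ => μ) := by
    intro i _
    have := (measurePreserving_eval (fun _ : Fin n => μ) i)
    refine HasSubgaussianMGF.of_map (Y := Function.eval i) (X := fun y => ψ y - ∫ y, ψ y ∂μ)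
      this.measurable.aemeasurable ?_
    rw [this.map_eq]; exact h1
  have h3 := (HasSubgaussianMGF.sum_of_iIndepFun hind h2).const_mul (n : ℝ)⁻¹
  have e : (fun ξ : Fin n → Y => (n : ℝ)⁻¹ * ∑ i, (ψ (ξ i) - ∫ y, ψ y ∂μ))
      = fun ξ => empiricalDeviation μ ψ ξ := by
    ext ξ
    simp only [empiricalDeviation, Finset.sum_sub_distrib, Finset.sum_const, Finset.card_univ,
      Fintype.card_fin, nsmul_eq_mul]
    field_simp
  rw [e] at h3
  refine ⟨h3.integrable_exp_mul t, (h3.mgf_le t).trans_eq ?_⟩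
  congr 3
  have hM2 : M - -M = 2 * M := by ring
  change (n : ℝ)⁻¹ ^ 2 * ((∑ _i : Fin n, (‖M - -M‖₊ / 2) ^ 2 : ℝ≥0) : ℝ) = _
  simp only [Finset.sum_const, Finset.card_univ, Fintype.card_fin, nsmul_eq_mul, hM2]
  push_cast
  rw [Real.norm_eq_abs, div_pow, div_pow, sq_abs, Real.sq_sqrt hn'.le]
  field_simp

/-- Finite nets at all dyadic scales, of exponentially bounded size. -/
def HasDyadicNets (X : Type*) [PseudoMetricSpace X] (D : ℝ) : Prop :=
  ∀ j : ℕ, ∃ (π : X → X) (S : Finset X), (∀ x, π x ∈ S) ∧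
    (S.card : ℝ) ≤ Real.exp (D * (j + 1)) ∧ ∀ x, dist (π x) x ≤ D * (1 / 2) ^ j

/-- Cut space into cubes of side 2^(-j) and choose one point of the set in every cube that meets it.
A bounded set meets O(2^(jd)) cubes. -/
theorem exists_hasDyadicNets {d : ℕ} (𝒳 : Set (EuclideanSpace ℝ (Fin d)))
    (h𝒳 : Bornology.IsBounded 𝒳) : ∃ D : ℝ, 0 < D ∧ HasDyadicNets 𝒳 D := by
  classical
  obtain ⟨R, hR0, hR⟩ := h𝒳.exists_pos_norm_le
  refine ⟨d * (2 * R + 5) + 1, by positivity, fun j => ?_⟩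
  rcases isEmpty_or_nonempty 𝒳 with he | ⟨⟨x₀⟩⟩
  · exact ⟨id, ∅, fun x => he.elim x, by simp [Real.exp_nonneg], fun x => he.elim x⟩
  let cell : 𝒳 → Fin d → ℤ := fun x i => ⌊(2 : ℝ) ^ j * x.1 i⌋
  -- The default `x₀` is taken only at cells that miss the set, hence never at `cell x`.
  let rep : (Fin d → ℤ) → 𝒳 := fun c => if h : ∃ x, cell x = c then h.choose else x₀
  have hrep : ∀ x, cell (rep (cell x)) = cell x := by
    intro x
    have h : ∃ x', cell x' = cell x := ⟨x, rfl⟩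
    simp only [rep, dif_pos h]
    exact h.choose_spec
  let m : ℤ := ⌊(2 : ℝ) ^ j * R⌋ + 1
  let T : Finset (Fin d → ℤ) := Fintype.piFinset fun _ => Finset.Icc (-m) m
  have h2j : (0 : ℝ) < 2 ^ j := by positivity
  have hcell : ∀ x, cell x ∈ T := by
    intro x
    refine Fintype.mem_piFinset.2 fun i => Finset.mem_Icc.2 ?_
    have h1 : |x.1 i| ≤ R := (PiLp.norm_apply_le x.1 i).trans (hR x.1 x.2)
    have h2 := abs_le.1 h1
    constructor
    · rw [Int.le_floor]
      simp only [m]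
      push_cast
      have := Int.lt_floor_add_one ((2 : ℝ) ^ j * R)
      nlinarith
    · have : cell x i ≤ ⌊(2 : ℝ) ^ j * R⌋ := Int.floor_le_floor (by nlinarith)
      simp only [m]; linarith
  refine ⟨fun x => rep (cell x), T.image rep, fun x => Finset.mem_image_of_mem _ (hcell x), ?_, ?_⟩
  · have hm0 : 0 ≤ m := by
      have : 0 ≤ ⌊(2 : ℝ) ^ j * R⌋ := Int.floor_nonneg.2 (by positivity)
      simp only [m]; linarith
    have hcard : (T.card : ℝ) = (2 * m + 1 : ℝ) ^ d := by
      simp only [T, Fintype.card_piFinset, Int.card_Icc, Finset.prod_const, Finset.card_univ,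
        Fintype.card_fin]
      push_cast
      congr 1
      have : (((m + 1 - -m).toNat : ℤ) : ℝ) = ((m + 1 - -m : ℤ) : ℝ) := by
        rw [Int.toNat_of_nonneg (by linarith)]
      rw [← Int.cast_natCast, this]; push_cast; ring
    have hm : (2 * m + 1 : ℝ) ≤ Real.exp ((2 * R + 5) * (j + 1)) := by
      have h1 : (m : ℝ) ≤ 2 ^ j * R + 1 := by
        simp only [m]; push_cast; linarith [Int.floor_le ((2 : ℝ) ^ j * R)]
      have h3 : (1 : ℝ) ≤ 2 ^ j := one_le_pow₀ (by norm_num)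
      have h4 : (2 : ℝ) ^ j ≤ Real.exp j := by
        rw [← Real.exp_one_pow]
        gcongr
        linarith [Real.add_one_le_exp 1]
      calc (2 * m + 1 : ℝ) ≤ 2 ^ j * (2 * R + 5) := by nlinarith
        _ ≤ Real.exp j * Real.exp (2 * R + 5) := by
          gcongr; linarith [Real.add_one_le_exp (2 * R + 5)]
        _ = Real.exp (j + (2 * R + 5)) := (Real.exp_add _ _).symm
        _ ≤ _ := by
          gcongr
          have : (0 : ℝ) ≤ j := by positivity
          nlinarith
    calc ((T.image rep).card : ℝ) ≤ T.card := by exact_mod_cast Finset.card_image_le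
      _ ≤ Real.exp ((2 * R + 5) * (j + 1)) ^ d := by
        rw [hcard]
        have : (0 : ℝ) ≤ m := by exact_mod_cast hm0
        gcongr
      _ = Real.exp (d * ((2 * R + 5) * (j + 1))) := (Real.exp_nat_mul _ _).symm
      _ ≤ _ := Real.exp_le_exp.2 (by
        have : (0 : ℝ) ≤ j := by positivity
        nlinarith)
  · intro x
    have hi : ∀ i, |(rep (cell x)).1 i - x.1 i| ≤ (1 / 2) ^ j := by
      intro i
      have h1 : ⌊(2 : ℝ) ^ j * (rep (cell x)).1 i⌋ = ⌊(2 : ℝ) ^ j * x.1 i⌋ := congrFun (hrep x) i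
      have h2 := Int.abs_sub_lt_one_of_floor_eq_floor h1
      rw [← mul_sub, abs_mul, abs_of_pos h2j] at h2
      rw [one_div, inv_pow, ← one_div, le_div_iff₀ h2j]
      linarith
    rw [Subtype.dist_eq, EuclideanSpace.dist_eq]
    have hsum : ∑ i, dist ((rep (cell x)).1 i) (x.1 i) ^ 2 ≤ (d * (1 / 2) ^ j) ^ 2 := by
      calc ∑ i, dist ((rep (cell x)).1 i) (x.1 i) ^ 2 ≤ ∑ _i : Fin d, ((1 / 2 : ℝ) ^ j) ^ 2 := by
            gcongr with i; rw [Real.dist_eq]; exact hi i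
        _ = d * ((1 / 2 : ℝ) ^ j) ^ 2 := by simp
        _ ≤ _ := by
            rw [mul_pow]
            gcongr
            exact_mod_cast Nat.le_self_pow two_ne_zero d
    refine (Real.sqrt_le_left (by positivity)).2 hsum |>.trans ?_
    gcongr
    nlinarith [Nat.cast_nonneg (α := ℝ) d]

/-- Chaining: the empirical process indexed by a Lipschitz family has size `O(n ^ (-1/2))`. -/
theorem exists_majorant_empiricalDeviation {X : Type*} [PseudoMetricSpace X] {D M : ℝ}
    (hD : 0 < D) (hM : 0 < M) (hX : HasDyadicNets X D) :
    ∃ c : ℝ, 0 < c ∧ ∀ (Y : Type*) [MeasurableSpace Y] (μ : Measure Y) [IsProbabilityMeasure μ]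
      (ψ : X → Y → ℝ), (∀ x, Measurable (ψ x)) → (∀ x y, |ψ x y| ≤ M) →
      (∀ x x' y, |ψ x y - ψ x' y| ≤ M * dist x x') → ∀ n : ℕ, 1 ≤ n →
      ∃ G : (Fin n → Y) → ℝ, Integrable G (Measure.pi fun _ => μ) ∧
        (∀ x ξ, |empiricalDeviation μ (ψ x) ξ| ≤ G ξ) ∧
        ∫ ξ, G ξ ∂(Measure.pi fun _ => μ) ≤ c / Real.sqrt n := by
  choose π S hS hcard hdist using hX
  let w : ℕ → ℝ := fun j => 2 * M * D * (1 / 2) ^ j * (D * (2 * j + 3) + 2)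
  have hw0 : ∀ j, 0 ≤ w j := fun j => by positivity
  have hw : Summable w := by
    have h1 := summable_pow_mul_geometric_of_norm_lt_one (R := ℝ) 1 (r := 1 / 2) (by norm_num)
    have h0 := summable_geometric_of_lt_one (r := (1 / 2 : ℝ)) (by norm_num) (by norm_num)
    refine ((h1.mul_left (4 * M * D * D)).add (h0.mul_left (2 * M * D * (3 * D + 2)))).congr ?_
    intro j; simp only [w]; ring
  -- The three summands pay for the coarsest net, for the links of the chain, and for cutting the
  -- chain off at a finite level.
  refine ⟨M * (D + 2) + ∑' j, w j + 1, by have : 0 ≤ ∑' j, w j := tsum_nonneg hw0; positivity, ?_⟩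
  intro Y _ μ _ ψ hψ hψM hψL n hn
  have hn' : (0 : ℝ) < n := by exact_mod_cast hn
  have hsn : 0 < Real.sqrt n := Real.sqrt_pos.2 hn'
  have hint : ∀ x, Integrable (ψ x) μ := fun x =>
    Integrable.of_bound (hψ x).aestronglyMeasurable M (Filter.Eventually.of_forall (hψM x))
  obtain ⟨G₀, hG₀i, hG₀, hG₀I⟩ := exists_majorant_of_subgaussian (P := Measure.pi fun _ : Fin n => μ)
    (S 0) (fun x ξ => empiricalDeviation μ (ψ x) ξ) (σ := M / Real.sqrt n) (Λ := D)
    (by positivity)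
    (fun x _ t => (hasSubgaussianMGF_empiricalDeviation (hψ x) (hψM x) hn t).1)
    (fun x _ t => (hasSubgaussianMGF_empiricalDeviation (hψ x) (hψM x) hn t).2)
    (by simpa using hcard 0)
  have hstep : ∀ j : ℕ, ∃ G : (Fin n → Y) → ℝ, Integrable G (Measure.pi fun _ => μ) ∧
      (∀ x ξ, |empiricalDeviation μ (ψ (π (j + 1) x)) ξ - empiricalDeviation μ (ψ (π j x)) ξ|
        ≤ G ξ) ∧ ∫ ξ, G ξ ∂(Measure.pi fun _ => μ) ≤ w j / Real.sqrt n := by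
    intro j
    -- Only pairs close enough to be consecutive points of a chain are kept: for them the increment
    -- is at most 2MD·2^(-j), while their number is still at most exp(D(2j + 3)). The geometric
    -- decay beats the linear growth of the exponent, so `w` is summable.
    let Q : Finset (X × X) := (S (j + 1) ×ˢ S j).filter fun p => dist p.1 p.2 ≤ 2 * D * (1 / 2) ^ j
    have hb : ∀ p ∈ Q, ∀ y, |ψ p.1 y - ψ p.2 y| ≤ 2 * M * D * (1 / 2) ^ j := by
      intro p hp y
      refine (hψL _ _ _).trans ?_
      have := (Finset.mem_filter.1 hp).2
      calc M * dist p.1 p.2 ≤ M * (2 * D * (1 / 2) ^ j) := by gcongr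
        _ = _ := by ring
    obtain ⟨G, hGi, hG, hGI⟩ := exists_majorant_of_subgaussian
      (P := Measure.pi fun _ : Fin n => μ) Q
      (fun p ξ => empiricalDeviation μ (fun y => ψ p.1 y - ψ p.2 y) ξ)
      (σ := 2 * M * D * (1 / 2) ^ j / Real.sqrt n) (Λ := D * (2 * j + 3))
      (by positivity)
      (fun p hp t => (hasSubgaussianMGF_empiricalDeviation ((hψ _).sub (hψ _)) (hb p hp) hn t).1)
      (fun p hp t => (hasSubgaussianMGF_empiricalDeviation ((hψ _).sub (hψ _)) (hb p hp) hn t).2)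
      (by
        calc (Q.card : ℝ) ≤ ((S (j + 1)).card * (S j).card : ℝ) := by
              exact_mod_cast (Finset.card_filter_le _ _).trans_eq (Finset.card_product _ _)
          _ ≤ Real.exp (D * ((j + 1 : ℕ) + 1)) * Real.exp (D * (j + 1)) := by
              gcongr
              · exact hcard _
              · exact hcard _
          _ = _ := by rw [← Real.exp_add]; congr 1; push_cast; ring)
    refine ⟨G, hGi, fun x ξ => ?_, hGI.trans_eq (by simp only [w]; ring)⟩
    have hmem : (π (j + 1) x, π j x) ∈ Q := by
      refine Finset.mem_filter.2 ⟨Finset.mk_mem_product (hS _ _) (hS _ _), ?_⟩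
      refine (dist_triangle_right _ _ x).trans ?_
      have h1 := hdist (j + 1) x
      have h2 := hdist j x
      have h3 : D * (1 / 2) ^ (j + 1) ≤ D * (1 / 2) ^ j := by
        gcongr ?_ * ?_
        exact pow_le_pow_of_le_one (by norm_num) (by norm_num) (Nat.le_succ j)
      simp only; linarith
    have := hG _ hmem ξ
    rwa [empiricalDeviation_sub (hint _) (hint _)] at this
  choose G hGi hG hGI using hstep
  -- At this level, which depends on `n` but not on the point, the remaining deviation is
  -- deterministically below n^(-1/2), so no limit of chains has to be taken.
  obtain ⟨J, hJ⟩ : ∃ J : ℕ, (1 / 2 : ℝ) ^ J < 1 / (Real.sqrt n * (2 * M * D)) :=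
    exists_pow_lt_of_lt_one (by positivity) (by norm_num)
  have hsi : Integrable (fun ξ => ∑ j ∈ Finset.range J, G j ξ) (Measure.pi fun _ : Fin n => μ) :=
    integrable_finsetSum _ fun j _ => hGi j
  refine ⟨fun ξ => G₀ ξ + ∑ j ∈ Finset.range J, G j ξ + 1 / Real.sqrt n,
    (hG₀i.add hsi).add (integrable_const _), fun x ξ => ?_, ?_⟩
  · have hch : ∀ J : ℕ, |empiricalDeviation μ (ψ (π J x)) ξ| ≤
        G₀ ξ + ∑ j ∈ Finset.range J, G j ξ := by
      intro J
      induction J with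
      | zero => simpa using hG₀ _ (hS 0 x) ξ
      | succ J ih =>
        rw [Finset.sum_range_succ]
        have := hG J x ξ
        have h2 := abs_sub_abs_le_abs_sub (empiricalDeviation μ (ψ (π (J + 1) x)) ξ)
          (empiricalDeviation μ (ψ (π J x)) ξ)
        linarith
    have htail : |empiricalDeviation μ (ψ x) ξ - empiricalDeviation μ (ψ (π J x)) ξ|
        ≤ 1 / Real.sqrt n := by
      rw [← empiricalDeviation_sub (hint _) (hint _)]
      refine (abs_empiricalDeviation_le (M := M * (D * (1 / 2) ^ J)) (fun y => ?_) hn ξ).trans ?_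
      · refine (hψL _ _ _).trans ?_
        rw [dist_comm]
        have := hdist J x
        gcongr
      · rw [lt_div_iff₀ (by positivity)] at hJ
        rw [le_div_iff₀ hsn]
        nlinarith
    have h2 := abs_sub_abs_le_abs_sub (empiricalDeviation μ (ψ x) ξ)
      (empiricalDeviation μ (ψ (π J x)) ξ)
    have := hch J
    simp only
    linarith
  · have hadd : Integrable (fun ξ => G₀ ξ + ∑ j ∈ Finset.range J, G j ξ)
        (Measure.pi fun _ : Fin n => μ) := hG₀i.add hsi
    rw [integral_add hadd (integrable_const _), integral_add hG₀i hsi,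
      integral_finsetSum _ fun j _ => hGi j]
    simp only [integral_const, probReal_univ, one_smul]
    have h1 : ∑ j ∈ Finset.range J, ∫ ξ, G j ξ ∂(Measure.pi fun _ => μ)
        ≤ (∑' j, w j) / Real.sqrt n := by
      refine (Finset.sum_le_sum fun j _ => hGI j).trans ?_
      rw [← Finset.sum_div]
      gcongr
      exact hw.sum_le_tsum _ fun j _ => hw0 j
    have h2 : (M * (D + 2) + ∑' j, w j + 1) / Real.sqrt n
        = M / Real.sqrt n * (D + 2) + (∑' j, w j) / Real.sqrt n + 1 / Real.sqrt n := by
      ring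
    rw [h2]
    linarith

/-! ### Oscillation as a ratio: contraction, perturbed updates, compression. -/

/-- The values of `u` differ by a factor of at most `R`. -/
def RatioLE {X : Type*} (u : X → ℝ) (R : ℝ) : Prop := ∀ x x', u x ≤ R * u x'

theorem RatioLE.mono {X : Type*} {u : X → ℝ} {R R' : ℝ} (h : RatioLE u R) (hu : ∀ x, 0 ≤ u x)
    (hR : R ≤ R') : RatioLE u R' := fun x x' =>
  (h x x').trans (mul_le_mul_of_nonneg_right hR (hu x'))

theorem RatioLE.div {X : Type*} {u w : X → ℝ} {R R' : ℝ} (h : RatioLE u R) (h' : RatioLE w R')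
    (hw : ∀ x, 0 < w x) (hu : ∀ x, 0 ≤ u x) (hR : 0 ≤ R) :
    RatioLE (fun x => u x / w x) (R * R') := by
  intro x x'
  simp only
  rw [mul_div_assoc', div_le_div_iff₀ (hw x) (hw x')]
  calc u x * w x' ≤ (R * u x') * (R' * w x) :=
        mul_le_mul (h x x') (h' x' x) (hw x').le (mul_nonneg hR (hu x'))
    _ = _ := by ring

theorem RatioLE.inv {X : Type*} {w : X → ℝ} {R : ℝ} (h : RatioLE w R) (hw : ∀ x, 0 < w x) :
    RatioLE (fun x => (w x)⁻¹) R := by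
  intro x x'
  simp only
  rw [← one_div, ← one_div, mul_one_div, div_le_div_iff₀ (hw x) (hw x')]
  simpa using h x' x

/-- An averaging operator whose kernel is bounded below by `c₀` contracts oscillations. -/
theorem integral_ratioLE_of_doeblin {X Y : Type*} [Nonempty X] [MeasurableSpace Y] {μ : Measure Y}
    [IsProbabilityMeasure μ] {π : X → Y → ℝ} {h : Y → ℝ} {c₀ M : ℝ}
    (hπi : ∀ x, Integrable (π x) μ) (hπ : ∀ x y, c₀ ≤ π x y) (hπ1 : ∀ x, ∫ y, π x y ∂μ = 1)
    (hhi : Integrable h μ) (hπhi : ∀ x, Integrable (fun y => π x y * h y) μ)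
    (hh : ∀ y, 0 < h y) (hM : 0 ≤ M) (hr : RatioLE h (1 + M)) (hc₀ : 0 ≤ c₀) :
    c₀ ≤ 1 ∧ RatioLE (fun x => ∫ y, π x y * h y ∂μ) (1 + (1 - c₀) * M) := by
  have hne : Nonempty Y := nonempty_of_isProbabilityMeasure μ
  obtain ⟨x₀⟩ := ‹Nonempty X›
  have hc1 : c₀ ≤ 1 := by
    have := integral_mono (integrable_const c₀) (hπi x₀) (hπ x₀)
    simpa [hπ1] using this
  refine ⟨hc1, fun x x' => ?_⟩
  have hbdd : BddBelow (Set.range h) := ⟨0, by rintro _ ⟨y, rfl⟩; exact (hh y).le⟩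
  set m := ⨅ y, h y
  have hm : ∀ y, m ≤ h y := ciInf_le hbdd
  have hm' : ∀ y, h y ≤ (1 + M) * m := by
    intro y
    rw [← div_le_iff₀' (by linarith)]
    refine le_ciInf fun y' => ?_
    rw [div_le_iff₀' (by linarith)]
    exact hr y y'
  -- The part c₀ ∫ h of the average is common to all x. Only the remaining mass 1 - c₀ sees the
  -- oscillation of h, and it contributes at most (1 - c₀) M m to a difference of two averages,
  -- where m is the infimum of h and hence a lower bound for every average.
  have key : ∀ x, ∫ y, (π x y - c₀) * h y ∂μ = ∫ y, π x y * h y ∂μ - c₀ * ∫ y, h y ∂μ := by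
    intro x
    simp only [sub_mul]
    rw [integral_sub (hπhi x) (hhi.const_mul _), integral_const_mul]
  have keyi : ∀ x, Integrable (fun y => (π x y - c₀) * h y) μ := by
    intro x
    simp only [sub_mul]
    exact (hπhi x).sub (hhi.const_mul _)
  have mass : ∀ x (a : ℝ), ∫ y, (π x y - c₀) * a ∂μ = (1 - c₀) * a := by
    intro x a
    rw [integral_mul_const, integral_sub (hπi x) (integrable_const _), hπ1]
    simp
  have massi : ∀ x (a : ℝ), Integrable (fun y => (π x y - c₀) * a) μ := fun x a =>
    ((hπi x).sub (integrable_const _)).mul_const a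
  have up := integral_mono (keyi x) (massi x ((1 + M) * m)) fun y =>
    mul_le_mul_of_nonneg_left (hm' y) (sub_nonneg.2 (hπ x y))
  have lo := integral_mono (massi x' m) (keyi x') fun y =>
    mul_le_mul_of_nonneg_left (hm y) (sub_nonneg.2 (hπ x' y))
  have lo2 : m ≤ ∫ y, π x' y * h y ∂μ := by
    have := integral_mono ((hπi x').mul_const m) (hπhi x') fun y =>
      mul_le_mul_of_nonneg_left (hm y) (hc₀.trans (hπ x' y))
    rwa [integral_mul_const, hπ1, one_mul] at this
  rw [mass, key] at up lo
  have := mul_le_mul_of_nonneg_left lo2 (mul_nonneg (sub_nonneg.2 hc1) hM)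
  simp only
  nlinarith

/-- The effect of an averaged update with perturbed target on oscillations relative to `us`. -/
theorem update_ratioLE {X : Type*} {u q qt us : X → ℝ} {η M Mm c₀ σ₁ σ₂ v₀ e l Φ lam : ℝ}
    (hη0 : 0 ≤ η) (hη1 : η ≤ 1) (hM0 : 0 ≤ M) (hMm : M ≤ Mm) (hσ₁ : 0 < σ₁)
    (hus : ∀ x, σ₁ ≤ us x) (hus' : ∀ x, us x ≤ σ₂) (hv₀ : 0 < v₀) (hc₀ : 0 ≤ c₀) (hc₀1 : c₀ ≤ 1)
    (hr : RatioLE (fun x => u x / us x) (1 + M))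
    (hq : RatioLE (fun x => q x / us x) (1 + (1 - c₀) * M))
    (he : ∀ x, |qt x - q x| * v₀ ≤ e) (hl0 : 0 ≤ l) (hl : ∀ x, l ≤ qt x * v₀)
    (hΦ : ∀ x, ((1 - η) * u x + η * qt x) * v₀ ≤ Φ) (hlam0 : 0 < lam)
    (hlam : ∀ x, lam ≤ ((1 - η) * u x + η * qt x) * v₀) :
    RatioLE (fun x => ((1 - η) * u x + η * qt x) / us x)
      (1 + (M * (1 - η * (c₀ * l / Φ)) + η * ((2 + Mm) * σ₂ / (σ₁ * lam)) * e)) := by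
  intro x x'
  have hx := hσ₁.trans_le (hus x)
  have hx' := hσ₁.trans_le (hus x')
  have hΦ0 : 0 < Φ := hlam0.trans_le ((hlam x).trans (hΦ x))
  have he0 : 0 ≤ e := (mul_nonneg (abs_nonneg _) hv₀.le).trans (he x)
  have hM1 : (1 - c₀) * M ≤ Mm := by nlinarith
  have hM2 : 0 ≤ (1 - c₀) * M := mul_nonneg (sub_nonneg.2 hc₀1) hM0
  have hee : ∀ z, |qt z / us z - q z / us z| ≤ e / v₀ / σ₁ := by
    intro z
    have hz := hσ₁.trans_le (hus z)
    rw [← sub_div, abs_div, abs_of_pos hz]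
    exact div_le_div₀ (by positivity) ((le_div_iff₀ hv₀).2 (he z)) hσ₁ (hus z)
  have h1 := hr x x'
  have h2 := hq x x'
  simp only at h1 h2
  have e1 := abs_le.1 (hee x)
  have e2 := abs_le.1 (hee x')
  set W := ((1 - η) * u x' + η * qt x') / us x' with hW
  -- The additive sampling error becomes a multiple of the updated value W, as a ratio bound
  -- requires; this is where the lower bound on the scale enters.
  have h3 : e / v₀ / σ₁ ≤ σ₂ / (σ₁ * lam) * e * W := by
    have : lam / v₀ ≤ W * σ₂ := by
      rw [div_le_iff₀ hv₀]
      have hW0 : 0 < W := by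
        refine div_pos ?_ hx'
        have := hlam0.trans_le (hlam x')
        exact pos_of_mul_pos_left this hv₀.le
      calc lam ≤ ((1 - η) * u x' + η * qt x') * v₀ := hlam x'
        _ = W * us x' * v₀ := by rw [hW]; field_simp
        _ ≤ W * σ₂ * v₀ := by
          have := hus' x'
          gcongr
    calc e / v₀ / σ₁ = e / (σ₁ * lam) * (lam / v₀) := by field_simp
      _ ≤ e / (σ₁ * lam) * (W * σ₂) := by gcongr
      _ = _ := by ring
  -- The target makes up at least the fraction l/Φ of the updated value. So the gain, which is at
  -- first proportional to the target, is proportional to W.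
  have h4 : l / Φ * W ≤ qt x' / us x' := by
    rw [hW, mul_div_assoc', div_le_div_iff_of_pos_right hx', div_mul_eq_mul_div, div_le_iff₀ hΦ0]
    have h5 := hl x'
    have h6 := hΦ x'
    have h7 : 0 ≤ qt x' * v₀ := hl0.trans h5
    have : l * ((1 - η) * u x' + η * qt x') * v₀ ≤ qt x' * Φ * v₀ := by
      calc l * ((1 - η) * u x' + η * qt x') * v₀ = l * (((1 - η) * u x' + η * qt x') * v₀) := by
            ring
        _ ≤ (qt x' * v₀) * Φ := mul_le_mul h5 h6 (hlam0.le.trans (hlam x')) h7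
        _ = _ := by ring
    exact le_of_mul_le_mul_right this hv₀
  -- Passing from q to qt costs one error at x and 1 + (1 - c₀)M errors at x', in all at most 2 +
  -- Mm.
  have h8 : qt x / us x ≤ (1 + (1 - c₀) * M) * (qt x' / us x') + (2 + Mm) * (e / v₀ / σ₁) := by
    have hpos : 0 ≤ e / v₀ / σ₁ := by positivity
    have h9 : (1 + (1 - c₀) * M) * (q x' / us x')
        ≤ (1 + (1 - c₀) * M) * (qt x' / us x' + e / v₀ / σ₁) := by
      gcongr; linarith
    have h10 := mul_le_mul_of_nonneg_right hM1 hpos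
    linarith
  have eW : W = (1 - η) * (u x' / us x') + η * (qt x' / us x') := by rw [hW]; ring
  have eL : ((1 - η) * u x + η * qt x) / us x = (1 - η) * (u x / us x) + η * (qt x / us x) := by
    ring
  have h11 := mul_le_mul_of_nonneg_left h1 (sub_nonneg.2 hη1)
  have h12 := mul_le_mul_of_nonneg_left h8 hη0
  have h13 := mul_le_mul_of_nonneg_left h3 (mul_nonneg hη0 (by linarith : 0 ≤ 2 + Mm))
  have h14 := mul_le_mul_of_nonneg_left h4 (mul_nonneg hη0 (mul_nonneg hc₀ hM0))
  simp only
  rw [eL]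
  calc (1 - η) * (u x / us x) + η * (qt x / us x)
      ≤ (1 + M) * W - η * (c₀ * M) * (qt x' / us x') + η * (2 + Mm) * (e / v₀ / σ₁) := by
        rw [eW]; linarith
    _ ≤ (1 + M) * W - η * (c₀ * M) * (l / Φ * W) + η * (2 + Mm) * (σ₂ / (σ₁ * lam) * e * W) := by
        linarith
    _ = _ := by ring

/-- A factor within exp(±δ) at every point multiplies the ratio by at most exp(2δ), and exp(2δ) - 1
≤ 2δ exp(2Δ). The a priori bound Mm keeps the coefficient of δ independent of M. -/
theorem ratioLE_of_compression {X : Type*} {u uh us : X → ℝ} {M Mm δ Δ : ℝ} (hM : 0 ≤ M)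
    (hMm : 0 ≤ Mm) (hδ : 0 ≤ δ) (hδΔ : δ ≤ Δ) (hus : ∀ x, 0 < us x) (hu : ∀ x, 0 < u x)
    (h : RatioLE (fun x => u x / us x) (1 + M)) (h' : RatioLE (fun x => u x / us x) (1 + Mm))
    (h1 : ∀ x, uh x ≤ Real.exp δ * u x) (h2 : ∀ x, u x ≤ Real.exp δ * uh x) :
    RatioLE (fun x => uh x / us x) (1 + (M + 2 * Real.exp (2 * Δ) * (1 + Mm) * δ)) := by
  intro x x'
  simp only
  have hm : u x / us x ≤ (1 + min M Mm) * (u x' / us x') := by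
    rcases min_cases M Mm with ⟨e, _⟩ | ⟨e, _⟩ <;> rw [e]
    · exact h x x'
    · exact h' x x'
  have hm0 : 0 ≤ min M Mm := le_min hM hMm
  have huh : 0 ≤ uh x' := (pos_of_mul_pos_right ((hu x').trans_le (h2 x')) (Real.exp_pos _).le).le
  have hexp : Real.exp (2 * δ) - 1 ≤ 2 * δ * Real.exp (2 * Δ) := by
    have a1 := Real.add_one_le_exp (-(2 * δ))
    have a2 : Real.exp (-(2 * δ)) * Real.exp (2 * δ) = 1 := by
      rw [← Real.exp_add]; simp
    have a3 : Real.exp (2 * δ) ≤ Real.exp (2 * Δ) := Real.exp_le_exp.2 (by linarith)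
    have a4 := mul_le_mul_of_nonneg_right a1 (Real.exp_pos (2 * δ)).le
    have a5 := mul_le_mul_of_nonneg_left a3 (mul_nonneg zero_le_two hδ)
    linarith
  have hexp0 : 0 ≤ Real.exp (2 * δ) - 1 := by
    linarith [Real.add_one_le_exp (2 * δ)]
  calc uh x / us x ≤ (Real.exp δ * u x) / us x :=
        div_le_div_of_nonneg_right (h1 x) (hus x).le
    _ = Real.exp δ * (u x / us x) := by ring
    _ ≤ Real.exp δ * ((1 + min M Mm) * (u x' / us x')) := by gcongr
    _ ≤ Real.exp δ * ((1 + min M Mm) * ((Real.exp δ * uh x') / us x')) := by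
        have := div_le_div_of_nonneg_right (h2 x') (hus x').le
        gcongr
    _ = (Real.exp δ * Real.exp δ) * (1 + min M Mm) * (uh x' / us x') := by ring
    _ = (1 + (min M Mm + (Real.exp (2 * δ) - 1) * (1 + min M Mm))) * (uh x' / us x') := by
        rw [← Real.exp_add, ← two_mul]; ring
    _ ≤ _ := by
        refine mul_le_mul_of_nonneg_right ?_ (div_nonneg huh (hus x').le)
        have b1 : (Real.exp (2 * δ) - 1) * (1 + min M Mm)
            ≤ (2 * δ * Real.exp (2 * Δ)) * (1 + Mm) :=
          mul_le_mul hexp (by linarith [min_le_right M Mm]) (by linarith) (hexp0.trans hexp)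
        linarith [min_le_left M Mm]

/-- The logarithm turns the ratio 1 + M into an oscillation log (1 + M) ≤ M. -/
theorem varNorm_le_of_ratioLE {X : Type*} [Nonempty X] {u us f fs : X → ℝ} {ε M : ℝ}
    (hε : 0 < ε) (hM : 0 ≤ M) (hu : ∀ x, 0 < u x) (hus : ∀ x, 0 < us x)
    (hf : ∀ x, f x = -ε * Real.log (u x)) (hfs : ∀ x, fs x = -ε * Real.log (us x))
    (h : RatioLE (fun x => u x / us x) (1 + M)) :
    varNorm (fun x => (f x - fs x) / ε) ≤ M := by
  have e : ∀ x, (f x - fs x) / ε = -Real.log (u x / us x) := by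
    intro x
    rw [hf, hfs, Real.log_div (hu x).ne' (hus x).ne']
    field_simp
    ring
  have hd : ∀ x x', (f x - fs x) / ε ≤ M + (f x' - fs x') / ε := by
    intro x x'
    rw [e, e]
    have hp : ∀ z, 0 < u z / us z := fun z => div_pos (hu z) (hus z)
    have h1 := Real.log_le_log (hp x') (h x' x)
    rw [Real.log_mul (by linarith) (hp x).ne'] at h1
    have h2 := Real.log_le_sub_one_of_pos (by linarith : 0 < 1 + M)
    linarith
  unfold varNorm
  have h1 : (⨆ x, (f x - fs x) / ε) - M ≤ ⨅ x, (f x - fs x) / ε :=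
    le_ciInf fun x' => by linarith [ciSup_le fun x => hd x x']
  linarith

/-! ### One step of the algorithm in exponential variables. -/

/-- One of the two exponentiated optimality relations, `us x = ∫ k x y / vs y dμ(y)`, together
with uniform bounds for the kernel `k` and for the potentials. -/
structure IsScalingPair {X : Type*} [MeasurableSpace X] (μ : Measure X) (k : X → X → ℝ)
    (us vs : X → ℝ) (κ₁ κ₂ σ₁ σ₂ : ℝ) : Prop where
  κ₁_pos : 0 < κ₁
  σ₁_pos : 0 < σ₁
  le_kernel : ∀ x y, κ₁ ≤ k x y
  kernel_le : ∀ x y, k x y ≤ κ₂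
  measurable_kernel : ∀ x, Measurable (k x)
  measurable_right : Measurable vs
  le_left : ∀ x, σ₁ ≤ us x
  left_le : ∀ x, us x ≤ σ₂
  le_right : ∀ x, σ₁ ≤ vs x
  right_le : ∀ x, vs x ≤ σ₂
  left_eq : ∀ x, us x = ∫ y, k x y / vs y ∂μ

/-- The empirical version of `x ↦ ∫ k x y / v y dμ(y)`. -/
def empiricalTarget {X : Type*} (k : X → X → ℝ) (v : X → ℝ) {n : ℕ} (ξ : Fin n → X) (x : X) : ℝ :=
  (∑ j, k x (ξ j) / v (ξ j)) / n

/-- The contraction rate of one step. -/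
def contractionRate (κ₁ κ₂ σ₂ Phi : ℝ) : ℝ :=
  (κ₁ / (σ₂ * σ₂)) * (κ₁ / (κ₂ / κ₁)) / ((κ₂ / κ₁) * Phi)

/-- An a priori bound for relative oscillations. -/
def oscBound (κ₁ κ₂ σ₁ σ₂ : ℝ) : ℝ := (κ₂ / κ₁) * (σ₂ / σ₁)

/-- The factor with which the sampling error enters in one step. -/
def noiseGain (κ₁ κ₂ σ₁ σ₂ Plo : ℝ) : ℝ :=
  (2 + oscBound κ₁ κ₂ σ₁ σ₂) * σ₂ / (σ₁ * (Plo / (κ₂ / κ₁)))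

namespace IsScalingPair

variable {X : Type*} [MeasurableSpace X] {μ : Measure X} {k : X → X → ℝ} {us vs : X → ℝ}
  {κ₁ κ₂ σ₁ σ₂ : ℝ}

theorem κ₁_le (H : IsScalingPair μ k us vs κ₁ κ₂ σ₁ σ₂) (x : X) : κ₁ ≤ κ₂ :=
  (H.le_kernel x x).trans (H.kernel_le x x)

theorem σ₁_le (H : IsScalingPair μ k us vs κ₁ κ₂ σ₁ σ₂) (x : X) : σ₁ ≤ σ₂ :=
  (H.le_left x).trans (H.left_le x)

theorem left_pos (H : IsScalingPair μ k us vs κ₁ κ₂ σ₁ σ₂) (x : X) : 0 < us x :=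
  H.σ₁_pos.trans_le (H.le_left x)

theorem right_pos (H : IsScalingPair μ k us vs κ₁ κ₂ σ₁ σ₂) (x : X) : 0 < vs x :=
  H.σ₁_pos.trans_le (H.le_right x)

theorem kernel_pos (H : IsScalingPair μ k us vs κ₁ κ₂ σ₁ σ₂) (x y : X) : 0 < k x y :=
  H.κ₁_pos.trans_le (H.le_kernel x y)

theorem kernel_ratio (H : IsScalingPair μ k us vs κ₁ κ₂ σ₁ σ₂) (x x' y : X) :
    k x y ≤ κ₂ / κ₁ * k x' y := by
  have h := H.κ₁_pos
  rw [div_mul_eq_mul_div, le_div_iff₀ h]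
  have h2 := h.trans_le (H.κ₁_le x)
  exact mul_le_mul (H.kernel_le x y) (H.le_kernel x' y) h.le h2.le

theorem left_ratioLE (H : IsScalingPair μ k us vs κ₁ κ₂ σ₁ σ₂) : RatioLE us (σ₂ / σ₁) := by
  intro x x'
  have h := H.σ₁_pos
  rw [div_mul_eq_mul_div, le_div_iff₀ h]
  exact mul_le_mul (H.left_le x) (H.le_left x') h.le (h.le.trans (H.σ₁_le x))

theorem right_ratioLE (H : IsScalingPair μ k us vs κ₁ κ₂ σ₁ σ₂) : RatioLE vs (σ₂ / σ₁) := by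
  intro x x'
  have h := H.σ₁_pos
  rw [div_mul_eq_mul_div, le_div_iff₀ h]
  exact mul_le_mul (H.right_le x) (H.le_right x') h.le (h.le.trans (H.σ₁_le x))

theorem oscBound_nonneg (H : IsScalingPair μ k us vs κ₁ κ₂ σ₁ σ₂) (x : X) :
    0 ≤ oscBound κ₁ κ₂ σ₁ σ₂ := by
  have h1 := H.κ₁_pos
  have h2 := h1.trans_le (H.κ₁_le x)
  have h3 := H.σ₁_pos
  have h4 := h3.trans_le (H.σ₁_le x)
  unfold oscBound; positivity

/-- The a priori bound: whatever the noise, a positive combination of kernel sections cannot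
oscillate more than the kernel, nor its quotient by us much more. -/
theorem relative_ratioLE (H : IsScalingPair μ k us vs κ₁ κ₂ σ₁ σ₂) {u : X → ℝ}
    (hu : ∀ x, 0 < u x) (h : RatioLE u (κ₂ / κ₁)) :
    RatioLE (fun x => u x / us x) (1 + oscBound κ₁ κ₂ σ₁ σ₂) := by
  intro x x'
  have h2 : 0 ≤ κ₂ / κ₁ := div_nonneg (H.κ₁_pos.le.trans (H.κ₁_le x)) H.κ₁_pos.le
  refine (h.div H.left_ratioLE H.left_pos (fun x => (hu x).le) h2).mono
    (fun x => (div_pos (hu x) (H.left_pos x)).le) ?_ x x'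
  unfold oscBound
  linarith

theorem empiricalTarget_ratioLE (H : IsScalingPair μ k us vs κ₁ κ₂ σ₁ σ₂) {v : X → ℝ}
    (hv : ∀ x, 0 < v x) {n : ℕ} (ξ : Fin n → X) : RatioLE (empiricalTarget k v ξ) (κ₂ / κ₁) := by
  intro x x'
  unfold empiricalTarget
  rw [mul_div_assoc', Finset.mul_sum]
  refine div_le_div_of_nonneg_right (Finset.sum_le_sum fun j _ => ?_) n.cast_nonneg
  rw [mul_div_assoc']
  exact div_le_div_of_nonneg_right (H.kernel_ratio x x' _) (hv _).le

/-- The target is homogeneous of degree -1 in v, so multiplying by v(x₀) removes the unknown scale.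
The resulting bound uses the kernel only and holds for every sample. -/
theorem le_empiricalTarget_mul (H : IsScalingPair μ k us vs κ₁ κ₂ σ₁ σ₂) {v : X → ℝ}
    (hv : ∀ x, 0 < v x) (hr : RatioLE v (κ₂ / κ₁)) {n : ℕ} (hn : 1 ≤ n) (ξ : Fin n → X) (x x₀ : X) :
    κ₁ / (κ₂ / κ₁) ≤ empiricalTarget k v ξ x * v x₀ := by
  have hn' : (0 : ℝ) < n := by exact_mod_cast hn
  have hκ := H.κ₁_pos
  have hκ2 := hκ.trans_le (H.κ₁_le x)
  unfold empiricalTarget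
  rw [div_mul_eq_mul_div, le_div_iff₀ hn', Finset.sum_mul]
  calc κ₁ / (κ₂ / κ₁) * n = ∑ _j : Fin n, κ₁ / (κ₂ / κ₁) := by simp [mul_comm]
    _ ≤ _ := by
      refine Finset.sum_le_sum fun j _ => ?_
      rw [div_mul_eq_mul_div, div_le_div_iff₀ (by positivity) (hv _)]
      calc κ₁ * v (ξ j) ≤ k x (ξ j) * (κ₂ / κ₁ * v x₀) :=
            mul_le_mul (H.le_kernel _ _) (hr _ _) (hv _).le (H.kernel_pos _ _).le
        _ = _ := by ring

theorem empiricalTarget_mul_le (H : IsScalingPair μ k us vs κ₁ κ₂ σ₁ σ₂) {v : X → ℝ}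
    (hv : ∀ x, 0 < v x) (hr : RatioLE v (κ₂ / κ₁)) {n : ℕ} (hn : 1 ≤ n) (ξ : Fin n → X) (x x₀ : X) :
    empiricalTarget k v ξ x * v x₀ ≤ κ₂ * (κ₂ / κ₁) := by
  have hn' : (0 : ℝ) < n := by exact_mod_cast hn
  have hκ := H.κ₁_pos
  have hκ2 := hκ.trans_le (H.κ₁_le x)
  unfold empiricalTarget
  rw [div_mul_eq_mul_div, div_le_iff₀ hn', Finset.sum_mul]
  calc _ ≤ ∑ _j : Fin n, κ₂ * (κ₂ / κ₁) := by
        refine Finset.sum_le_sum fun j _ => ?_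
        rw [div_mul_eq_mul_div, div_le_iff₀ (hv _), mul_assoc]
        exact mul_le_mul (H.kernel_le _ _) (hr _ _) (hv _).le hκ2.le
    _ = _ := by simp [mul_comm]

theorem integrable_kernel_mul (H : IsScalingPair μ k us vs κ₁ κ₂ σ₁ σ₂) [IsFiniteMeasure μ]
    {w : X → ℝ} (hw : Measurable w) (hw0 : ∀ y, 0 ≤ w y) {W : ℝ} (hW : ∀ y, w y ≤ W) (x : X) :
    Integrable (fun y => k x y * w y) μ := by
  refine Integrable.of_bound ((H.measurable_kernel x).mul hw).aestronglyMeasurable (κ₂ * W)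
    (Filter.Eventually.of_forall fun y => ?_)
  rw [Real.norm_of_nonneg (mul_nonneg (H.kernel_pos x y).le (hw0 y))]
  exact mul_le_mul (H.kernel_le x y) (hW y) (hw0 y) (H.κ₁_pos.le.trans (H.κ₁_le x))

/-- The same normalisation makes the sampling error an empirical deviation of a uniformly bounded
integrand. -/
theorem empiricalTarget_sub {v : X → ℝ} {n : ℕ}
    (ξ : Fin n → X) (x x₀ : X) :
    (empiricalTarget k v ξ x - ∫ y, k x y / v y ∂μ) * v x₀
      = empiricalDeviation μ (fun y => k x y * (v x₀ / v y)) ξ := by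
  have e : ∀ y, k x y * (v x₀ / v y) = k x y / v y * v x₀ := fun y => by ring
  simp only [empiricalTarget, empiricalDeviation, e, integral_mul_const, ← Finset.sum_mul]
  ring

/-- By the optimality relation k(x, y) / (us(x) vs(y)) is a probability density in y, and it is at
least κ₁/σ₂². The target divided by us is the average of vs/v under it, so the Doeblin contraction
applies. -/
theorem target_ratioLE [IsProbabilityMeasure μ] (H : IsScalingPair μ k us vs κ₁ κ₂ σ₁ σ₂)
    {v : X → ℝ} (hvm : Measurable v) (hv : ∀ x, 0 < v x) {M : ℝ} (hM : 0 ≤ M)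
    (hs : RatioLE (fun x => v x / vs x) (1 + M)) :
    κ₁ / (σ₂ * σ₂) ≤ 1 ∧
    RatioLE (fun x => (∫ y, k x y / v y ∂μ) / us x) (1 + (1 - κ₁ / (σ₂ * σ₂)) * M) := by
  obtain ⟨x₀⟩ := nonempty_of_isProbabilityMeasure μ
  have hne : Nonempty X := ⟨x₀⟩
  have hκ := H.κ₁_pos
  have hσ := H.σ₁_pos
  have hσ2 := hσ.trans_le (H.σ₁_le x₀)
  have hinv : RatioLE (fun y => vs y / v y) (1 + M) := by
    have := hs.inv fun x => div_pos (hv x) (H.right_pos x)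
    simpa only [inv_div] using this
  have hbd : ∀ y, vs y / v y ≤ (1 + M) * (vs x₀ / v x₀) := fun y => hinv y x₀
  have hpi : ∀ x y, k x y / (us x * vs y) = (us x)⁻¹ * (k x y * (vs y)⁻¹) := fun x y => by
    rw [div_eq_mul_inv, mul_inv]; ring
  have hvsi : ∀ y, (vs y)⁻¹ ≤ σ₁⁻¹ := fun y => inv_anti₀ hσ (H.le_right y)
  have hint : ∀ x, Integrable (fun y => k x y * (vs y)⁻¹) μ :=
    H.integrable_kernel_mul H.measurable_right.inv (fun y => (inv_pos.2 (H.right_pos y)).le) hvsi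
  have hvb : ∀ y, (v y)⁻¹ ≤ (1 + M) * (vs x₀ / v x₀) * σ₁⁻¹ := by
    intro y
    have h1 := hbd y
    have h2 := hv y
    calc (v y)⁻¹ = vs y / v y * (vs y)⁻¹ := by
          have := (H.right_pos y).ne'
          field_simp
      _ ≤ _ := mul_le_mul h1 (hvsi y) (inv_pos.2 (H.right_pos y)).le
          ((div_pos (H.right_pos y) (hv y)).le.trans h1)
  have hint2 : ∀ x, Integrable (fun y => k x y * (v y)⁻¹) μ :=
    H.integrable_kernel_mul hvm.inv (fun y => (inv_pos.2 (hv y)).le) hvb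
  have e : ∀ x y, k x y / (us x * vs y) * (vs y / v y) = (us x)⁻¹ * (k x y * (v y)⁻¹) := by
    intro x y
    have := (H.right_pos y).ne'
    have := (H.left_pos x).ne'
    have := (hv y).ne'
    field_simp
  have key := integral_ratioLE_of_doeblin (μ := μ) (π := fun x y => k x y / (us x * vs y))
    (h := fun y => vs y / v y) (c₀ := κ₁ / (σ₂ * σ₂)) (M := M)
    (fun x => by simp only [hpi]; exact (hint x).const_mul _)
    (fun x y => div_le_div₀ (H.kernel_pos x y).le (H.le_kernel x y)
      (mul_pos (H.left_pos x) (H.right_pos y))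
      (mul_le_mul (H.left_le x) (H.right_le y) (H.right_pos y).le hσ2.le))
    (fun x => by
      simp only [hpi]
      rw [integral_const_mul]
      have := H.left_eq x
      simp only [div_eq_mul_inv] at this
      rw [← this]
      exact inv_mul_cancel₀ (H.left_pos x).ne')
    (Integrable.of_bound (H.measurable_right.div hvm).aestronglyMeasurable _
      (Filter.Eventually.of_forall fun y => by
        rw [Real.norm_of_nonneg (div_pos (H.right_pos y) (hv y)).le]; exact hbd y))
    (fun x => by simp only [e]; exact (hint2 x).const_mul _)
    (fun y => div_pos (H.right_pos y) (hv y)) hM hinv (by positivity)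
  refine ⟨key.1, ?_⟩
  have e2 : (fun x => (∫ y, k x y / v y ∂μ) / us x)
      = fun x => ∫ y, k x y / (us x * vs y) * (vs y / v y) ∂μ := by
    ext x
    simp only [e]
    rw [integral_const_mul]
    simp only [div_eq_mul_inv]
    ring
  rw [e2]
  exact key.2

/-- One half-step of online Sinkhorn: bounds on ratios, on the scale and on the error. -/
theorem halfStep [IsProbabilityMeasure μ] (H : IsScalingPair μ k us vs κ₁ κ₂ σ₁ σ₂)
    {u v u' : X → ℝ} (hvm : Measurable v) (hu : ∀ x, 0 < u x) (hv : ∀ x, 0 < v x)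
    (hur : RatioLE u (κ₂ / κ₁)) (hvr : RatioLE v (κ₂ / κ₁)) {n : ℕ} (hn : 1 ≤ n) (ξ : Fin n → X)
    {η : ℝ} (hη0 : 0 ≤ η) (hη1 : η ≤ 1)
    (hu' : ∀ x, u' x = (1 - η) * u x + η * empiricalTarget k v ξ x)
    (x₀ : X) {lo hi Plo Phi : ℝ} (hPlo : 0 < Plo) (hlo : Plo ≤ lo) (hhi : hi ≤ Phi)
    (hlo' : lo ≤ κ₁ / (κ₂ / κ₁)) (hhi' : κ₂ * (κ₂ / κ₁) ≤ hi)
    (hp1 : lo ≤ u x₀ * v x₀) (hp2 : u x₀ * v x₀ ≤ hi) {e : ℝ}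
    (he : ∀ x, |empiricalDeviation μ (fun y => k x y * (v x₀ / v y)) ξ| ≤ e)
    {M : ℝ} (hM0 : 0 ≤ M) (hru : RatioLE (fun x => u x / us x) (1 + M))
    (hrv : RatioLE (fun x => v x / vs x) (1 + M))
    (hrate : η * contractionRate κ₁ κ₂ σ₂ Phi ≤ 1) :
    (∀ x, 0 < u' x) ∧ RatioLE u' (κ₂ / κ₁) ∧ lo ≤ u' x₀ * v x₀ ∧ u' x₀ * v x₀ ≤ hi ∧
      RatioLE (fun x => u' x / us x) (1 + (M * (1 - η * contractionRate κ₁ κ₂ σ₂ Phi)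
        + η * noiseGain κ₁ κ₂ σ₁ σ₂ Plo * e)) := by
  have hκ := H.κ₁_pos
  have hκ2 := hκ.trans_le (H.κ₁_le x₀)
  have hσ := H.σ₁_pos
  have hσ2 := hσ.trans_le (H.σ₁_le x₀)
  have hρ : 0 < κ₂ / κ₁ := by positivity
  have hv₀ := hv x₀
  have hq1 := fun x => H.le_empiricalTarget_mul hv hvr hn ξ x x₀
  have hq2 := fun x => H.empiricalTarget_mul_le hv hvr hn ξ x x₀
  have hqr := H.empiricalTarget_ratioLE hv ξ
  have hqpos : ∀ x, 0 < empiricalTarget k v ξ x := fun x =>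
    pos_of_mul_pos_left ((by positivity : 0 < κ₁ / (κ₂ / κ₁)).trans_le (hq1 x)) hv₀.le
  have hη1' := sub_nonneg.2 hη1
  have hpos : ∀ x, 0 < u' x := by
    intro x
    rw [hu']
    rcases hη0.eq_or_lt with h | h
    · rw [← h]; simpa using hu x
    · exact add_pos_of_nonneg_of_pos (mul_nonneg hη1' (hu x).le) (mul_pos h (hqpos x))
  have hratio : RatioLE u' (κ₂ / κ₁) := by
    intro x x'
    rw [hu', hu']
    have h1 := mul_le_mul_of_nonneg_left (hur x x') hη1'
    have h2 := mul_le_mul_of_nonneg_left (hqr x x') hη0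
    linarith
  -- The new scale is a convex combination of the old one and of a number between κ₁²/κ₂ and κ₂²/κ₁.
  -- Hence every interval that contains those two numbers is preserved.
  have hs : u' x₀ * v x₀ = (1 - η) * (u x₀ * v x₀) + η * (empiricalTarget k v ξ x₀ * v x₀) := by
    rw [hu']; ring
  have hs1 : lo ≤ u' x₀ * v x₀ := by
    rw [hs]
    have h1 := mul_le_mul_of_nonneg_left hp1 hη1'
    have h2 := mul_le_mul_of_nonneg_left (hlo'.trans (hq1 x₀)) hη0
    linarith
  have hs2 : u' x₀ * v x₀ ≤ hi := by
    rw [hs]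
    have h1 := mul_le_mul_of_nonneg_left hp2 hη1'
    have h2 := mul_le_mul_of_nonneg_left ((hq2 x₀).trans hhi') hη0
    linarith
  refine ⟨hpos, hratio, hs1, hs2, ?_⟩
  set Mm := oscBound κ₁ κ₂ σ₁ σ₂ with hMm
  have hMm0 : 0 ≤ Mm := H.oscBound_nonneg x₀
  -- The update estimate is applied with min(M, Mm), so that its noise factor is uniform. In the end
  -- M returns, because 1 - η times the rate is nonnegative.
  have hm0 : 0 ≤ min M Mm := le_min hM0 hMm0
  have hru' : RatioLE (fun x => u x / us x) (1 + min M Mm) := by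
    rcases min_cases M Mm with ⟨e, _⟩ | ⟨e, _⟩ <;> rw [e]
    · exact hru
    · exact H.relative_ratioLE hu hur
  have hrv' : RatioLE (fun x => v x / vs x) (1 + min M Mm) := by
    rcases min_cases M Mm with ⟨e, _⟩ | ⟨e, _⟩ <;> rw [e]
    · exact hrv
    · refine (hvr.div H.right_ratioLE H.right_pos (fun x => (hv x).le) hρ.le).mono
        (fun x => (div_pos (hv x) (H.right_pos x)).le) ?_
      rw [hMm]; unfold oscBound; linarith
  have ht := H.target_ratioLE hvm hv hm0 hrv'
  have key := update_ratioLE (u := u) (q := fun x => ∫ y, k x y / v y ∂μ)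
    (qt := empiricalTarget k v ξ) (us := us) (Mm := Mm) (e := e) (l := κ₁ / (κ₂ / κ₁))
    (Φ := (κ₂ / κ₁) * Phi) (lam := Plo / (κ₂ / κ₁)) hη0 hη1 hm0 (min_le_right _ _) hσ H.le_left
    H.left_le hv₀ (by positivity) ht.1 hru' ht.2
    (fun x => by
      have hab : ∀ a : ℝ, |a| * v x₀ = |a * v x₀| := fun a => by rw [abs_mul, abs_of_pos hv₀]
      rw [hab, empiricalTarget_sub]
      exact he x)
    (by positivity) hq1
    (fun x => by
      rw [← hu']
      calc u' x * v x₀ ≤ (κ₂ / κ₁ * u' x₀) * v x₀ := by gcongr; exact hratio x x₀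
        _ = κ₂ / κ₁ * (u' x₀ * v x₀) := by ring
        _ ≤ _ := by gcongr; exact hs2.trans hhi)
    (by positivity)
    (fun x => by
      rw [← hu', div_le_iff₀ hρ]
      calc Plo ≤ u' x₀ * v x₀ := hlo.trans hs1
        _ ≤ (κ₂ / κ₁ * u' x) * v x₀ := by gcongr; exact hratio x₀ x
        _ = _ := by ring)
  have e2 : (fun x => u' x / us x)
      = fun x => ((1 - η) * u x + η * empiricalTarget k v ξ x) / us x := by
    ext x; rw [hu']
  have hnn : ∀ x, 0 ≤ u' x / us x := fun x => (div_pos (hpos x) (H.left_pos x)).le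
  rw [← e2] at key
  refine key.mono hnn ?_
  have := mul_le_mul_of_nonneg_right (min_le_left M Mm) (sub_nonneg.2 hrate)
  unfold contractionRate noiseGain at *
  linarith

theorem contractionRate_pos (H : IsScalingPair μ k us vs κ₁ κ₂ σ₁ σ₂) (x : X) {Phi : ℝ}
    (hPhi : 0 < Phi) : 0 < contractionRate κ₁ κ₂ σ₂ Phi := by
  have h1 := H.κ₁_pos
  have h2 := h1.trans_le (H.κ₁_le x)
  have h4 := H.σ₁_pos.trans_le (H.σ₁_le x)
  unfold contractionRate; positivity

theorem contractionRate_le_one [IsProbabilityMeasure μ]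
    (H : IsScalingPair μ k us vs κ₁ κ₂ σ₁ σ₂) {Phi : ℝ} (hPhi : κ₂ * (κ₂ / κ₁) ≤ Phi) :
    contractionRate κ₁ κ₂ σ₂ Phi ≤ 1 := by
  obtain ⟨x⟩ := nonempty_of_isProbabilityMeasure μ
  have h1 := H.κ₁_pos
  have h12 := H.κ₁_le x
  have h2 := h1.trans_le h12
  have h4 := H.σ₁_pos.trans_le (H.σ₁_le x)
  have hρ : 1 ≤ κ₂ / κ₁ := (one_le_div h1).2 h12
  -- The choice v = vs, M = 0 serves only to extract κ₁/σ₂² ≤ 1.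
  have hc := (H.target_ratioLE H.measurable_right H.right_pos le_rfl (fun x x' => by
    simp only
    rw [div_self (H.right_pos x).ne', div_self (H.right_pos x').ne']; norm_num)).1
  have hP : κ₁ ≤ Phi := h12.trans ((le_mul_of_one_le_right h2.le hρ).trans hPhi)
  have hP0 := h1.trans_le hP
  unfold contractionRate
  rw [div_le_one (by positivity)]
  calc κ₁ / (σ₂ * σ₂) * (κ₁ / (κ₂ / κ₁)) ≤ 1 * κ₁ := by
        gcongr
        exact div_le_self h1.le hρ
    _ ≤ κ₂ / κ₁ * Phi := by gcongr

theorem noiseGain_nonneg (H : IsScalingPair μ k us vs κ₁ κ₂ σ₁ σ₂) (x : X) {Plo : ℝ}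
    (hPlo : 0 < Plo) : 0 ≤ noiseGain κ₁ κ₂ σ₁ σ₂ Plo := by
  have h0 := H.oscBound_nonneg x
  have h1 := H.κ₁_pos
  have h2 := h1.trans_le (H.κ₁_le x)
  have h3 := H.σ₁_pos
  have h4 := h3.trans_le (H.σ₁_le x)
  unfold noiseGain; positivity

end IsScalingPair

/-- The factor with which the compression error enters in one step. -/
def compressionGain (κ₁ κ₂ σ₁ σ₂ Δ : ℝ) : ℝ :=
  2 * Real.exp (2 * Δ) * (1 + oscBound κ₁ κ₂ σ₁ σ₂)

/-- One full step of compressed online Sinkhorn. -/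
theorem fullStep {X : Type*} [MeasurableSpace X] {α β : Measure X} [IsProbabilityMeasure α]
    [IsProbabilityMeasure β] {k : X → X → ℝ} {us vs : X → ℝ} {κ₁ κ₂ σ₁ σ₂ : ℝ}
    (H : IsScalingPair β k us vs κ₁ κ₂ σ₁ σ₂)
    (H' : IsScalingPair α (fun y x => k x y) vs us κ₁ κ₂ σ₁ σ₂)
    {u v u' v' uh vh : X → ℝ} (hvm : Measurable v) (hum' : Measurable u') (hu : ∀ x, 0 < u x)
    (hv : ∀ x, 0 < v x) (hur : RatioLE u (κ₂ / κ₁)) (hvr : RatioLE v (κ₂ / κ₁)) {n : ℕ}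
    (hn : 1 ≤ n) (ξ ξ' : Fin n → X) {η : ℝ} (hη0 : 0 ≤ η) (hη1 : η ≤ 1)
    (hu' : ∀ x, u' x = (1 - η) * u x + η * empiricalTarget k v ξ x)
    (hv' : ∀ y, v' y = (1 - η) * v y + η * empiricalTarget (fun y x => k x y) u' ξ' y)
    (x₀ : X) {lo hi Plo Phi : ℝ} (hPlo : 0 < Plo) (hlo : Plo ≤ lo) (hhi : hi ≤ Phi)
    (hlo' : lo ≤ κ₁ / (κ₂ / κ₁)) (hhi' : κ₂ * (κ₂ / κ₁) ≤ hi)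
    (hp1 : lo ≤ u x₀ * v x₀) (hp2 : u x₀ * v x₀ ≤ hi) {e e' : ℝ} (he0 : 0 ≤ e) (he0' : 0 ≤ e')
    (he : ∀ x, |empiricalDeviation β (fun y => k x y * (v x₀ / v y)) ξ| ≤ e)
    (he' : ∀ y, |empiricalDeviation α (fun x => k x y * (u' x₀ / u' x)) ξ'| ≤ e')
    {M : ℝ} (hM0 : 0 ≤ M) (hru : RatioLE (fun x => u x / us x) (1 + M))
    (hrv : RatioLE (fun x => v x / vs x) (1 + M))
    (hrate : η * contractionRate κ₁ κ₂ σ₂ Phi ≤ 1) {δ Δ : ℝ} (hδ : 0 ≤ δ) (hδΔ : δ ≤ Δ)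
    (huh : ∀ x, uh x ≤ Real.exp δ * u' x) (huh' : ∀ x, u' x ≤ Real.exp δ * uh x)
    (hvh : ∀ x, vh x ≤ Real.exp δ * v' x) (hvh' : ∀ x, v' x ≤ Real.exp δ * vh x) :
    Real.exp (-(2 * δ)) * lo ≤ uh x₀ * vh x₀ ∧ uh x₀ * vh x₀ ≤ Real.exp (2 * δ) * hi ∧
      RatioLE (fun x => uh x / us x) (1 + (M * (1 - η * contractionRate κ₁ κ₂ σ₂ Phi)
        + η * noiseGain κ₁ κ₂ σ₁ σ₂ Plo * (e + e') + compressionGain κ₁ κ₂ σ₁ σ₂ Δ * δ)) ∧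
      RatioLE (fun x => vh x / vs x) (1 + (M * (1 - η * contractionRate κ₁ κ₂ σ₂ Phi)
        + η * noiseGain κ₁ κ₂ σ₁ σ₂ Plo * (e + e') + compressionGain κ₁ κ₂ σ₁ σ₂ Δ * δ)) := by
  have hκ := H.κ₁_pos
  have hκ2 := hκ.trans_le (H.κ₁_le x₀)
  have hσ := H.σ₁_pos
  have hσ2 := hσ.trans_le (H.σ₁_le x₀)
  have hosc := H.oscBound_nonneg x₀
  obtain ⟨a1, a2, a3, a4, a5⟩ := H.halfStep hvm hu hv hur hvr hn ξ hη0 hη1 hu' x₀ hPlo hlo hhi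
    hlo' hhi' hp1 hp2 he hM0 hru hrv hrate
  set c := contractionRate κ₁ κ₂ σ₂ Phi
  set g := noiseGain κ₁ κ₂ σ₁ σ₂ Plo with hg
  have hg0 : 0 ≤ g := H.noiseGain_nonneg x₀ hPlo
  have hPhi : 0 < Phi := hPlo.trans_le (hlo.trans (hp1.trans (hp2.trans hhi)))
  have hc0 : 0 ≤ c := (H.contractionRate_pos x₀ hPhi).le
  have hge : 0 ≤ η * g * e := by positivity
  have hge' : 0 ≤ η * g * e' := by positivity
  have hηc : 0 ≤ η * c := by positivity
  have hMc : 0 ≤ M * (η * c) := by positivity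
  have hpu : ∀ x, 0 ≤ u' x / us x := fun x => (div_pos (a1 x) (H.left_pos x)).le
  -- The second half-step already uses the new u, whose error may exceed M by the noise ηge of the
  -- first one. So both inputs are bounded by M + ηge, and contraction of this sum leaves M(1 - ηc)
  -- + ηg(e + e').
  obtain ⟨b1, b2, b3, b4, b5⟩ := H'.halfStep (M := M + η * g * e) hum' hv a1 hvr a2 hn ξ' hη0 hη1
    hv' x₀ hPlo hlo hhi hlo' hhi' (by rwa [mul_comm]) (by rwa [mul_comm]) he' (by positivity)
    (hrv.mono (fun x => (div_pos (hv x) (H.right_pos x)).le) (by linarith))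
    (a5.mono hpu (by linarith)) hrate
  have hpv : ∀ x, 0 ≤ v' x / vs x := fun x => (div_pos (b1 x) (H.right_pos x)).le
  have hN0 : 0 ≤ M * (1 - η * c) + η * g * (e + e') := by
    have := mul_nonneg hM0 (sub_nonneg.2 hrate)
    linarith
  have d1 := ratioLE_of_compression (M := M * (1 - η * c) + η * g * (e + e')) hN0 hosc hδ hδΔ
    H.left_pos a1 (a5.mono hpu (by linarith)) (H.relative_ratioLE a1 a2) huh huh'
  have d2 := ratioLE_of_compression (M := M * (1 - η * c) + η * g * (e + e')) hN0 hosc hδ hδΔ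
    H.right_pos b1 (b5.mono hpv (by
      have := mul_nonneg hge hηc
      linarith)) (H'.relative_ratioLE b1 b2) hvh hvh'
  have huhp : ∀ x, 0 < uh x := fun x =>
    pos_of_mul_pos_right ((a1 x).trans_le (huh' x)) (Real.exp_pos _).le
  have hvhp : ∀ x, 0 < vh x := fun x =>
    pos_of_mul_pos_right ((b1 x).trans_le (hvh' x)) (Real.exp_pos _).le
  have e2 : Real.exp (2 * δ) = Real.exp δ * Real.exp δ := by rw [← Real.exp_add, two_mul]
  rw [mul_comm (v' x₀)] at b3 b4
  refine ⟨?_, ?_, d1, d2⟩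
  · rw [Real.exp_neg, inv_mul_le_iff₀ (Real.exp_pos _), e2]
    calc lo ≤ u' x₀ * v' x₀ := b3
      _ ≤ (Real.exp δ * uh x₀) * (Real.exp δ * vh x₀) :=
        mul_le_mul (huh' x₀) (hvh' x₀) (b1 x₀).le (mul_pos (Real.exp_pos _) (huhp x₀)).le
      _ = _ := by ring
  · rw [e2]
    calc uh x₀ * vh x₀ ≤ (Real.exp δ * u' x₀) * (Real.exp δ * v' x₀) :=
        mul_le_mul (huh x₀) (hvh x₀) (hvhp x₀).le (mul_pos (Real.exp_pos _) (a1 x₀)).le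
      _ = Real.exp δ * Real.exp δ * (u' x₀ * v' x₀) := by ring
      _ ≤ _ := by gcongr

/-! ### The scalar recursion and the sizes of the parameters. -/

theorem exists_rate_of_recursion {a b c C D₀ : ℝ} (ha : 0 < a) (hb : -1 < b) (hb0 : b ≤ 0)
    (hc : 0 < c) (hc1 : c ≤ 1) (hC : 0 ≤ C) (hD₀ : 0 ≤ D₀) :
    ∃ A : ℝ, 0 < A ∧ ∀ d : ℕ → ℝ, d 1 ≤ D₀ →
      (∀ t : ℕ, 1 ≤ t → d (t + 1) ≤ (1 - c * (t : ℝ) ^ b) * d t + C * (t : ℝ) ^ (b - a)) →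
      ∀ t : ℕ, 1 ≤ t → d t ≤ A * (t : ℝ) ^ (-a) := by
  have hlim : Filter.Tendsto (fun t : ℕ => a * (t : ℝ) ^ (-(1 + b))) Filter.atTop (nhds 0) := by
    have := (tendsto_rpow_neg_atTop (by linarith : 0 < 1 + b)).comp tendsto_natCast_atTop_atTop
    simpa using this.const_mul a
  -- As b > -1, eventually a/t ≤ (c/2) t^b: half of the contraction absorbs the decay of t^(-a) from
  -- t to t + 1, and the other half absorbs the forcing term once A ≥ 2C/c. Before that time a crude
  -- linear bound is enough.
  obtain ⟨t₀, ht₀⟩ := Filter.eventually_atTop.1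
    (hlim.eventually (gt_mem_nhds (by positivity : 0 < c / 2)))
  set t₁ := max t₀ 1
  have ht₁ : (1 : ℝ) ≤ t₁ := by exact_mod_cast le_max_right t₀ 1
  have hA1 : 0 ≤ 2 * C / c := by positivity
  have hA2 : 0 ≤ (D₀ + C * t₁) * (t₁ : ℝ) ^ a := by positivity
  refine ⟨2 * C / c + (D₀ + C * t₁) * (t₁ : ℝ) ^ a + 1, by positivity, fun d hd1 hd t ht => ?_⟩
  set A := 2 * C / c + (D₀ + C * t₁) * (t₁ : ℝ) ^ a + 1 with hA
  have hpow : ∀ t : ℕ, 1 ≤ t → (t : ℝ) ^ b ≤ 1 := fun t ht =>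
    Real.rpow_le_one_of_one_le_of_nonpos (by exact_mod_cast ht) hb0
  have hpow2 : ∀ t : ℕ, 1 ≤ t → (t : ℝ) ^ (b - a) ≤ 1 := fun t ht =>
    Real.rpow_le_one_of_one_le_of_nonpos (by exact_mod_cast ht) (by linarith)
  have hfac : ∀ t : ℕ, 1 ≤ t → 0 ≤ 1 - c * (t : ℝ) ^ b := fun t ht => by
    have := mul_le_mul hc1 (hpow t ht) (by positivity) zero_le_one
    linarith
  have hcrude : ∀ t : ℕ, 1 ≤ t → d t ≤ D₀ + C * t := by
    intro t ht
    induction t, ht using Nat.le_induction with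
    | base => push_cast; linarith
    | succ t ht ih =>
      refine (hd t ht).trans ?_
      have h1 := mul_le_mul_of_nonneg_left ih (hfac t ht)
      have h2 : 0 ≤ c * (t : ℝ) ^ b * (D₀ + C * t) := by positivity
      have h3 := mul_le_mul_of_nonneg_left (hpow2 t ht) hC
      push_cast
      linarith
  by_cases h : t ≤ t₁
  · have hle : d t ≤ D₀ + C * t₁ := (hcrude t ht).trans (by gcongr)
    have ht' : (1 : ℝ) ≤ t := by exact_mod_cast ht
    rw [Real.rpow_neg (by positivity), ← div_eq_mul_inv, le_div_iff₀ (by positivity)]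
    calc d t * (t : ℝ) ^ a ≤ (D₀ + C * t₁) * (t₁ : ℝ) ^ a := by gcongr
      _ ≤ A := by linarith
  · push Not at h
    induction t, h.le using Nat.le_induction with
    | base => exact absurd h (lt_irrefl _)
    | succ t htt ih =>
      have ht1 : 1 ≤ t := (le_max_right _ _).trans htt
      have htr : (1 : ℝ) ≤ t := by exact_mod_cast ht1
      have htp : (0 : ℝ) < t := by linarith
      have ih' : d t ≤ A * (t : ℝ) ^ (-a) := by
        rcases htt.eq_or_lt with e | e
        · have hle : d t ≤ D₀ + C * t₁ := (hcrude t ht1).trans (by rw [e])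
          rw [Real.rpow_neg (by positivity), ← div_eq_mul_inv, le_div_iff₀ (by positivity)]
          calc d t * (t : ℝ) ^ a ≤ (D₀ + C * t₁) * (t₁ : ℝ) ^ a := by rw [← e] at hle ⊢; gcongr
            _ ≤ A := by linarith
        · exact ih ht1 e
      have h1 := mul_le_mul_of_nonneg_left ih' (hfac t ht1)
      have hsmall := (ht₀ t ((le_max_left _ _).trans htt)).le
      -- Bernoulli's inequality (1 + 1/t)^(-a) ≥ 1 - a/t.
      have hbern : (t : ℝ) ^ (-a) * (1 - a / t) ≤ ((t : ℝ) + 1) ^ (-a) := by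
        have e1 : ((t : ℝ) + 1) = t * (1 + 1 / t) := by field_simp
        rw [e1, Real.mul_rpow htp.le (by positivity)]
        gcongr
        rw [Real.rpow_def_of_pos (by positivity)]
        have h3 := Real.log_le_sub_one_of_pos (by positivity : (0 : ℝ) < 1 + 1 / t)
        have h4 := Real.add_one_le_exp (Real.log (1 + 1 / t) * -a)
        have h5 : a * Real.log (1 + 1 / t) ≤ a * (1 / t) := by gcongr; linarith
        have h6 : a * (1 / (t : ℝ)) = a / t := by ring
        linarith
      have hkey : a / t ≤ c / 2 * (t : ℝ) ^ b := by
        have e2 : (t : ℝ) ^ (-(1 + b)) = (t : ℝ)⁻¹ * ((t : ℝ) ^ b)⁻¹ := by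
          rw [neg_add, Real.rpow_add htp, Real.rpow_neg htp.le, Real.rpow_neg htp.le, Real.rpow_one]
        rw [e2, ← mul_assoc, ← div_eq_mul_inv, ← div_eq_mul_inv, div_le_iff₀ (by positivity)]
          at hsmall
        exact hsmall
      have hsplit : (t : ℝ) ^ (b - a) = (t : ℝ) ^ b * (t : ℝ) ^ (-a) := by
        rw [← Real.rpow_add htp, sub_eq_add_neg]
      have hAc : C ≤ c / 2 * A := by
        have : C = c / 2 * (2 * C / c) := by field_simp
        rw [this]
        gcongr
        linarith
      have hta : 0 < (t : ℝ) ^ (-a) := by positivity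
      have htb : 0 < (t : ℝ) ^ b := by positivity
      have hA0 : 0 < A := by linarith
      have hd' := hd t ht1
      rw [hsplit] at hd'
      push_cast
      have s1 := mul_le_mul_of_nonneg_right hAc (mul_pos htb hta).le
      have s2 := mul_le_mul_of_nonneg_left hkey (mul_pos hA0 hta).le
      have s3 := mul_le_mul_of_nonneg_left hbern hA0.le
      linarith

theorem batchSize_pos (a : ℝ) {s t : ℕ} (ht : 1 ≤ t) : 1 ≤ batchSize a s t :=
  Nat.one_le_ceil_iff.2 (Real.rpow_pos_of_pos (by exact_mod_cast (by omega : 0 < t + s)) _)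

theorem rpow_le_sqrt_batchSize {a : ℝ} (ha : 0 < a) (s t : ℕ) :
    (t : ℝ) ^ a ≤ Real.sqrt (batchSize a s t) := by
  refine Real.le_sqrt_of_sq_le ?_
  calc ((t : ℝ) ^ a) ^ 2 = (t : ℝ) ^ (2 * a) := by
        rw [← Real.rpow_mul_natCast t.cast_nonneg]; push_cast; ring_nf
    _ ≤ ((t + s : ℕ) : ℝ) ^ (2 * a) := by
        gcongr; omega
    _ ≤ _ := Nat.le_ceil _

theorem stepSize_le_one {b : ℝ} (hb : b ≤ 0) (s : ℕ) {t : ℕ} (ht : 1 ≤ t) :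
    stepSize b s t ≤ 1 :=
  Real.rpow_le_one_of_one_le_of_nonpos (by exact_mod_cast (by omega : 1 ≤ t + s)) hb

theorem stepSize_le_rpow {b : ℝ} (hb : b ≤ 0) (s : ℕ) {t : ℕ} (ht : 1 ≤ t) :
    stepSize b s t ≤ (t : ℝ) ^ b :=
  Real.rpow_le_rpow_of_nonpos (by exact_mod_cast ht) (by push_cast; linarith [s.cast_nonneg (α := ℝ)])
    hb

/-- Since t + s ≤ (s + 1) t, the offset costs only a constant factor. -/
theorem le_stepSize {b : ℝ} (hb : b ≤ 0) (s : ℕ) {t : ℕ} (ht : 1 ≤ t) :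
    ((s : ℝ) + 1) ^ b * (t : ℝ) ^ b ≤ stepSize b s t := by
  have ht' : (1 : ℝ) ≤ t := by exact_mod_cast ht
  rw [← Real.mul_rpow (by positivity) (by positivity)]
  refine Real.rpow_le_rpow_of_nonpos (by push_cast; positivity) ?_ hb
  push_cast
  nlinarith [s.cast_nonneg (α := ℝ)]

theorem one_le_compressionSize {a b ζ : ℝ} {s t : ℕ} (ht : 1 ≤ t) :
    1 ≤ compressionSize a b ζ s t := by
  unfold compressionSize
  split_ifs
  · exact batchSize_pos a le_rfl
  · exact Nat.one_le_ceil_iff.2 (Real.rpow_pos_of_pos (by exact_mod_cast ht) _)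

theorem compressionSize_rpow_le {a b ζ : ℝ} (hζ : 0 < ζ) (hab : 0 ≤ a - b) (s : ℕ) {t : ℕ}
    (ht : 1 ≤ t) : (compressionSize a b ζ s (t + 1) : ℝ) ^ (-ζ) ≤ (t : ℝ) ^ (b - a) := by
  have ht' : (0 : ℝ) < t := by exact_mod_cast ht
  have h1 : (t : ℝ) ^ ((a - b) / ζ) ≤ compressionSize a b ζ s (t + 1) := by
    unfold compressionSize
    rw [if_neg (by omega)]
    refine le_trans ?_ (Nat.le_ceil _)
    gcongr
    linarith
  calc (compressionSize a b ζ s (t + 1) : ℝ) ^ (-ζ) ≤ ((t : ℝ) ^ ((a - b) / ζ)) ^ (-ζ) :=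
        Real.rpow_le_rpow_of_nonpos (by positivity) h1 (by linarith)
    _ = _ := by
        rw [← Real.rpow_mul ht'.le]; congr 1; field_simp; ring

theorem sum_batchSize_le {a : ℝ} (ha : 0 < a) (s t : ℕ) :
    ((∑ i ∈ Finset.Icc 1 t, batchSize a s i : ℕ) : ℝ)
      ≤ 2 * ((s : ℝ) + 1) ^ (2 * a) * (t : ℝ) ^ (2 * a + 1) := by
  rcases t.eq_zero_or_pos with rfl | ht
  · simp; positivity
  have ht' : (0 : ℝ) < t := by exact_mod_cast ht
  push_cast
  calc ∑ i ∈ Finset.Icc 1 t, (batchSize a s i : ℝ)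
      ≤ ∑ _i ∈ Finset.Icc 1 t, 2 * (((s : ℝ) + 1) ^ (2 * a) * (t : ℝ) ^ (2 * a)) := by
        refine Finset.sum_le_sum fun i hi => ?_
        rw [Finset.mem_Icc] at hi
        have hi1 : (1 : ℝ) ≤ ((i + s : ℕ) : ℝ) := by exact_mod_cast (by omega : 1 ≤ i + s)
        -- Rounding up a number that is at least 1 at most doubles it; this is the factor 2 of the
        -- bound.
        have h1 : (1 : ℝ) ≤ ((i + s : ℕ) : ℝ) ^ (2 * a) := Real.one_le_rpow hi1 (by linarith)
        have h2 : ((i + s : ℕ) : ℝ) ^ (2 * a) ≤ ((s : ℝ) + 1) ^ (2 * a) * (t : ℝ) ^ (2 * a) := by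
          rw [← Real.mul_rpow (by positivity) ht'.le]
          gcongr
          have : (i : ℝ) ≤ t := by exact_mod_cast hi.2
          have : (1 : ℝ) ≤ t := by exact_mod_cast ht
          push_cast
          nlinarith [s.cast_nonneg (α := ℝ)]
        have h3 := (Nat.ceil_lt_add_one (zero_le_one.trans h1)).le
        unfold batchSize
        linarith
    _ = _ := by
        rw [Finset.sum_const, Nat.card_Icc, nsmul_eq_mul, Real.rpow_add ht', Real.rpow_one]
        simp only [Nat.add_sub_cancel]
        ring

theorem lt_sum_firstIter (a : ℝ) (s N : ℕ) :
    N < ∑ i ∈ Finset.Icc 1 (Run.firstIter (batchSize a s) N), batchSize a s i := by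
  have hne : {t : ℕ | N < ∑ i ∈ Finset.Icc 1 t, batchSize a s i}.Nonempty := by
    refine ⟨N + 1, ?_⟩
    have : ∑ _i ∈ Finset.Icc 1 (N + 1), 1 ≤ ∑ i ∈ Finset.Icc 1 (N + 1), batchSize a s i :=
      Finset.sum_le_sum fun i hi => batchSize_pos a (Finset.mem_Icc.1 hi).1
    simp at this
    exact this
  exact Nat.sInf_mem hne

theorem one_le_firstIter (a : ℝ) (s N : ℕ) : 1 ≤ Run.firstIter (batchSize a s) N := by
  by_contra h
  have h0 : Run.firstIter (batchSize a s) N = 0 := by omega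
  have := lt_sum_firstIter a s N
  rw [h0] at this
  simp at this

/-- By the choice of T = t(N), N is below the sum of T batch sizes, which is O(T^(2a+1)). The claim
is this inequality raised to the power a/(2a + 1). -/
theorem firstIter_rpow_le {a : ℝ} (ha : 0 < a) (s : ℕ) {N : ℕ} (hN : 1 ≤ N) :
    (Run.firstIter (batchSize a s) N : ℝ) ^ (-a)
      ≤ (2 * ((s : ℝ) + 1) ^ (2 * a)) ^ (a / (2 * a + 1)) * (N : ℝ) ^ (-(a / (2 * a + 1))) := by
  set T := Run.firstIter (batchSize a s) N
  have hT : (0 : ℝ) < T := by exact_mod_cast one_le_firstIter a s N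
  have hN' : (0 : ℝ) < N := by exact_mod_cast hN
  have h1 : (N : ℝ) ≤ 2 * ((s : ℝ) + 1) ^ (2 * a) * (T : ℝ) ^ (2 * a + 1) :=
    le_trans (by exact_mod_cast (lt_sum_firstIter a s N).le) (sum_batchSize_le ha s T)
  set S := 2 * ((s : ℝ) + 1) ^ (2 * a)
  have hS : 0 < S := by positivity
  have h2 : (N : ℝ) ^ (a / (2 * a + 1)) ≤ S ^ (a / (2 * a + 1)) * (T : ℝ) ^ a := by
    refine (Real.rpow_le_rpow hN'.le h1 (by positivity)).trans_eq ?_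
    rw [Real.mul_rpow hS.le (by positivity), ← Real.rpow_mul hT.le]
    congr 2
    field_simp
  rw [Real.rpow_neg hT.le, Real.rpow_neg hN'.le, ← div_eq_mul_inv, ← one_div,
    div_le_div_iff₀ (by positivity) (by positivity)]
  linarith

/-- From y^n / n! ≤ exp y at y = N^γ, with nγ ≥ q. -/
theorem exists_exp_neg_rpow_le {γ q : ℝ} (hγ : 0 < γ) :
    ∃ C : ℝ, 0 < C ∧ ∀ N : ℕ, 1 ≤ N →
      Real.exp (-1 * (N : ℝ) ^ γ) ≤ C * (N : ℝ) ^ (-q) := by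
  obtain ⟨n, hn⟩ := exists_nat_ge (q / γ)
  refine ⟨n.factorial, by exact_mod_cast n.factorial_pos, fun N hN => ?_⟩
  have hN' : (1 : ℝ) ≤ N := by exact_mod_cast hN
  have hN0 : (0 : ℝ) < N := by linarith
  have h1 := Real.pow_div_factorial_le_exp ((N : ℝ) ^ γ) (by positivity) n
  have h2 : (N : ℝ) ^ q ≤ ((N : ℝ) ^ γ) ^ n := by
    rw [← Real.rpow_mul_natCast hN0.le]
    refine Real.rpow_le_rpow_of_exponent_le hN' ?_
    rw [div_le_iff₀ hγ] at hn
    linarith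
  have hf : (0 : ℝ) < n.factorial := by exact_mod_cast n.factorial_pos
  rw [div_le_iff₀ hf] at h1
  rw [neg_one_mul, Real.exp_neg, Real.rpow_neg hN0.le, ← div_eq_mul_inv, ← one_div,
    div_le_div_iff₀ (Real.exp_pos _) (by positivity)]
  linarith

/-! ### Measurable suprema and deviations of random families independent of the sample. -/

theorem measurable_iSup_of_continuous {Ω X : Type*} [MeasurableSpace Ω] [TopologicalSpace X]
    [CompactSpace X] [TopologicalSpace.SeparableSpace X] {F : Ω → X → ℝ}
    (hm : ∀ x, Measurable fun ω => F ω x) (hc : ∀ ω, Continuous (F ω)) :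
    Measurable fun ω => ⨆ x, F ω x := by
  rcases isEmpty_or_nonempty X with hX | hX
  · simp only [Real.iSup_of_isEmpty]; exact measurable_const
  have e : (fun ω => ⨆ x, F ω x) = fun ω => ⨆ n, F ω (TopologicalSpace.denseSeq X n) := by
    ext ω
    have hb : BddAbove (Set.range (F ω)) := (isCompact_range (hc ω)).bddAbove
    have hb' : BddAbove (Set.range fun n => F ω (TopologicalSpace.denseSeq X n)) :=
      hb.mono (by rintro _ ⟨n, rfl⟩; exact ⟨_, rfl⟩)
    refine le_antisymm (ciSup_le fun x => ?_) (ciSup_le fun n => le_ciSup hb _)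
    have hcl : IsClosed {x | F ω x ≤ ⨆ n, F ω (TopologicalSpace.denseSeq X n)} :=
      isClosed_le (hc ω) continuous_const
    have := (TopologicalSpace.denseRange_denseSeq X).closure_eq ▸
      hcl.closure_subset_iff.2 (by rintro _ ⟨n, rfl⟩; exact le_ciSup hb' n)
    exact this (Set.mem_univ x)
  rw [e]
  exact Measurable.iSup fun n => hm _

theorem measurable_varNorm {Ω X : Type*} [MeasurableSpace Ω] [TopologicalSpace X]
    [CompactSpace X] [TopologicalSpace.SeparableSpace X] {F : Ω → X → ℝ}
    (hm : ∀ x, Measurable fun ω => F ω x) (hc : ∀ ω, Continuous (F ω)) :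
    Measurable fun ω => varNorm (F ω) := by
  have h1 := measurable_iSup_of_continuous hm hc
  have h2 := measurable_iSup_of_continuous (F := fun ω x => -F ω x) (fun x => (hm x).neg)
    (fun ω => (hc ω).neg)
  have e : (fun ω => varNorm (F ω)) = fun ω => (⨆ x, F ω x) + ⨆ x, -F ω x := by
    ext ω
    have h : (⨅ x, F ω x) = -⨆ x, -F ω x := by
      rw [iInf, Real.sInf_def, iSup]
      congr 2
      ext y
      simp only [Set.mem_neg, Set.mem_range]
      exact exists_congr fun x => by rw [neg_eq_iff_eq_neg]
    rw [varNorm, h, sub_neg_eq_add]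
  rw [e]
  exact h1.add h2

theorem varNorm_nonneg {X : Type*} [TopologicalSpace X] [CompactSpace X] [Nonempty X] {h : X → ℝ}
    (hc : Continuous h) : 0 ≤ varNorm h := by
  obtain ⟨x⟩ := ‹Nonempty X›
  have h1 := ciInf_le (isCompact_range hc).bddBelow x
  have h2 := le_ciSup (isCompact_range hc).bddAbove x
  unfold varNorm
  linarith

/-- The largest deviation over a family of functions. -/
def supDeviation {X Y : Type*} [MeasurableSpace Y] (μ : Measure Y) (ψ : X → Y → ℝ) {n : ℕ}
    (ξ : Fin n → Y) : ℝ :=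
  ⨆ x, |empiricalDeviation μ (ψ x) ξ|

section SupDeviation

variable {X Y : Type*} [MeasurableSpace Y] {μ : Measure Y} {M : ℝ} {n : ℕ}

theorem supDeviation_nonneg (ψ : X → Y → ℝ) (ξ : Fin n → Y) : 0 ≤ supDeviation μ ψ ξ :=
  Real.iSup_nonneg fun _ => abs_nonneg _

variable [IsProbabilityMeasure μ]

theorem le_supDeviation {ψ : X → Y → ℝ} (hM : ∀ x y, |ψ x y| ≤ M) (hn : 1 ≤ n) (ξ : Fin n → Y)
    (x : X) : |empiricalDeviation μ (ψ x) ξ| ≤ supDeviation μ ψ ξ :=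
  le_ciSup (f := fun x => |empiricalDeviation μ (ψ x) ξ|)
    ⟨2 * M, by rintro _ ⟨x, rfl⟩; exact abs_empiricalDeviation_le (hM x) hn ξ⟩ x

theorem supDeviation_le [Nonempty X] {ψ : X → Y → ℝ} (hM : ∀ x y, |ψ x y| ≤ M) (hn : 1 ≤ n)
    (ξ : Fin n → Y) : supDeviation μ ψ ξ ≤ 2 * M :=
  ciSup_le fun x => abs_empiricalDeviation_le (hM x) hn ξ

theorem continuous_empiricalDeviation [PseudoMetricSpace X] {ψ : X → Y → ℝ}
    (hψ : ∀ x, Measurable (ψ x)) (hM : ∀ x y, |ψ x y| ≤ M)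
    (hL : ∀ x x' y, |ψ x y - ψ x' y| ≤ M * dist x x') (hM0 : 0 ≤ M) (hn : 1 ≤ n)
    (ξ : Fin n → Y) : Continuous fun x => empiricalDeviation μ (ψ x) ξ := by
  have hint : ∀ x, Integrable (ψ x) μ := fun x =>
    Integrable.of_bound (hψ x).aestronglyMeasurable M (Filter.Eventually.of_forall (hM x))
  refine (LipschitzWith.of_dist_le_mul (K := ⟨2 * M, by positivity⟩) fun x x' => ?_).continuous
  rw [Real.dist_eq, ← empiricalDeviation_sub (hint x) (hint x')]
  refine (abs_empiricalDeviation_le (hL x x') hn ξ).trans_eq ?_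
  change 2 * (M * dist x x') = 2 * M * dist x x'
  ring

/-- The expected largest deviation for a random Lipschitz family that is independent of the
sample. -/
theorem integral_supDeviation_le [PseudoMetricSpace X] [CompactSpace X] [Nonempty X]
    {D : ℝ} (hD : 0 < D) (hM : 0 < M) (hX : HasDyadicNets X D) :
    ∃ c : ℝ, 0 < c ∧ ∀ (Y Θ Ω : Type*) [MeasurableSpace Y] [MeasurableSpace Θ]
      [MeasurableSpace Ω] (μ : Measure Y) [IsProbabilityMeasure μ] (P : Measure Ω)
      [IsProbabilityMeasure P] (ψ : Θ → X → Y → ℝ) (n : ℕ) (θ : Ω → Θ) (ξ : Ω → Fin n → Y),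
      (∀ x, Measurable fun p : Θ × Y => ψ p.1 x p.2) → (∀ θ x y, |ψ θ x y| ≤ M) →
      (∀ θ x x' y, |ψ θ x y - ψ θ x' y| ≤ M * dist x x') → 1 ≤ n →
      Measurable θ → Measurable ξ → IndepFun θ ξ P → P.map ξ = Measure.pi (fun _ => μ) →
      Measurable (fun ω => supDeviation μ (ψ (θ ω)) (ξ ω)) ∧
        Integrable (fun ω => supDeviation μ (ψ (θ ω)) (ξ ω)) P ∧
        ∫ ω, supDeviation μ (ψ (θ ω)) (ξ ω) ∂P ≤ c / Real.sqrt n := by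
  obtain ⟨c, hc, H⟩ := exists_majorant_empiricalDeviation hD hM hX
  refine ⟨c, hc, ?_⟩
  intro Y Θ Ω _ _ _ μ _ P _ ψ n θ ξ hψ hψM hψL hn hθ hξ hind hlaw
  have hψ' : ∀ θ x, Measurable (ψ θ x) := fun θ x => (hψ x).comp measurable_prodMk_left
  have hZ : Measurable fun p : Θ × (Fin n → Y) => supDeviation μ (ψ p.1) p.2 := by
    refine measurable_iSup_of_continuous (F := fun (p : Θ × (Fin n → Y)) x =>
      |empiricalDeviation μ (ψ p.1 x) p.2|) (fun x => ?_)
      (fun p => (continuous_empiricalDeviation (hψ' p.1) (hψM p.1) (hψL p.1) hM.le hn p.2).abs)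
    have h1 : Measurable fun p : Θ × (Fin n → Y) => ∑ j, ψ p.1 x (p.2 j) :=
      Finset.measurable_fun_sum _ fun j _ => (hψ x).comp
        (measurable_fst.prodMk ((measurable_pi_apply j).comp measurable_snd))
    have h2 : Measurable fun p : Θ × (Fin n → Y) => ∫ y, ψ p.1 x y ∂μ :=
      ((hψ x).stronglyMeasurable.integral_prod_right' (ν := μ)).measurable.comp measurable_fst
    have h3 : Measurable fun p : Θ × (Fin n → Y) => empiricalDeviation μ (ψ p.1 x) p.2 :=
      (h1.div_const _).sub h2
    exact continuous_abs.measurable.comp h3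
  have hbd : ∀ p : Θ × (Fin n → Y), ‖supDeviation μ (ψ p.1) p.2‖ ≤ 2 * M := fun p => by
    rw [Real.norm_of_nonneg (supDeviation_nonneg _ _)]
    exact supDeviation_le (hψM p.1) hn p.2
  have hm := hZ.comp (hθ.prodMk hξ)
  refine ⟨hm, Integrable.of_bound hm.aestronglyMeasurable (2 * M)
    (Filter.Eventually.of_forall fun ω => hbd (θ ω, ξ ω)), ?_⟩
  -- Independence makes the joint law a product. The inner integral then runs over the sample with
  -- the family frozen, where the chaining bound applies with a constant that depends on the family
  -- only through M.
  have hjoint := (indepFun_iff_map_prod_eq_prod_map_map hθ.aemeasurable hξ.aemeasurable).1 hind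
  have : IsProbabilityMeasure (P.map θ) := Measure.isProbabilityMeasure_map hθ.aemeasurable
  have e1 : ∫ ω, supDeviation μ (ψ (θ ω)) (ξ ω) ∂P
      = ∫ p, supDeviation μ (ψ p.1) p.2 ∂((P.map θ).prod (Measure.pi fun _ : Fin n => μ)) := by
    rw [← hlaw, ← hjoint, integral_map (hθ.prodMk hξ).aemeasurable hZ.aestronglyMeasurable]
  have hi : Integrable (fun p : Θ × (Fin n → Y) => supDeviation μ (ψ p.1) p.2)
      ((P.map θ).prod (Measure.pi fun _ : Fin n => μ)) :=
    Integrable.of_bound hZ.aestronglyMeasurable (2 * M) (Filter.Eventually.of_forall hbd)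
  rw [e1, integral_prod _ hi]
  have hin : ∀ θ, ∫ ξ, supDeviation μ (ψ θ) ξ ∂(Measure.pi fun _ : Fin n => μ)
      ≤ c / Real.sqrt n := by
    intro θ
    obtain ⟨G, hGi, hG, hGI⟩ := H Y μ (ψ θ) (hψ' θ) (hψM θ) (hψL θ) n hn
    refine le_trans (integral_mono ?_ hGi fun ξ => ciSup_le fun x => hG x ξ) hGI
    exact Integrable.of_bound (hZ.comp measurable_prodMk_left).aestronglyMeasurable (2 * M)
      (Filter.Eventually.of_forall fun ξ => hbd (θ, ξ))
  calc _ ≤ ∫ _θ, c / Real.sqrt n ∂(P.map θ) :=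
        integral_mono hi.integral_prod_left (integrable_const _) hin
    _ = _ := by simp

end SupDeviation

/-- Both hypotheses together say that the law of (S, Y, Z) is a product of three measures, and such
a product may be bracketed either way. -/
theorem indepFun_prodMk_left {Ω A B C : Type*} [MeasurableSpace Ω] [MeasurableSpace A]
    [MeasurableSpace B] [MeasurableSpace C] {P : Measure Ω} [IsProbabilityMeasure P]
    {S : Ω → A} {Y : Ω → B} {Z : Ω → C} (hS : Measurable S) (hY : Measurable Y)
    (hZ : Measurable Z) (h : IndepFun S (fun ω => (Y ω, Z ω)) P) (h' : IndepFun Y Z P) :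
    IndepFun (fun ω => (S ω, Y ω)) Z P := by
  have h1 := (indepFun_iff_map_prod_eq_prod_map_map hS.aemeasurable
    (hY.prodMk hZ).aemeasurable).1 h
  have h2 := (indepFun_iff_map_prod_eq_prod_map_map hY.aemeasurable hZ.aemeasurable).1 h'
  have h3 : P.map (fun ω => (S ω, Y ω)) = (P.map S).prod (P.map Y) := (indepFun_iff_map_prod_eq_prod_map_map hS.aemeasurable hY.aemeasurable).1
    (h.comp measurable_id measurable_fst)
  have : IsProbabilityMeasure (P.map S) := Measure.isProbabilityMeasure_map hS.aemeasurable
  have : IsProbabilityMeasure (P.map Y) := Measure.isProbabilityMeasure_map hY.aemeasurable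
  have : IsProbabilityMeasure (P.map Z) := Measure.isProbabilityMeasure_map hZ.aemeasurable
  refine (indepFun_iff_map_prod_eq_prod_map_map (hS.prodMk hY).aemeasurable hZ.aemeasurable).2 ?_
  rw [h3]
  have e : P.map (fun ω => ((S ω, Y ω), Z ω))
      = (P.map fun ω => (S ω, (Y ω, Z ω))).map MeasurableEquiv.prodAssoc.symm := by
    rw [Measure.map_map MeasurableEquiv.prodAssoc.symm.measurable (hS.prodMk (hY.prodMk hZ))]
    rfl
  rw [e, h1, h2, ← Measure.prodAssoc_prod, MeasurableEquiv.map_symm_map]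

/-! ### The state, the batches and their independence. -/

namespace Run

variable {X : Type*} [MeasurableSpace X] {α β : Measure X} {η : ℕ → ℝ} {bs m : ℕ → ℕ}
  {Ω : Type*} [MeasurableSpace Ω] {P : Measure Ω}

/-- The weights and points in use at iteration `t`. -/
def state (R : Run α β η bs m P) (t : ℕ) (ω : Ω) :
    (Fin (m t) → X) × (Fin (m t) → ℝ) × (Fin (m t) → X) × (Fin (m t) → ℝ) :=
  (R.xhat t ω, R.phat t ω, R.yhat t ω, R.qhat t ω)

/-- The batch from `α` drawn in iteration `t`. -/
def xbatch (R : Run α β η bs m P) (t : ℕ) (ω : Ω) (j : Fin (bs t)) : X :=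
  R.x (sampleCount bs t + j) ω

/-- The batch from `β` drawn in iteration `t`. -/
def ybatch (R : Run α β η bs m P) (t : ℕ) (ω : Ω) (j : Fin (bs t)) : X :=
  R.y (sampleCount bs t + j) ω

theorem measurable_state (R : Run α β η bs m P) {t : ℕ} (ht : 1 ≤ t) : Measurable (R.state t) :=
  (R.measurable_xhat t ht).prodMk ((R.measurable_phat t ht).prodMk
    ((R.measurable_yhat t ht).prodMk (R.measurable_qhat t ht)))

theorem measurable_xbatch (R : Run α β η bs m P) (t : ℕ) : Measurable (R.xbatch t) :=
  measurable_pi_lambda _ fun _ => R.measurable_x _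

theorem measurable_ybatch (R : Run α β η bs m P) (t : ℕ) : Measurable (R.ybatch t) :=
  measurable_pi_lambda _ fun _ => R.measurable_y _

theorem measurable_sample (R : Run α β η bs m P) (i : ℕ ⊕ ℕ) : Measurable (Sum.elim R.x R.y i) := by
  rcases i with i | i
  · exact R.measurable_x i
  · exact R.measurable_y i

theorem map_xbatch (R : Run α β η bs m P) (t : ℕ) :
    P.map (R.xbatch t) = Measure.pi fun _ => α := by
  have : IsProbabilityMeasure P := R.indep_samples.isProbabilityMeasure
  have hinj : Function.Injective fun j : Fin (bs t) => (Sum.inl (sampleCount bs t + j) : ℕ ⊕ ℕ) :=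
    fun i j h => by
      have := Sum.inl.inj h
      exact Fin.ext (by omega)
  have h := (iIndepFun_iff_map_fun_eq_pi_map fun j => (R.measurable_x _).aemeasurable).1
    (R.indep_samples.precomp hinj)
  simp only [R.law_x] at h
  exact h

theorem map_ybatch (R : Run α β η bs m P) (t : ℕ) :
    P.map (R.ybatch t) = Measure.pi fun _ => β := by
  have : IsProbabilityMeasure P := R.indep_samples.isProbabilityMeasure
  have hinj : Function.Injective fun j : Fin (bs t) => (Sum.inr (sampleCount bs t + j) : ℕ ⊕ ℕ) :=
    fun i j h => by
      have := Sum.inr.inj h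
      exact Fin.ext (by omega)
  have h := (iIndepFun_iff_map_fun_eq_pi_map fun j => (R.measurable_y _).aemeasurable).1
    (R.indep_samples.precomp hinj)
  simp only [R.law_y] at h
  exact h

theorem indepFun_ybatch_xbatch (R : Run α β η bs m P) (t : ℕ) :
    IndepFun (R.ybatch t) (R.xbatch t) P := by
  classical
  let SY : Finset (ℕ ⊕ ℕ) :=
    Finset.univ.image fun j : Fin (bs t) => Sum.inr (sampleCount bs t + j)
  let SX : Finset (ℕ ⊕ ℕ) :=
    Finset.univ.image fun j : Fin (bs t) => Sum.inl (sampleCount bs t + j)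
  have hdisj : Disjoint SY SX := by
    rw [Finset.disjoint_left]
    intro i hi hi'
    simp only [SY, SX, Finset.mem_image, Finset.mem_univ, true_and] at hi hi'
    obtain ⟨j, rfl⟩ := hi
    obtain ⟨j', h⟩ := hi'
    cases h
  have h := R.indep_samples.indepFun_finset SY SX hdisj R.measurable_sample
  exact h.comp
    (φ := fun (f : SY → X) (j : Fin (bs t)) => f ⟨Sum.inr (sampleCount bs t + j),
      Finset.mem_image_of_mem _ (Finset.mem_univ j)⟩)
    (ψ := fun (f : SX → X) (j : Fin (bs t)) => f ⟨Sum.inl (sampleCount bs t + j),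
      Finset.mem_image_of_mem _ (Finset.mem_univ j)⟩)
    (measurable_pi_lambda _ fun _ => measurable_pi_apply _)
    (measurable_pi_lambda _ fun _ => measurable_pi_apply _)

theorem indepFun_state_batches (R : Run α β η bs m P) {t : ℕ} (ht : 1 ≤ t) :
    IndepFun (R.state t) (fun ω => (R.ybatch t ω, R.xbatch t ω)) P :=
  (R.nonanticipating t ht).comp measurable_id
    (ψ := fun f : ℕ → X × X => ((fun j : Fin (bs t) => (f j).2), (fun j : Fin (bs t) => (f j).1)))
    ((measurable_pi_lambda _ fun _ => (measurable_pi_apply _).snd).prodMk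
      (measurable_pi_lambda _ fun _ => (measurable_pi_apply _).fst))

theorem indepFun_state_ybatch (R : Run α β η bs m P) {t : ℕ} (ht : 1 ≤ t) :
    IndepFun (R.state t) (R.ybatch t) P :=
  (R.indepFun_state_batches ht).comp measurable_id measurable_fst

theorem indepFun_state_ybatch_xbatch (R : Run α β η bs m P) {t : ℕ} (ht : 1 ≤ t) :
    IndepFun (fun ω => (R.state t ω, R.ybatch t ω)) (R.xbatch t) P :=
  have : IsProbabilityMeasure P := R.indep_samples.isProbabilityMeasure
  indepFun_prodMk_left (R.measurable_state ht) (R.measurable_ybatch t) (R.measurable_xbatch t)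
    (R.indepFun_state_batches ht) (R.indepFun_ybatch_xbatch t)

end Run

/-! ### The algorithm in exponential variables, as a function of state and batch. -/

/-- The Gibbs kernel `exp (-c / ε)`. -/
def gibbs {X : Type*} (ε : ℝ) (c : X → X → ℝ) (x y : X) : ℝ := Real.exp (-c x y / ε)

/-- The sum inside the logarithm of `atomicPotential`. -/
def atomicSum {X : Type*} (ε : ℝ) (c : X → X → ℝ) {m : ℕ} (w : Fin m → ℝ) (z : Fin m → X)
    (x : X) : ℝ :=
  ∑ i, Real.exp ((w i - c x (z i)) / ε)

section Atomic

variable {X : Type*} {ε : ℝ} {c : X → X → ℝ} {m n : ℕ}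

theorem exp_sub_div (ε a b : ℝ) : Real.exp ((a - b) / ε) = Real.exp (a / ε) * Real.exp (-b / ε) := by
  rw [← Real.exp_add]; congr 1; ring

theorem atomicSum_pos (hm : 1 ≤ m) (w : Fin m → ℝ) (z : Fin m → X) (x : X) :
    0 < atomicSum ε c w z x :=
  have : Nonempty (Fin m) := ⟨⟨0, hm⟩⟩
  Finset.sum_pos (fun _ _ => Real.exp_pos _) Finset.univ_nonempty

/-- Source of the a priori ratio bound: every compressed potential is a positive combination of
kernel sections, with whatever weights and points the compression has chosen. -/
theorem atomicSum_ratioLE [MeasurableSpace X] {μ : Measure X} {us vs : X → ℝ} {κ₁ κ₂ σ₁ σ₂ : ℝ}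
    (H : IsScalingPair μ (gibbs ε c) us vs κ₁ κ₂ σ₁ σ₂) (w : Fin m → ℝ) (z : Fin m → X) :
    RatioLE (atomicSum ε c w z) (κ₂ / κ₁) := by
  intro x x'
  unfold atomicSum
  rw [Finset.mul_sum]
  refine Finset.sum_le_sum fun i _ => ?_
  rw [exp_sub_div, exp_sub_div]
  have := mul_le_mul_of_nonneg_left (H.kernel_ratio x x' (z i)) (Real.exp_pos (w i / ε)).le
  unfold gibbs at this
  linarith

theorem measurable_atomicSum [MeasurableSpace X] (hc : Measurable (Function.uncurry c)) :
    Measurable fun p : ((Fin m → ℝ) × (Fin m → X)) × X => atomicSum ε c p.1.1 p.1.2 p.2 := by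
  refine Finset.measurable_fun_sum _ fun i _ => Real.measurable_exp.comp (Measurable.div_const ?_ _)
  refine ((measurable_pi_apply i).comp (measurable_fst.comp measurable_fst)).sub ?_
  exact hc.comp (measurable_snd.prodMk
    ((measurable_pi_apply i).comp (measurable_snd.comp measurable_fst)))

theorem measurable_atomicSum_right [MeasurableSpace X] (hc : Measurable (Function.uncurry c))
    (w : Fin m → ℝ) (z : Fin m → X) : Measurable (atomicSum ε c w z) := by
  have h := (measurable_atomicSum (ε := ε) (m := m) hc).comp (measurable_prodMk_left (x := (w, z)))
  exact h

theorem measurable_empiricalTarget {Θ : Type*} [MeasurableSpace Θ] {k : X → X → ℝ}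
    {V : Θ → X → ℝ} {ξ : Θ → Fin n → X} {x : Θ → X}
    (hk : ∀ j, Measurable fun p => k (x p) (ξ p j)) (hV : ∀ j, Measurable fun p => V p (ξ p j)) :
    Measurable fun p => empiricalTarget k (V p) (ξ p) (x p) := by
  unfold empiricalTarget
  have h : ∀ j, Measurable fun p => k (x p) (ξ p j) / V p (ξ p j) := fun j => (hk j).div (hV j)
  have h' : Measurable fun p => ∑ j, k (x p) (ξ p j) / V p (ξ p j) :=
    Finset.measurable_fun_sum _ fun j _ => h j
  exact h'.div_const _

theorem continuous_atomicPotential [TopologicalSpace X] (hc : Continuous (Function.uncurry c))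
    (hm : 1 ≤ m) (w : Fin m → ℝ) (z : Fin m → X) : Continuous (atomicPotential ε c w z) := by
  have h : Continuous (atomicSum ε c w z) := continuous_finsetSum _ fun i _ =>
    Real.continuous_exp.comp ((continuous_const.sub
      (hc.comp (continuous_id.prodMk continuous_const))).div_const _)
  exact continuous_const.mul (h.log fun x => (atomicSum_pos hm w z x).ne')

/-- Reveals the update as a convex combination of the old exponential and the empirical target. -/
theorem onlineUpdate_eq (hε : ε ≠ 0) (η : ℝ) (w : Fin m → ℝ) (z : Fin m → X) {h v : X → ℝ}
    (hv : ∀ x, 0 < v x) (hh : ∀ x, h x = -ε * Real.log (v x)) (ξ : Fin n → X) (x : X) :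
    onlineUpdate ε c η w z h ξ x = -ε * Real.log ((1 - η) * atomicSum ε c w z x
      + η * empiricalTarget (gibbs ε c) v ξ x) := by
  unfold onlineUpdate atomicSum empiricalTarget
  rw [Finset.mul_sum, mul_div_assoc', Finset.mul_sum, Finset.sum_div]
  congr 4
  ext j
  have e : Real.exp (h (ξ j) / ε) = (v (ξ j))⁻¹ := by
    rw [hh, neg_mul, neg_div, mul_div_cancel_left₀ _ hε, Real.exp_neg, Real.exp_log (hv _)]
  rw [exp_sub_div, e]
  unfold gibbs
  ring

/-- Translates an additive error of a potential into a multiplicative error of its exponential; this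
is how compression enters. -/
theorem le_exp_mul_of_abs_log_le {u u' f f' δ : ℝ} (hε : 0 < ε) (hu : 0 < u) (hu' : 0 < u')
    (hf : f = -ε * Real.log u) (hf' : f' = -ε * Real.log u') (h : |f - f'| ≤ ε * δ) :
    u' ≤ Real.exp δ * u ∧ u ≤ Real.exp δ * u' := by
  have e : f - f' = ε * (Real.log u' - Real.log u) := by rw [hf, hf']; ring
  rw [e, abs_mul, abs_of_pos hε] at h
  have h2 := abs_le.1 (le_of_mul_le_mul_left h hε)
  constructor
  · rw [← Real.exp_log hu', ← Real.exp_log hu, ← Real.exp_add]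
    exact Real.exp_le_exp.2 (by linarith)
  · rw [← Real.exp_log hu', ← Real.exp_log hu, ← Real.exp_add]
    exact Real.exp_le_exp.2 (by linarith)

end Atomic

namespace IsScalingPair

variable {X : Type*} [MeasurableSpace X] {μ : Measure X} {k : X → X → ℝ} {us vs : X → ℝ}
  {κ₁ κ₂ σ₁ σ₂ : ℝ}

theorem update_pos_ratioLE (H : IsScalingPair μ k us vs κ₁ κ₂ σ₁ σ₂) {u v : X → ℝ}
    (hu : ∀ x, 0 < u x) (hv : ∀ x, 0 < v x) (hur : RatioLE u (κ₂ / κ₁)) {n : ℕ} (hn : 1 ≤ n)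
    (ξ : Fin n → X) {η : ℝ} (hη0 : 0 ≤ η) (hη1 : η ≤ 1) :
    (∀ x, 0 < (1 - η) * u x + η * empiricalTarget k v ξ x) ∧
      RatioLE (fun x => (1 - η) * u x + η * empiricalTarget k v ξ x) (κ₂ / κ₁) := by
  have hη1' := sub_nonneg.2 hη1
  constructor
  · intro x
    have hn' : (0 : ℝ) < n := by exact_mod_cast hn
    have hne : Nonempty (Fin n) := ⟨⟨0, hn⟩⟩
    have hq : 0 < empiricalTarget k v ξ x := div_pos (Finset.sum_pos
      (fun j _ => div_pos (H.kernel_pos _ _) (hv _)) Finset.univ_nonempty) hn'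
    rcases hη0.eq_or_lt with h | h
    · rw [← h]; simpa using hu x
    · exact add_pos_of_nonneg_of_pos (mul_nonneg hη1' (hu x).le) (mul_pos h hq)
  · intro x x'
    have h1 := mul_le_mul_of_nonneg_left (hur x x') hη1'
    have h2 := mul_le_mul_of_nonneg_left (H.empiricalTarget_ratioLE hv ξ x x') hη0
    simp only
    linarith

/-- The addend Λ is there so that one constant serves both as uniform bound and as Lipschitz
constant, as the chaining estimate expects. -/
theorem abs_kernel_mul_ratio_le (H : IsScalingPair μ k us vs κ₁ κ₂ σ₁ σ₂) {w : X → ℝ}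
    (hw : ∀ x, 0 < w x) (hr : RatioLE w (κ₂ / κ₁)) {Λ : ℝ} (hΛ : 0 ≤ Λ) (x₀ x y : X) :
    |k x y * (w x₀ / w y)| ≤ (κ₂ + Λ) * (κ₂ / κ₁) := by
  have h1 := H.κ₁_pos
  have h2 := h1.trans_le (H.κ₁_le x)
  have h3 : w x₀ / w y ≤ κ₂ / κ₁ := (div_le_iff₀ (hw y)).2 (hr x₀ y)
  have h4 : 0 < w x₀ / w y := div_pos (hw _) (hw _)
  rw [abs_of_pos (mul_pos (H.kernel_pos x y) h4)]
  have := H.kernel_le x y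
  exact mul_le_mul (by linarith) h3 h4.le (by positivity)

theorem abs_kernel_mul_ratio_sub_le [PseudoMetricSpace X]
    (H : IsScalingPair μ k us vs κ₁ κ₂ σ₁ σ₂) {w : X → ℝ}
    (hw : ∀ x, 0 < w x) (hr : RatioLE w (κ₂ / κ₁)) {Λ : ℝ} (hΛ : 0 ≤ Λ)
    (hL : ∀ x x' y, |k x y - k x' y| ≤ Λ * dist x x') (x₀ x x' y : X) :
    |k x y * (w x₀ / w y) - k x' y * (w x₀ / w y)| ≤ (κ₂ + Λ) * (κ₂ / κ₁) * dist x x' := by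
  have h1 := H.κ₁_pos
  have h2 := h1.trans_le (H.κ₁_le x)
  have h3 : w x₀ / w y ≤ κ₂ / κ₁ := (div_le_iff₀ (hw y)).2 (hr x₀ y)
  have h4 : 0 < w x₀ / w y := div_pos (hw _) (hw _)
  rw [← sub_mul, abs_mul, abs_of_pos h4]
  calc |k x y - k x' y| * (w x₀ / w y) ≤ ((κ₂ + Λ) * dist x x') * (κ₂ / κ₁) := by
        have := hL x x' y
        have h5 : 0 ≤ κ₂ * dist x x' := by positivity
        gcongr
        linarith
    _ = _ := by ring

end IsScalingPair

/-- `exp (-ĝ / ε)` as a function of the state of the algorithm. -/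
def stateV {X : Type*} (ε : ℝ) (C : X → X → ℝ) {m : ℕ}
    (θ : (Fin m → X) × (Fin m → ℝ) × (Fin m → X) × (Fin m → ℝ)) : X → ℝ :=
  atomicSum ε (fun y x => C x y) θ.2.1 θ.1

/-- `exp (-f / ε)` after the update, as a function of the state and the batch. -/
def stateU {X : Type*} (ε : ℝ) (C : X → X → ℝ) (η : ℝ) {m n : ℕ}
    (θ : ((Fin m → X) × (Fin m → ℝ) × (Fin m → X) × (Fin m → ℝ)) × (Fin n → X)) (x : X) : ℝ :=
  (1 - η) * atomicSum ε C θ.1.2.2.2 θ.1.2.2.1 x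
    + η * empiricalTarget (gibbs ε C) (stateV ε C θ.1) θ.2 x

section State

variable {X : Type*} [MeasurableSpace X] {ε : ℝ} {C : X → X → ℝ} {m n : ℕ}

theorem measurable_gibbs (hC : Measurable (Function.uncurry C)) :
    Measurable (Function.uncurry (gibbs ε C)) :=
  Real.measurable_exp.comp ((hC.neg).div_const ε)

theorem measurable_stateV (hC : Measurable (Function.uncurry C)) :
    Measurable fun p : ((Fin m → X) × (Fin m → ℝ) × (Fin m → X) × (Fin m → ℝ)) × X =>
      stateV ε C p.1 p.2 := by
  have hCs : Measurable (Function.uncurry fun y x => C x y) := hC.comp measurable_swap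
  have hg : Measurable fun p : ((Fin m → X) × (Fin m → ℝ) × (Fin m → X) × (Fin m → ℝ)) × X =>
      ((p.1.2.1, p.1.1), p.2) := by fun_prop
  have h := (measurable_atomicSum (ε := ε) (m := m) hCs).comp hg
  exact h

theorem measurable_stateU (hC : Measurable (Function.uncurry C)) (η : ℝ) :
    Measurable fun p : (((Fin m → X) × (Fin m → ℝ) × (Fin m → X) × (Fin m → ℝ)) ×
      (Fin n → X)) × X => stateU ε C η p.1 p.2 := by
  have hg : Measurable fun p : (((Fin m → X) × (Fin m → ℝ) × (Fin m → X) × (Fin m → ℝ)) ×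
      (Fin n → X)) × X => ((p.1.1.2.2.2, p.1.1.2.2.1), p.2) := by fun_prop
  have h1 := (measurable_atomicSum (ε := ε) (m := m) hC).comp hg
  have hξ : ∀ j, Measurable fun p : (((Fin m → X) × (Fin m → ℝ) × (Fin m → X) ×
      (Fin m → ℝ)) × (Fin n → X)) × X => p.1.2 j := fun j => by fun_prop
  have hk : ∀ j, Measurable fun p : (((Fin m → X) × (Fin m → ℝ) × (Fin m → X) ×
      (Fin m → ℝ)) × (Fin n → X)) × X => gibbs ε C p.2 (p.1.2 j) := fun j => by
    have h := (measurable_gibbs (ε := ε) hC).comp (measurable_snd.prodMk (hξ j))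
    exact h
  have hV : ∀ j, Measurable fun p : (((Fin m → X) × (Fin m → ℝ) × (Fin m → X) ×
      (Fin m → ℝ)) × (Fin n → X)) × X => stateV ε C p.1.1 (p.1.2 j) := fun j => by
    have h := (measurable_stateV (ε := ε) (m := m) hC).comp
      ((measurable_fst.comp measurable_fst).prodMk (hξ j))
    exact h
  have h2 := measurable_empiricalTarget hk hV
  have h3 := (h1.const_mul (1 - η)).add (h2.const_mul η)
  exact h3

end State

/-- A random positive function of bounded ratio, independent of the sample, has scale-free
sampling errors of the order of the inverse square root of the sample size. -/
theorem IsScalingPair.exists_noise_bound {X : Type*} [MeasurableSpace X] {μ : Measure X}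
    [IsProbabilityMeasure μ] {k : X → X → ℝ} {us vs : X → ℝ} {κ₁ κ₂ σ₁ σ₂ : ℝ}
    [PseudoMetricSpace X] [CompactSpace X] {D : ℝ} (hD : 0 < D) (hX : HasDyadicNets X D)
    (H : IsScalingPair μ k us vs κ₁ κ₂ σ₁ σ₂) (hk : Measurable (Function.uncurry k)) {Λ : ℝ}
    (hΛ : 0 ≤ Λ) (hL : ∀ x x' y, |k x y - k x' y| ≤ Λ * dist x x') (x₀ : X) :
    ∃ c : ℝ, 0 < c ∧ ∀ (Θ Ω : Type*) [MeasurableSpace Θ] [MeasurableSpace Ω] (P : Measure Ω)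
      [IsProbabilityMeasure P] (V : Θ → X → ℝ) (n : ℕ) (θ : Ω → Θ) (ξ : Ω → Fin n → X),
      Measurable (fun p : Θ × X => V p.1 p.2) → (∀ θ x, 0 < V θ x) →
      (∀ θ, RatioLE (V θ) (κ₂ / κ₁)) → 1 ≤ n → Measurable θ → Measurable ξ → IndepFun θ ξ P →
      P.map ξ = Measure.pi (fun _ => μ) →
      Integrable (fun ω => supDeviation μ
          (fun x y => k x y * (V (θ ω) x₀ / V (θ ω) y)) (ξ ω)) P ∧
        ∫ ω, supDeviation μ (fun x y => k x y * (V (θ ω) x₀ / V (θ ω) y)) (ξ ω) ∂P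
          ≤ c / Real.sqrt n := by
  have hne : Nonempty X := ⟨x₀⟩
  have hκ := H.κ₁_pos
  have hκ2 := hκ.trans_le (H.κ₁_le x₀)
  obtain ⟨c, hc, hc'⟩ := integral_supDeviation_le (X := X) (M := (κ₂ + Λ) * (κ₂ / κ₁)) hD
    (by positivity) hX
  refine ⟨c, hc, fun Θ Ω _ _ P _ V n θ ξ hVm hVp hVr hn hθ hξ hind hlaw => ?_⟩
  have hV₀ : Measurable fun p : Θ × X => V p.1 x₀ := by
    have hg : Measurable fun p : Θ × X => (p.1, x₀) := measurable_fst.prodMk measurable_const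
    have h := hVm.comp hg
    exact h
  have hψ : ∀ x, Measurable fun p : Θ × X => k x p.2 * (V p.1 x₀ / V p.1 p.2) := fun x => by
    have hg : Measurable fun p : Θ × X => (x, p.2) := measurable_const.prodMk measurable_snd
    have h := hk.comp hg
    exact h.mul (hV₀.div hVm)
  exact (hc' X Θ Ω μ P (fun θ x y => k x y * (V θ x₀ / V θ y)) n θ ξ hψ
    (fun θ x y => H.abs_kernel_mul_ratio_le (hVp θ) (hVr θ) hΛ x₀ x y)
    (fun θ x x' y => H.abs_kernel_mul_ratio_sub_le (hVp θ) (hVr θ) hΛ hL x₀ x x' y) hn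
    hθ hξ hind hlaw).2

/-! ### Sampling errors along a run and the pathwise majorant. -/

namespace Run

variable {X : Type*} [MeasurableSpace X] {α β : Measure X} {η : ℕ → ℝ} {bs m : ℕ → ℕ}
  {Ω : Type*} [MeasurableSpace Ω] {P : Measure Ω}

/-- `exp (-f̂_t / ε)`. -/
def usum (R : Run α β η bs m P) (ε : ℝ) (C : X → X → ℝ) (t : ℕ) (ω : Ω) : X → ℝ :=
  atomicSum ε C (R.qhat t ω) (R.yhat t ω)

/-- `exp (-ĝ_t / ε)`. -/
def vsum (R : Run α β η bs m P) (ε : ℝ) (C : X → X → ℝ) (t : ℕ) (ω : Ω) : X → ℝ :=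
  atomicSum ε (fun y x => C x y) (R.phat t ω) (R.xhat t ω)

/-- `exp (-f_{t+1} / ε)`. -/
def unext (R : Run α β η bs m P) (ε : ℝ) (C : X → X → ℝ) (t : ℕ) (ω : Ω) (x : X) : ℝ :=
  (1 - η t) * R.usum ε C t ω x
    + η t * empiricalTarget (gibbs ε C) (R.vsum ε C t ω) (R.ybatch t ω) x

/-- `exp (-g_{t+1} / ε)`. -/
def vnext (R : Run α β η bs m P) (ε : ℝ) (C : X → X → ℝ) (t : ℕ) (ω : Ω) (y : X) : ℝ :=
  (1 - η t) * R.vsum ε C t ω y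
    + η t * empiricalTarget (fun y x => gibbs ε C x y) (R.unext ε C t ω) (R.xbatch t ω) y

/-- The scale-free sampling error of the `f`-update. -/
def noiseY (R : Run α β η bs m P) (ε : ℝ) (C : X → X → ℝ) (x₀ : X) (t : ℕ) (ω : Ω) : ℝ :=
  supDeviation β (fun x y => gibbs ε C x y * (R.vsum ε C t ω x₀ / R.vsum ε C t ω y))
    (R.ybatch t ω)

/-- The scale-free sampling error of the `g`-update. -/
def noiseX (R : Run α β η bs m P) (ε : ℝ) (C : X → X → ℝ) (x₀ : X) (t : ℕ) (ω : Ω) : ℝ :=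
  supDeviation α (fun y x => gibbs ε C x y * (R.unext ε C t ω x₀ / R.unext ε C t ω x))
    (R.xbatch t ω)

/-- A pathwise upper bound for the relative oscillations at iteration `n + 1`. -/
def errorMajorant (R : Run α β η bs m P) (ε : ℝ) (C : X → X → ℝ) (x₀ : X) (c g h B₁ : ℝ)
    (δ : ℕ → ℝ) : ℕ → Ω → ℝ
  | 0, _ => B₁
  | n + 1, ω => R.errorMajorant ε C x₀ c g h B₁ δ n ω * (1 - η (n + 1) * c)
      + η (n + 1) * g * (R.noiseY ε C x₀ (n + 1) ω + R.noiseX ε C x₀ (n + 1) ω) + h * δ (n + 1)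

section Majorant

variable {ε : ℝ} {C : X → X → ℝ} {us vs : X → ℝ} {κ₁ κ₂ σ₁ σ₂ : ℝ}

theorem usum_pos (R : Run α β η bs m P) {t : ℕ} (hm : 1 ≤ m t) (ω : Ω) (x : X) :
    0 < R.usum ε C t ω x := atomicSum_pos hm _ _ _

theorem vsum_pos (R : Run α β η bs m P) {t : ℕ} (hm : 1 ≤ m t) (ω : Ω) (y : X) :
    0 < R.vsum ε C t ω y := atomicSum_pos hm _ _ _

theorem usum_ratioLE (R : Run α β η bs m P)
    (H : IsScalingPair β (gibbs ε C) us vs κ₁ κ₂ σ₁ σ₂) (t : ℕ) (ω : Ω) :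
    RatioLE (R.usum ε C t ω) (κ₂ / κ₁) := atomicSum_ratioLE H _ _

theorem vsum_ratioLE (R : Run α β η bs m P)
    (H' : IsScalingPair α (fun y x => gibbs ε C x y) vs us κ₁ κ₂ σ₁ σ₂) (t : ℕ) (ω : Ω) :
    RatioLE (R.vsum ε C t ω) (κ₂ / κ₁) := atomicSum_ratioLE (c := fun y x => C x y) H' _ _

theorem measurable_usum (R : Run α β η bs m P) (hC : Measurable (Function.uncurry C)) (t : ℕ)
    (ω : Ω) : Measurable (R.usum ε C t ω) := measurable_atomicSum_right hC _ _

theorem measurable_vsum (R : Run α β η bs m P) (hC : Measurable (Function.uncurry C)) (t : ℕ)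
    (ω : Ω) : Measurable (R.vsum ε C t ω) :=
  measurable_atomicSum_right (c := fun y x => C x y) (hC.comp measurable_swap) _ _

theorem usum_one (R : Run α β η bs m P) (ω : Ω) (x : X) :
    R.usum ε C 1 ω x = ∑ i, gibbs ε C x (R.yhat 1 ω i) := by
  simp only [usum, atomicSum, R.init_qhat, zero_sub, gibbs]

theorem vsum_one (R : Run α β η bs m P) (ω : Ω) (y : X) :
    R.vsum ε C 1 ω y = ∑ i, gibbs ε C (R.xhat 1 ω i) y := by
  simp only [vsum, atomicSum, R.init_phat, zero_sub, gibbs]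

/-- Initially all weights are zero, so each exponential at x₀ is a sum of m₁ kernel values. -/
theorem scale_one_bounds (R : Run α β η bs m P)
    (H : IsScalingPair β (gibbs ε C) us vs κ₁ κ₂ σ₁ σ₂) (hm : 1 ≤ m 1) (ω : Ω) (x₀ : X) :
    (m 1 * κ₁) * (m 1 * κ₁) ≤ R.usum ε C 1 ω x₀ * R.vsum ε C 1 ω x₀ ∧
      R.usum ε C 1 ω x₀ * R.vsum ε C 1 ω x₀ ≤ (m 1 * κ₂) * (m 1 * κ₂) := by
  have hκ := H.κ₁_pos
  have hκ2 := hκ.trans_le (H.κ₁_le x₀)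
  have lower : ∀ k : Fin (m 1) → ℝ, (∀ i, κ₁ ≤ k i) → m 1 * κ₁ ≤ ∑ i, k i := fun k hk => by
    simpa using Finset.sum_le_sum fun i (_ : i ∈ Finset.univ) => hk i
  have upper : ∀ k : Fin (m 1) → ℝ, (∀ i, k i ≤ κ₂) → ∑ i, k i ≤ m 1 * κ₂ := fun k hk => by
    simpa using Finset.sum_le_sum fun i (_ : i ∈ Finset.univ) => hk i
  have hu := R.usum_pos (ε := ε) (C := C) hm ω x₀
  have hv := R.vsum_pos (ε := ε) (C := C) hm ω x₀
  constructor
  · refine mul_le_mul ?_ ?_ (by positivity) hu.le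
    · rw [usum_one]; exact lower _ fun i => H.le_kernel _ _
    · rw [vsum_one]; exact lower _ fun i => H.le_kernel _ _
  · refine mul_le_mul ?_ ?_ hv.le (by positivity)
    · rw [usum_one]; exact upper _ fun i => H.kernel_le _ _
    · rw [vsum_one]; exact upper _ fun i => H.kernel_le _ _

theorem fnext_eq (R : Run α β η bs m P) (hε : ε ≠ 0) {t : ℕ} (hm : 1 ≤ m t) (ω : Ω) (x : X) :
    R.fnext ε C t ω x = -ε * Real.log (R.unext ε C t ω x) :=
  onlineUpdate_eq (v := R.vsum ε C t ω) (h := R.ghat ε C t ω) hε (η t) (R.qhat t ω) (R.yhat t ω)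
    (atomicSum_pos hm _ _) (fun _ => rfl) (R.ybatch t ω) x

theorem unext_pos_ratioLE (R : Run α β η bs m P)
    (H : IsScalingPair β (gibbs ε C) us vs κ₁ κ₂ σ₁ σ₂) {t : ℕ} (hη0 : 0 ≤ η t) (hη1 : η t ≤ 1)
    (hbs : 1 ≤ bs t) (hm : 1 ≤ m t) (ω : Ω) :
    (∀ x, 0 < R.unext ε C t ω x) ∧ RatioLE (R.unext ε C t ω) (κ₂ / κ₁) :=
  H.update_pos_ratioLE (R.usum_pos hm ω) (R.vsum_pos hm ω) (R.usum_ratioLE H t ω) hbs _ hη0 hη1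

theorem vnext_pos (R : Run α β η bs m P)
    (H : IsScalingPair β (gibbs ε C) us vs κ₁ κ₂ σ₁ σ₂)
    (H' : IsScalingPair α (fun y x => gibbs ε C x y) vs us κ₁ κ₂ σ₁ σ₂) {t : ℕ} (hη0 : 0 ≤ η t)
    (hη1 : η t ≤ 1) (hbs : 1 ≤ bs t) (hm : 1 ≤ m t) (ω : Ω) (y : X) : 0 < R.vnext ε C t ω y :=
  (H'.update_pos_ratioLE (R.vsum_pos hm ω) (R.unext_pos_ratioLE H hη0 hη1 hbs hm ω).1
    (R.vsum_ratioLE H' t ω) hbs (R.xbatch t ω) hη0 hη1).1 y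

theorem gnext_eq (R : Run α β η bs m P) (hε : ε ≠ 0)
    (H : IsScalingPair β (gibbs ε C) us vs κ₁ κ₂ σ₁ σ₂) {t : ℕ} (hη0 : 0 ≤ η t) (hη1 : η t ≤ 1)
    (hbs : 1 ≤ bs t) (hm : 1 ≤ m t) (ω : Ω) (y : X) :
    R.gnext ε C t ω y = -ε * Real.log (R.vnext ε C t ω y) :=
  onlineUpdate_eq (c := fun y x => C x y) (v := R.unext ε C t ω) (h := R.fnext ε C t ω) hε (η t)
    (R.phat t ω) (R.xhat t ω) (R.unext_pos_ratioLE H hη0 hη1 hbs hm ω).1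
    (R.fnext_eq hε hm ω) (R.xbatch t ω) y

theorem measurable_unext (R : Run α β η bs m P) (hC : Measurable (Function.uncurry C)) (t : ℕ)
    (ω : Ω) : Measurable (R.unext ε C t ω) := by
  have h : Measurable fun x =>
      empiricalTarget (gibbs ε C) (R.vsum ε C t ω) (R.ybatch t ω) x :=
    measurable_empiricalTarget (V := fun _ => R.vsum ε C t ω) (ξ := fun _ => R.ybatch t ω)
      (fun _ => (measurable_gibbs hC).comp (measurable_id.prodMk measurable_const))
      (fun _ => measurable_const)
  have h1 := ((R.measurable_usum (ε := ε) hC t ω).const_mul (1 - η t)).add (h.const_mul (η t))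
  exact h1

/-- The sampling errors are of the order of the inverse square root of the batch size. -/
theorem exists_noise_bound [PseudoMetricSpace X] [CompactSpace X] {D : ℝ} (hD : 0 < D)
    (hX : HasDyadicNets X D) [IsProbabilityMeasure α] [IsProbabilityMeasure β]
    (H : IsScalingPair β (gibbs ε C) us vs κ₁ κ₂ σ₁ σ₂)
    (H' : IsScalingPair α (fun y x => gibbs ε C x y) vs us κ₁ κ₂ σ₁ σ₂)
    (hC : Measurable (Function.uncurry C)) {Λ : ℝ} (hΛ : 0 ≤ Λ)
    (hL : ∀ x x' y, |gibbs ε C x y - gibbs ε C x' y| ≤ Λ * dist x x')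
    (hL' : ∀ y y' x, |gibbs ε C x y - gibbs ε C x y'| ≤ Λ * dist y y') (x₀ : X) :
    ∃ c : ℝ, 0 < c ∧ ∀ (η : ℕ → ℝ) (bs m : ℕ → ℕ) (Ω : Type*) [MeasurableSpace Ω] (P : Measure Ω)
      (R : Run α β η bs m P) (t : ℕ), 1 ≤ t → 0 ≤ η t → η t ≤ 1 → 1 ≤ bs t → 1 ≤ m t →
      (Integrable (R.noiseY ε C x₀ t) P ∧ ∫ ω, R.noiseY ε C x₀ t ω ∂P ≤ c / Real.sqrt (bs t)) ∧
      (Integrable (R.noiseX ε C x₀ t) P ∧ ∫ ω, R.noiseX ε C x₀ t ω ∂P ≤ c / Real.sqrt (bs t)) := by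
  have hk := measurable_gibbs (ε := ε) hC
  have hk' : Measurable (Function.uncurry fun y x => gibbs ε C x y) := hk.comp measurable_swap
  obtain ⟨c₁, hc₁, h₁⟩ := H.exists_noise_bound hD hX hk hΛ hL x₀
  obtain ⟨c₂, hc₂, h₂⟩ := H'.exists_noise_bound hD hX hk' hΛ hL' x₀
  refine ⟨c₁ + c₂, by positivity, fun η bs m Ω _ P R t ht hη0 hη1 hbs hm => ?_⟩
  have hP : IsProbabilityMeasure P := R.indep_samples.isProbabilityMeasure
  have hVp : ∀ (θ : (Fin (m t) → X) × (Fin (m t) → ℝ) × (Fin (m t) → X) × (Fin (m t) → ℝ)) x,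
      0 < stateV ε C θ x := fun θ x => atomicSum_pos hm _ _ _
  have hVr : ∀ θ : (Fin (m t) → X) × (Fin (m t) → ℝ) × (Fin (m t) → X) × (Fin (m t) → ℝ),
      RatioLE (stateV ε C θ) (κ₂ / κ₁) := fun θ =>
    atomicSum_ratioLE (c := fun y x => C x y) H' _ _
  have hU : ∀ θ : ((Fin (m t) → X) × (Fin (m t) → ℝ) × (Fin (m t) → X) × (Fin (m t) → ℝ)) ×
      (Fin (bs t) → X), (∀ x, 0 < stateU ε C (η t) θ x) ∧
        RatioLE (stateU ε C (η t) θ) (κ₂ / κ₁) := fun θ =>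
    H.update_pos_ratioLE (u := atomicSum ε C θ.1.2.2.2 θ.1.2.2.1) (v := stateV ε C θ.1)
      (atomicSum_pos hm _ _) (hVp θ.1) (atomicSum_ratioLE H _ _) hbs θ.2 hη0 hη1
  have hY := h₁ _ Ω P (stateV ε C) (bs t) (R.state t) (R.ybatch t) (measurable_stateV hC) hVp hVr
    hbs (R.measurable_state ht) (R.measurable_ybatch t) (R.indepFun_state_ybatch ht)
    (R.map_ybatch t)
  -- The integrand of the g-update contains the new f, which depends on the state and on the batch
  -- from β. The pair of both is what has to be independent of the batch from α.
  have hX := h₂ _ Ω P (stateU ε C (η t)) (bs t) (fun ω => (R.state t ω, R.ybatch t ω)) (R.xbatch t)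
    (measurable_stateU hC (η t)) (fun θ => (hU θ).1) (fun θ => (hU θ).2) hbs
    ((R.measurable_state ht).prodMk (R.measurable_ybatch t)) (R.measurable_xbatch t)
    (R.indepFun_state_ybatch_xbatch ht) (R.map_xbatch t)
  exact ⟨⟨hY.1, hY.2.trans (by gcongr; linarith)⟩, ⟨hX.1, hX.2.trans (by gcongr; linarith)⟩⟩

theorem errorMajorant_nonneg (R : Run α β η bs m P) {x₀ : X} {c g h B₁ : ℝ} {δ : ℕ → ℝ}
    (hη0 : ∀ t, 1 ≤ t → 0 ≤ η t) (hc : ∀ t, 1 ≤ t → η t * c ≤ 1) (hg : 0 ≤ g) (hh : 0 ≤ h)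
    (hB₁ : 0 ≤ B₁) (hδ : ∀ t, 1 ≤ t → 0 ≤ δ t) (n : ℕ) (ω : Ω) :
    0 ≤ R.errorMajorant ε C x₀ c g h B₁ δ n ω := by
  induction n with
  | zero => rw [errorMajorant]; exact hB₁
  | succ n ih =>
    rw [errorMajorant]
    have h1 := mul_nonneg ih (sub_nonneg.2 (hc (n + 1) (by omega)))
    have h2 := mul_nonneg (mul_nonneg (hη0 (n + 1) (by omega)) hg)
      (add_nonneg (supDeviation_nonneg (μ := β)
        (fun x y => gibbs ε C x y * (R.vsum ε C (n + 1) ω x₀ / R.vsum ε C (n + 1) ω y))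
        (R.ybatch (n + 1) ω)) (supDeviation_nonneg (μ := α)
        (fun y x => gibbs ε C x y * (R.unext ε C (n + 1) ω x₀ / R.unext ε C (n + 1) ω x))
        (R.xbatch (n + 1) ω)))
    have h3 := mul_nonneg hh (hδ (n + 1) (by omega))
    exact add_nonneg (add_nonneg h1 h2) h3

/-- Pathwise bounds along a run whose compression errors are at most `ε * δ t`. -/
theorem relative_ratioLE_errorMajorant [IsProbabilityMeasure α] [IsProbabilityMeasure β]
    (R : Run α β η bs m P) (hε : 0 < ε)
    (H : IsScalingPair β (gibbs ε C) us vs κ₁ κ₂ σ₁ σ₂)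
    (H' : IsScalingPair α (fun y x => gibbs ε C x y) vs us κ₁ κ₂ σ₁ σ₂)
    (hC : Measurable (Function.uncurry C)) (hη0 : ∀ t, 1 ≤ t → 0 ≤ η t)
    (hη1 : ∀ t, 1 ≤ t → η t ≤ 1) (hbs : ∀ t, 1 ≤ t → 1 ≤ bs t) (hm : ∀ t, 1 ≤ t → 1 ≤ m t)
    {δ : ℕ → ℝ} (hδ : ∀ t, 1 ≤ t → 0 ≤ δ t) {S : ℝ}
    (hS : ∀ n, ∑ i ∈ Finset.range n, δ (i + 1) ≤ S) {ω : Ω}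
    (hcomp : ∀ t, 1 ≤ t →
      (∀ x, |R.fnext ε C t ω x - R.fhat ε C (t + 1) ω x| ≤ ε * δ t) ∧
      (∀ y, |R.gnext ε C t ω y - R.ghat ε C (t + 1) ω y| ≤ ε * δ t))
    (x₀ : X) {Plo₀ Phi₀ c g h : ℝ}
    (hPlo₀ : Plo₀ = min (κ₁ / (κ₂ / κ₁)) ((m 1 * κ₁) * (m 1 * κ₁)))
    (hPhi₀ : Phi₀ = max (κ₂ * (κ₂ / κ₁)) ((m 1 * κ₂) * (m 1 * κ₂)))
    (hc : c = contractionRate κ₁ κ₂ σ₂ (Real.exp (2 * S) * Phi₀))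
    (hg : g = noiseGain κ₁ κ₂ σ₁ σ₂ (Real.exp (-(2 * S)) * Plo₀))
    (hh : h = compressionGain κ₁ κ₂ σ₁ σ₂ S) (n : ℕ) :
    Real.exp (-(2 * ∑ i ∈ Finset.range n, δ (i + 1))) * Plo₀
        ≤ R.usum ε C (n + 1) ω x₀ * R.vsum ε C (n + 1) ω x₀ ∧
      R.usum ε C (n + 1) ω x₀ * R.vsum ε C (n + 1) ω x₀
        ≤ Real.exp (2 * ∑ i ∈ Finset.range n, δ (i + 1)) * Phi₀ ∧
      RatioLE (fun x => R.usum ε C (n + 1) ω x / us x)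
        (1 + R.errorMajorant ε C x₀ c g h (oscBound κ₁ κ₂ σ₁ σ₂) δ n ω) ∧
      RatioLE (fun x => R.vsum ε C (n + 1) ω x / vs x)
        (1 + R.errorMajorant ε C x₀ c g h (oscBound κ₁ κ₂ σ₁ σ₂) δ n ω) := by
  have hκ := H.κ₁_pos
  have hκ2 := hκ.trans_le (H.κ₁_le x₀)
  have hσ := H.σ₁_pos
  have hσ2 := hσ.trans_le (H.σ₁_le x₀)
  have hosc := H.oscBound_nonneg x₀
  have hm1 : (0 : ℝ) < m 1 := by exact_mod_cast hm 1 le_rfl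
  have hPlo0 : 0 < Plo₀ := by rw [hPlo₀]; exact lt_min (by positivity) (by positivity)
  have hPhi1 : κ₂ * (κ₂ / κ₁) ≤ Phi₀ := hPhi₀ ▸ le_max_left _ _
  have hPhi0 : 0 < Phi₀ := lt_of_lt_of_le (by positivity) hPhi1
  have hS0 : 0 ≤ S := by simpa using hS 0
  have hsum0 : ∀ n, 0 ≤ ∑ i ∈ Finset.range n, δ (i + 1) := fun n =>
    Finset.sum_nonneg fun i _ => hδ _ (by omega)
  have hge : Phi₀ ≤ Real.exp (2 * S) * Phi₀ :=
    le_mul_of_one_le_left hPhi0.le (Real.one_le_exp (by linarith))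
  have hc1 : c ≤ 1 := hc ▸ H.contractionRate_le_one (hPhi1.trans hge)
  have hc0 : 0 < c := hc ▸ H.contractionRate_pos x₀ (by positivity)
  have hrate : ∀ t, 1 ≤ t → η t * c ≤ 1 := fun t ht =>
    mul_le_one₀ (hη1 t ht) hc0.le hc1
  have hg0 : 0 ≤ g := hg ▸ H.noiseGain_nonneg x₀ (by positivity)
  have hh0 : 0 ≤ h := by rw [hh]; unfold compressionGain; positivity
  have hup : ∀ t, 1 ≤ t → ∀ x, 0 < R.usum ε C t ω x := fun t ht => R.usum_pos (hm t ht) ω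
  have hvp : ∀ t, 1 ≤ t → ∀ x, 0 < R.vsum ε C t ω x := fun t ht => R.vsum_pos (hm t ht) ω
  have hur : ∀ t, RatioLE (R.usum ε C t ω) (κ₂ / κ₁) := fun t => R.usum_ratioLE H t ω
  have hvr : ∀ t, RatioLE (R.vsum ε C t ω) (κ₂ / κ₁) := fun t => R.vsum_ratioLE H' t ω
  induction n with
  | zero =>
    simp only [Finset.range_zero, Finset.sum_empty, mul_zero, neg_zero, Real.exp_zero, one_mul,
      zero_add]
    have hs := R.scale_one_bounds H (hm 1 le_rfl) ω x₀
    rw [errorMajorant]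
    refine ⟨?_, ?_, H.relative_ratioLE (hup 1 le_rfl) (hur 1),
      H'.relative_ratioLE (hvp 1 le_rfl) (hvr 1)⟩
    · rw [hPlo₀]
      exact (min_le_right _ _).trans hs.1
    · rw [hPhi₀]
      exact hs.2.trans (le_max_right _ _)
  | succ n ih =>
    obtain ⟨i1, i2, i3, i4⟩ := ih
    have ht : 1 ≤ n + 1 := by omega
    have hb0 := R.errorMajorant_nonneg (ε := ε) (C := C) (x₀ := x₀) hη0 hrate hg0 hh0 hosc hδ n ω
    have hun := R.unext_pos_ratioLE H (hη0 _ ht) (hη1 _ ht) (hbs _ ht) (hm _ ht) ω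
    have hvn := R.vnext_pos H H' (hη0 _ ht) (hη1 _ ht) (hbs _ ht) (hm _ ht) ω
    have hcf := fun x => le_exp_mul_of_abs_log_le hε (hun.1 x) (hup (n + 1 + 1) (by omega) x)
      (R.fnext_eq hε.ne' (hm _ ht) ω x) rfl ((hcomp (n + 1) ht).1 x)
    have hcg := fun y => le_exp_mul_of_abs_log_le hε (hvn y) (hvp (n + 1 + 1) (by omega) y)
      (R.gnext_eq hε.ne' H (hη0 _ ht) (hη1 _ ht) (hbs _ ht) (hm _ ht) ω y) rfl
      ((hcomp (n + 1) ht).2 y)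
    have hδS : δ (n + 1) ≤ S := by
      refine le_trans ?_ (hS (n + 1))
      rw [Finset.sum_range_succ]
      linarith [hsum0 n]
    -- The scale interval `lo`, `hi` widens at each step by the compression errors so far, whereas
    -- `Plo` and `Phi` use the total S, so that the contraction and noise constants are the same for
    -- all steps.
    have step := fullStep H H' (R.measurable_vsum hC (n + 1) ω) (R.measurable_unext hC (n + 1) ω) (hup _ ht) (hvp _ ht) (hur _) (hvr _)
      (hbs _ ht) (R.ybatch (n + 1) ω) (R.xbatch (n + 1) ω) (hη0 _ ht) (hη1 _ ht)
      (u' := R.unext ε C (n + 1) ω) (v' := R.vnext ε C (n + 1) ω)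
      (fun x => rfl) (fun y => rfl) x₀
      (lo := Real.exp (-(2 * ∑ i ∈ Finset.range n, δ (i + 1))) * Plo₀)
      (hi := Real.exp (2 * ∑ i ∈ Finset.range n, δ (i + 1)) * Phi₀)
      (Plo := Real.exp (-(2 * S)) * Plo₀) (Phi := Real.exp (2 * S) * Phi₀)
      (by positivity) (by have := hS n; gcongr) (by have := hS n; gcongr)
      (by
        refine le_trans (mul_le_of_le_one_left hPlo0.le (Real.exp_le_one_iff.2 ?_))
          (hPlo₀ ▸ min_le_left _ _)
        linarith [hsum0 n])
      (hPhi1.trans (le_mul_of_one_le_left hPhi0.le (Real.one_le_exp (by linarith [hsum0 n]))))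
      i1 i2 (e := R.noiseY ε C x₀ (n + 1) ω) (e' := R.noiseX ε C x₀ (n + 1) ω)
      (supDeviation_nonneg _ _) (supDeviation_nonneg _ _)
      -- Only boundedness matters here, so the Lipschitz addend is taken to be 0.
      (le_supDeviation (fun x y => H.abs_kernel_mul_ratio_le (hvp _ ht) (hvr _) le_rfl x₀ x y)
        (hbs _ ht) _)
      (le_supDeviation (fun y x => H'.abs_kernel_mul_ratio_le hun.1 hun.2 le_rfl x₀ y x)
        (hbs _ ht) _)
      hb0 i3 i4 (hc ▸ hrate _ ht) (hδ _ ht) hδS (fun x => (hcf x).1) (fun x => (hcf x).2)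
      (fun y => (hcg y).1) (fun y => (hcg y).2)
    rw [← hc, ← hg, ← hh] at step
    obtain ⟨s1, s2, s3, s4⟩ := step
    rw [errorMajorant]
    refine ⟨?_, ?_, s3, s4⟩
    · refine le_trans (le_of_eq ?_) s1
      rw [Finset.sum_range_succ, ← mul_assoc, ← Real.exp_add]
      congr 2; ring
    · refine s2.trans (le_of_eq ?_)
      rw [Finset.sum_range_succ, ← mul_assoc, ← Real.exp_add]
      congr 2; ring

end Majorant

end Run

/-! ### Constants from the cost and the potentials; expectation of the majorant. -/

theorem abs_gibbs_sub_le {X : Type*} {ε Cb : ℝ} (hε : 0 < ε) {c : X → X → ℝ}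
    (hcb : ∀ x y, |c x y| ≤ Cb) (x y x' y' : X) :
    |gibbs ε c x y - gibbs ε c x' y'| ≤ Real.exp (Cb / ε) / ε * |c x y - c x' y'| := by
  -- The tangent of exp at p lies below its graph, so exp p - exp q ≤ exp p · (p - q).
  have key : ∀ p q : ℝ, p ≤ Cb / ε → Real.exp p - Real.exp q ≤ Real.exp (Cb / ε) * |p - q| := by
    intro p q hp
    have h1 := Real.add_one_le_exp (q - p)
    have h2 : Real.exp q = Real.exp p * Real.exp (q - p) := by rw [← Real.exp_add]; congr 1; ring
    have h3 := mul_le_mul_of_nonneg_left h1 (Real.exp_pos p).le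
    have h4 : Real.exp p * (p - q) ≤ Real.exp (Cb / ε) * |p - q| :=
      (mul_le_mul_of_nonneg_left (le_abs_self _) (Real.exp_pos p).le).trans
        (mul_le_mul_of_nonneg_right (Real.exp_le_exp.2 hp) (abs_nonneg _))
    linarith
  have hb : ∀ x y, -c x y / ε ≤ Cb / ε := fun x y =>
    div_le_div_of_nonneg_right (by linarith [(abs_le.1 (hcb x y)).1]) hε.le
  have e : |-c x y / ε - -c x' y' / ε| = |c x y - c x' y'| / ε := by
    rw [← sub_div, abs_div, abs_of_pos hε, neg_sub_neg, abs_sub_comm]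
  have h1 := key (-c x y / ε) (-c x' y' / ε) (hb x y)
  have h2 := key (-c x' y' / ε) (-c x y / ε) (hb x' y')
  rw [abs_sub_comm] at h2
  rw [e] at h1 h2
  have e2 : Real.exp (Cb / ε) / ε * |c x y - c x' y'|
      = Real.exp (Cb / ε) * (|c x y - c x' y'| / ε) := by ring
  rw [e2]
  unfold gibbs
  exact abs_sub_le_iff.2 ⟨h1, h2⟩

/-- The optimality relation in exponential form. -/
theorem isScalingPair_of_softTransform {X : Type*} [TopologicalSpace X]
    [MeasurableSpace X] [BorelSpace X] {μ : Measure X} [IsProbabilityMeasure μ] {ε Cb Fb : ℝ}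
    (hε : 0 < ε) {c : X → X → ℝ} (hc : ∀ x, Continuous (c x)) (hcb : ∀ x y, |c x y| ≤ Cb)
    {f g : X → ℝ} (hg : Continuous g) (hfb : ∀ x, |f x| ≤ Fb) (hgb : ∀ x, |g x| ≤ Fb)
    (hf : ∀ x, f x = softTransform ε c μ g x) :
    IsScalingPair μ (gibbs ε c) (fun x => Real.exp (-f x / ε)) (fun x => Real.exp (-g x / ε))
      (Real.exp (-Cb / ε)) (Real.exp (Cb / ε)) (Real.exp (-Fb / ε)) (Real.exp (Fb / ε)) where
  κ₁_pos := Real.exp_pos _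
  σ₁_pos := Real.exp_pos _
  le_kernel x y := Real.exp_le_exp.2
    (div_le_div_of_nonneg_right (by linarith [(abs_le.1 (hcb x y)).2]) hε.le)
  kernel_le x y := Real.exp_le_exp.2
    (div_le_div_of_nonneg_right (by linarith [(abs_le.1 (hcb x y)).1]) hε.le)
  measurable_kernel x := (Real.continuous_exp.comp ((hc x).neg.div_const _)).measurable
  measurable_right := (Real.continuous_exp.comp (hg.neg.div_const _)).measurable
  le_left x := Real.exp_le_exp.2
    (div_le_div_of_nonneg_right (by linarith [(abs_le.1 (hfb x)).2]) hε.le)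
  left_le x := Real.exp_le_exp.2
    (div_le_div_of_nonneg_right (by linarith [(abs_le.1 (hfb x)).1]) hε.le)
  le_right x := Real.exp_le_exp.2
    (div_le_div_of_nonneg_right (by linarith [(abs_le.1 (hgb x)).2]) hε.le)
  right_le x := Real.exp_le_exp.2
    (div_le_div_of_nonneg_right (by linarith [(abs_le.1 (hgb x)).1]) hε.le)
  left_eq x := by
    have hcont : Continuous fun y => Real.exp ((g y - c x y) / ε) :=
      Real.continuous_exp.comp ((hg.sub (hc x)).div_const _)
    have hint : Integrable (fun y => Real.exp ((g y - c x y) / ε)) μ :=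
      Integrable.of_bound hcont.measurable.aestronglyMeasurable (Real.exp ((Fb + Cb) / ε))
        (Filter.Eventually.of_forall fun y => by
          rw [Real.norm_of_nonneg (Real.exp_pos _).le]
          refine Real.exp_le_exp.2 (div_le_div_of_nonneg_right ?_ hε.le)
          linarith [(abs_le.1 (hgb y)).2, (abs_le.1 (hcb x y)).1])
    have hpos := integral_exp_pos hint
    have e : -f x / ε = Real.log (∫ y, Real.exp ((g y - c x y) / ε) ∂μ) := by
      rw [hf]; unfold softTransform; field_simp
    simp only [e, Real.exp_log hpos, gibbs]
    refine integral_congr_ae (Filter.Eventually.of_forall fun y => ?_)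
    simp only
    rw [← Real.exp_sub]
    congr 1
    ring

namespace Run

variable {X : Type*} [MeasurableSpace X] {α β : Measure X} {η : ℕ → ℝ} {bs m : ℕ → ℕ}
  {Ω : Type*} [MeasurableSpace Ω] {P : Measure Ω} {ε : ℝ} {C : X → X → ℝ}

theorem measurable_fhat (R : Run α β η bs m P) (hC : Measurable (Function.uncurry C)) {t : ℕ}
    (ht : 1 ≤ t) (x : X) : Measurable fun ω => R.fhat ε C t ω x := by
  have hg : Measurable fun ω => ((R.qhat t ω, R.yhat t ω), x) :=
    ((R.measurable_qhat t ht).prodMk (R.measurable_yhat t ht)).prodMk measurable_const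
  have h := (measurable_atomicSum (ε := ε) (m := m t) hC).comp hg
  have h2 := (Real.measurable_log.comp h).const_mul (-ε)
  exact h2

theorem measurable_ghat (R : Run α β η bs m P) (hC : Measurable (Function.uncurry C)) {t : ℕ}
    (ht : 1 ≤ t) (y : X) : Measurable fun ω => R.ghat ε C t ω y := by
  have hCs : Measurable (Function.uncurry fun y x => C x y) := hC.comp measurable_swap
  have hg : Measurable fun ω => ((R.phat t ω, R.xhat t ω), y) :=
    ((R.measurable_phat t ht).prodMk (R.measurable_xhat t ht)).prodMk measurable_const
  have h := (measurable_atomicSum (ε := ε) (m := m t) hCs).comp hg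
  have h2 := (Real.measurable_log.comp h).const_mul (-ε)
  exact h2

theorem integrable_errorMajorant (R : Run α β η bs m P) {x₀ : X} {c g h B₁ : ℝ} {δ : ℕ → ℝ}
    (hY : ∀ t, 1 ≤ t → Integrable (R.noiseY ε C x₀ t) P)
    (hX : ∀ t, 1 ≤ t → Integrable (R.noiseX ε C x₀ t) P) (n : ℕ) :
    Integrable (R.errorMajorant ε C x₀ c g h B₁ δ n) P := by
  have : IsProbabilityMeasure P := R.indep_samples.isProbabilityMeasure
  induction n with
  | zero => exact integrable_const B₁
  | succ n ih =>
    have h1 := ((ih.mul_const (1 - η (n + 1) * c)).add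
      (((hY (n + 1) (by omega)).add (hX (n + 1) (by omega))).const_mul (η (n + 1) * g))).add
      (integrable_const (h * δ (n + 1)))
    exact h1

theorem integral_errorMajorant_succ (R : Run α β η bs m P) {x₀ : X} {c g h B₁ : ℝ} {δ : ℕ → ℝ}
    (hY : ∀ t, 1 ≤ t → Integrable (R.noiseY ε C x₀ t) P)
    (hX : ∀ t, 1 ≤ t → Integrable (R.noiseX ε C x₀ t) P) (n : ℕ) :
    ∫ ω, R.errorMajorant ε C x₀ c g h B₁ δ (n + 1) ω ∂P
      = (∫ ω, R.errorMajorant ε C x₀ c g h B₁ δ n ω ∂P) * (1 - η (n + 1) * c)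
        + η (n + 1) * g * (∫ ω, R.noiseY ε C x₀ (n + 1) ω ∂P + ∫ ω, R.noiseX ε C x₀ (n + 1) ω ∂P)
        + h * δ (n + 1) := by
  have : IsProbabilityMeasure P := R.indep_samples.isProbabilityMeasure
  have hI := R.integrable_errorMajorant (c := c) (g := g) (h := h) (B₁ := B₁) (δ := δ) hY hX n
  have i1 := hI.mul_const (1 - η (n + 1) * c)
  have hYX : Integrable (fun ω => R.noiseY ε C x₀ (n + 1) ω + R.noiseX ε C x₀ (n + 1) ω) P :=
    (hY (n + 1) (by omega)).add (hX (n + 1) (by omega))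
  have i2 := hYX.const_mul (η (n + 1) * g)
  have i3 : Integrable (fun ω => R.errorMajorant ε C x₀ c g h B₁ δ n ω * (1 - η (n + 1) * c)
      + η (n + 1) * g * (R.noiseY ε C x₀ (n + 1) ω + R.noiseX ε C x₀ (n + 1) ω)) P := i1.add i2
  simp only [errorMajorant]
  rw [integral_add i3 (integrable_const _), integral_add i1 i2, integral_mul_const,
    integral_const_mul, integral_add (hY (n + 1) (by omega)) (hX (n + 1) (by omega))]
  simp

end Run

/-! ### The error rate per iteration. -/

theorem exists_sum_rpow_le {p : ℝ} (hp : p < -1) {K : ℝ} (hK : 0 ≤ K) :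
    ∃ S : ℝ, ∀ n, ∑ i ∈ Finset.range n, K * ((i + 1 : ℕ) : ℝ) ^ p ≤ S := by
  have hs : Summable fun i : ℕ => K * ((i + 1 : ℕ) : ℝ) ^ p :=
    ((summable_nat_add_iff 1).2 (Real.summable_nat_rpow.2 hp)).mul_left K
  exact ⟨_, fun n => hs.sum_le_tsum _ fun i _ => by positivity⟩

/-- The error of compressed online Sinkhorn at iteration `t` is of the order of `t ^ (-a)`. -/
theorem exists_error_rate {X : Type*} [PseudoMetricSpace X] [CompactSpace X] [MeasurableSpace X]
    [BorelSpace X] {D : ℝ} (hD : 0 < D) (hX : HasDyadicNets X D) {α β : Measure X}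
    [IsProbabilityMeasure α] [IsProbabilityMeasure β] {C : X → X → ℝ} {L : ℝ≥0}
    (hC : LipschitzWith L (Function.uncurry C)) {ε : ℝ} (hε : 0 < ε) {fs gs : X → ℝ}
    (hfc : Continuous fs) (hgc : Continuous gs) (hf : ∀ x, fs x = softTransform ε C β gs x)
    (hg : ∀ y, gs y = softTransform ε (fun y x => C x y) α fs y) {a b : ℝ} (hb : -1 < b)
    (hb' : b < -(1 / 2)) (hab : 1 < a - b) {ζ : ℝ} (hζ : 0 < ζ) (K : ℝ) (s : ℕ) :
    ∃ A : ℝ, 0 < A ∧ ∀ (Ω : Type*) [MeasurableSpace Ω] (P : Measure Ω) [IsProbabilityMeasure P]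
      (R : Run α β (stepSize b s) (batchSize a s) (compressionSize a b ζ s) P),
      R.CompressionErrorBound ε C ζ K → ∀ t : ℕ, 1 ≤ t →
      Integrable (fun ω => varNorm (fun x => (R.fhat ε C t ω x - fs x) / ε)
        + varNorm (fun y => (R.ghat ε C t ω y - gs y) / ε)) P ∧
      ∫ ω, (varNorm (fun x => (R.fhat ε C t ω x - fs x) / ε)
        + varNorm (fun y => (R.ghat ε C t ω y - gs y) / ε)) ∂P ≤ A * (t : ℝ) ^ (-a) := by
  have hne : Nonempty X := nonempty_of_isProbabilityMeasure α
  obtain ⟨x₀⟩ := id hne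
  have ha : 0 < a := by linarith
  have hb0 : b ≤ 0 := by linarith
  have hCc := hC.continuous
  have hCm : Measurable (Function.uncurry C) := hCc.measurable
  have hC1 : ∀ x, Continuous (C x) := fun x => hCc.comp (Continuous.prodMk_right x)
  have hC2 : ∀ y, Continuous fun x => C x y := fun y => hCc.comp (Continuous.prodMk_left y)
  obtain ⟨Cb, hCb⟩ := isCompact_univ.exists_bound_of_continuousOn hCc.continuousOn
  have hCb' : ∀ x y, |C x y| ≤ Cb := fun x y => hCb (x, y) (Set.mem_univ _)
  obtain ⟨F₁, hF₁⟩ := isCompact_univ.exists_bound_of_continuousOn hfc.continuousOn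
  obtain ⟨F₂, hF₂⟩ := isCompact_univ.exists_bound_of_continuousOn hgc.continuousOn
  have hfb : ∀ x, |fs x| ≤ max F₁ F₂ := fun x => (hF₁ x (Set.mem_univ _)).trans (le_max_left _ _)
  have hgb : ∀ x, |gs x| ≤ max F₁ F₂ := fun x => (hF₂ x (Set.mem_univ _)).trans (le_max_right _ _)
  have H := isScalingPair_of_softTransform hε hC1 hCb' hgc hfb hgb hf
  have H' : IsScalingPair α (fun y x => gibbs ε C x y) _ _ _ _ _ _ :=
    isScalingPair_of_softTransform (c := fun y x => C x y) hε hC2 (fun y x => hCb' x y) hfc hgb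
      hfb hg
  set κ₁ := Real.exp (-Cb / ε)
  set κ₂ := Real.exp (Cb / ε)
  set σ₁ := Real.exp (-max F₁ F₂ / ε)
  set σ₂ := Real.exp (max F₁ F₂ / ε)
  have hΛ : 0 ≤ κ₂ / ε * L := by positivity
  have hL : ∀ x x' y, |gibbs ε C x y - gibbs ε C x' y| ≤ κ₂ / ε * L * dist x x' := fun x x' y => by
    refine (abs_gibbs_sub_le hε hCb' x y x' y).trans ?_
    rw [mul_assoc]
    gcongr
    simpa [Prod.dist_eq, Real.dist_eq] using hC.dist_le_mul (x, y) (x', y)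
  have hL' : ∀ y y' x, |gibbs ε C x y - gibbs ε C x y'| ≤ κ₂ / ε * L * dist y y' :=
    fun y y' x => by
      refine (abs_gibbs_sub_le hε hCb' x y x y').trans ?_
      rw [mul_assoc]
      gcongr
      simpa [Prod.dist_eq, Real.dist_eq] using hC.dist_le_mul (x, y) (x, y')
  obtain ⟨cN, hcN, hnoise⟩ := Run.exists_noise_bound hD hX H H' hCm hΛ hL hL' x₀
  -- Here a - b > 1 is used: the total compression error is finite, which confines the scale. The
  -- sign of K is not prescribed, hence |K|.
  obtain ⟨S, hS⟩ := exists_sum_rpow_le (p := b - a) (by linarith) (K := |K| / ε) (by positivity)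
  set δ : ℕ → ℝ := fun t => |K| / ε * (t : ℝ) ^ (b - a) with hδdef
  have hδ : ∀ t : ℕ, 1 ≤ t → 0 ≤ δ t := fun t _ => by positivity
  have hm : ∀ t, 1 ≤ t → 1 ≤ compressionSize a b ζ s t := fun t ht => one_le_compressionSize ht
  have hm1 : (0 : ℝ) < compressionSize a b ζ s 1 := by exact_mod_cast hm 1 le_rfl
  obtain ⟨Plo₀, hPlo₀⟩ : ∃ p, p = min (κ₁ / (κ₂ / κ₁))
    ((compressionSize a b ζ s 1 * κ₁) * (compressionSize a b ζ s 1 * κ₁)) := ⟨_, rfl⟩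
  obtain ⟨Phi₀, hPhi₀⟩ : ∃ p, p = max (κ₂ * (κ₂ / κ₁))
    ((compressionSize a b ζ s 1 * κ₂) * (compressionSize a b ζ s 1 * κ₂)) := ⟨_, rfl⟩
  obtain ⟨c, hc⟩ : ∃ c, c = contractionRate κ₁ κ₂ σ₂ (Real.exp (2 * S) * Phi₀) := ⟨_, rfl⟩
  obtain ⟨g, hg'⟩ : ∃ g, g = noiseGain κ₁ κ₂ σ₁ σ₂ (Real.exp (-(2 * S)) * Plo₀) := ⟨_, rfl⟩
  obtain ⟨h, hh⟩ : ∃ h, h = compressionGain κ₁ κ₂ σ₁ σ₂ S := ⟨_, rfl⟩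
  have hosc := H.oscBound_nonneg x₀
  have hPlo0 : 0 < Plo₀ := by rw [hPlo₀]; exact lt_min (by positivity) (by positivity)
  have hPhi1 : κ₂ * (κ₂ / κ₁) ≤ Phi₀ := hPhi₀ ▸ le_max_left _ _
  have hPhi0 : 0 < Phi₀ := lt_of_lt_of_le (by positivity) hPhi1
  have hS0 : 0 ≤ S := by simpa using hS 0
  have hc1 : c ≤ 1 := hc ▸ H.contractionRate_le_one (hPhi1.trans
    (le_mul_of_one_le_left hPhi0.le (Real.one_le_exp (by linarith))))
  have hc0 : 0 < c := hc ▸ H.contractionRate_pos x₀ (by positivity)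
  have hg0 : 0 ≤ g := hg' ▸ H.noiseGain_nonneg x₀ (by positivity)
  have hh0 : 0 ≤ h := by rw [hh]; unfold compressionGain; positivity
  have hη0 : ∀ t, 1 ≤ t → 0 ≤ stepSize b s t := fun t _ => Real.rpow_nonneg (Nat.cast_nonneg _) _
  have hη1 : ∀ t, 1 ≤ t → stepSize b s t ≤ 1 := fun t ht => stepSize_le_one hb0 s ht
  have hrate : ∀ t, 1 ≤ t → stepSize b s t * c ≤ 1 := fun t ht =>
    mul_le_one₀ (hη1 t ht) hc0.le hc1
  have hbs : ∀ t, 1 ≤ t → 1 ≤ batchSize a s t := fun t ht => batchSize_pos a ht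
  have hsb : ((s : ℝ) + 1) ^ b ≤ 1 :=
    Real.rpow_le_one_of_one_le_of_nonpos (by linarith [s.cast_nonneg (α := ℝ)]) hb0
  have hsb0 : 0 < ((s : ℝ) + 1) ^ b := by positivity
  -- The forcing constant collects the two sampling errors, each at most cN t^(-a) and multiplied by
  -- a step size of at most t^b, and the compression error h |K|/ε · t^(b-a). All of this is fixed
  -- before the run is chosen.
  obtain ⟨A, hA, hrec⟩ := exists_rate_of_recursion (a := a) (b := b) (c := c * ((s : ℝ) + 1) ^ b)
    (C := 2 * g * cN + h * (|K| / ε)) (D₀ := oscBound κ₁ κ₂ σ₁ σ₂) ha hb hb0 (by positivity)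
    (mul_le_one₀ hc1 hsb0.le hsb) (by positivity) hosc
  refine ⟨2 * A, by positivity, fun Ω _ P _ R hR t ht => ?_⟩
  have hY : ∀ t, 1 ≤ t → Integrable (R.noiseY ε C x₀ t) P := fun t ht =>
    (hnoise _ _ _ Ω P R t ht (hη0 t ht) (hη1 t ht) (hbs t ht) (hm t ht)).1.1
  have hX' : ∀ t, 1 ≤ t → Integrable (R.noiseX ε C x₀ t) P := fun t ht =>
    (hnoise _ _ _ Ω P R t ht (hη0 t ht) (hη1 t ht) (hbs t ht) (hm t ht)).2.1
  set B := R.errorMajorant ε C x₀ c g h (oscBound κ₁ κ₂ σ₁ σ₂) δ with hB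
  have hBi : ∀ n, Integrable (B n) P := R.integrable_errorMajorant hY hX'
  have hBn : ∀ n ω, 0 ≤ B n ω := R.errorMajorant_nonneg hη0 hrate hg0 hh0 hosc hδ
  -- The majorant is indexed from 0 and iterations from 1, hence `t - 1`.
  have hEB : ∀ t : ℕ, 1 ≤ t → ∫ ω, B (t - 1) ω ∂P ≤ A * (t : ℝ) ^ (-a) := by
    refine hrec (fun t => ∫ ω, B (t - 1) ω ∂P) ?_ ?_
    · simp only [Nat.sub_self, hB, Run.errorMajorant]
      simp
    · intro t ht
      obtain ⟨n, rfl⟩ : ∃ n, t = n + 1 := ⟨t - 1, by omega⟩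
      have hsucc := R.integral_errorMajorant_succ (c := c) (g := g) (h := h)
        (B₁ := oscBound κ₁ κ₂ σ₁ σ₂) (δ := δ) hY hX' n
      rw [← hB] at hsucc
      simp only [Nat.add_sub_cancel]
      rw [hsucc]
      have hN := hnoise _ _ _ Ω P R (n + 1) ht (hη0 _ ht) (hη1 _ ht) (hbs _ ht) (hm _ ht)
      have hE0 : 0 ≤ ∫ ω, B n ω ∂P := integral_nonneg (hBn n)
      have htp : (0 : ℝ) < ((n + 1 : ℕ) : ℝ) := by exact_mod_cast ht
      have hsq : cN / Real.sqrt (batchSize a s (n + 1)) ≤ cN * ((n + 1 : ℕ) : ℝ) ^ (-a) := by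
        rw [Real.rpow_neg htp.le, ← div_eq_mul_inv]
        have h1 : 0 < ((n + 1 : ℕ) : ℝ) ^ a := by positivity
        have h2 := rpow_le_sqrt_batchSize ha s (n + 1)
        gcongr
      have hsplit : ((n + 1 : ℕ) : ℝ) ^ (b - a)
          = ((n + 1 : ℕ) : ℝ) ^ b * ((n + 1 : ℕ) : ℝ) ^ (-a) := by
        rw [← Real.rpow_add htp, sub_eq_add_neg]
      have e1 := mul_le_mul_of_nonneg_left (le_stepSize hb0 s ht) (mul_nonneg hE0 hc0.le)
      have e2 : stepSize b s (n + 1) * g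
          * (∫ ω, R.noiseY ε C x₀ (n + 1) ω ∂P + ∫ ω, R.noiseX ε C x₀ (n + 1) ω ∂P)
          ≤ ((n + 1 : ℕ) : ℝ) ^ b * g * (2 * (cN * ((n + 1 : ℕ) : ℝ) ^ (-a))) := by
        have h3 := stepSize_le_rpow hb0 s ht
        have h4 : ∫ ω, R.noiseY ε C x₀ (n + 1) ω ∂P + ∫ ω, R.noiseX ε C x₀ (n + 1) ω ∂P
          ≤ 2 * (cN * ((n + 1 : ℕ) : ℝ) ^ (-a)) := by
          linarith [hN.1.2, hN.2.2]
        have h5 : 0 ≤ ((n + 1 : ℕ) : ℝ) ^ b * g := by positivity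
        have h6 : 0 ≤ stepSize b s (n + 1) * g := mul_nonneg (hη0 _ ht) hg0
        have h7 : 0 ≤ 2 * (cN * ((n + 1 : ℕ) : ℝ) ^ (-a)) := by positivity
        exact (mul_le_mul_of_nonneg_left h4 h6).trans
          (mul_le_mul_of_nonneg_right (mul_le_mul_of_nonneg_right h3 hg0) h7)
      have e3 : h * δ (n + 1) = h * (|K| / ε) * ((n + 1 : ℕ) : ℝ) ^ (b - a) := by
        simp only [hδdef]; ring
      rw [e3]
      rw [hsplit]
      linarith
  have hcomp : ∀ᵐ ω ∂P, ∀ t, 1 ≤ t →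
      (∀ x, |R.fnext ε C t ω x - R.fhat ε C (t + 1) ω x| ≤ ε * δ t) ∧
      (∀ y, |R.gnext ε C t ω y - R.ghat ε C (t + 1) ω y| ≤ ε * δ t) := by
    filter_upwards [hR] with ω hω t ht
    have hle : K * (compressionSize a b ζ s (t + 1) : ℝ) ^ (-ζ) ≤ ε * δ t := by
      have h1 := compressionSize_rpow_le (a := a) (b := b) hζ (by linarith) s ht
      have h2 : ε * δ t = |K| * (t : ℝ) ^ (b - a) := by simp only [hδdef]; field_simp
      rw [h2]
      exact mul_le_mul (le_abs_self K) h1 (by positivity) (abs_nonneg K)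
    exact ⟨fun x => ((hω t ht).1 x).trans hle, fun y => ((hω t ht).2 y).trans hle⟩
  have hCs : Continuous (Function.uncurry fun y x => C x y) := hCc.comp continuous_swap
  have hfhc : ∀ ω, Continuous fun x => (R.fhat ε C t ω x - fs x) / ε := fun ω =>
    ((continuous_atomicPotential hCc (hm t ht) _ _).sub hfc).div_const _
  have hghc : ∀ ω, Continuous fun y => (R.ghat ε C t ω y - gs y) / ε := fun ω =>
    ((continuous_atomicPotential hCs (hm t ht) _ _).sub hgc).div_const _
  have hmeas : Measurable fun ω => varNorm (fun x => (R.fhat ε C t ω x - fs x) / ε)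
      + varNorm (fun y => (R.ghat ε C t ω y - gs y) / ε) :=
    (measurable_varNorm (fun x => ((R.measurable_fhat hCm ht x).sub_const _).div_const _) hfhc).add
      (measurable_varNorm (fun y => ((R.measurable_ghat hCm ht y).sub_const _).div_const _) hghc)
  have hbound : ∀ᵐ ω ∂P, varNorm (fun x => (R.fhat ε C t ω x - fs x) / ε)
      + varNorm (fun y => (R.ghat ε C t ω y - gs y) / ε) ≤ 2 * B (t - 1) ω := by
    filter_upwards [hcomp] with ω hω
    obtain ⟨-, -, r1, r2⟩ := R.relative_ratioLE_errorMajorant hε H H' hCm hη0 hη1 hbs hm hδ hS hω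
      x₀ hPlo₀ hPhi₀ hc hg' hh (t - 1)
    rw [Nat.sub_add_cancel ht] at r1 r2
    have v1 := varNorm_le_of_ratioLE (f := R.fhat ε C t ω) (fs := fs) hε (hBn (t - 1) ω)
      (R.usum_pos (hm t ht) ω) (fun x => Real.exp_pos _) (fun x => rfl)
      (fun x => by rw [Real.log_exp]; field_simp) r1
    have v2 := varNorm_le_of_ratioLE (f := R.ghat ε C t ω) (fs := gs) hε (hBn (t - 1) ω)
      (R.vsum_pos (hm t ht) ω) (fun x => Real.exp_pos _) (fun x => rfl)
      (fun x => by rw [Real.log_exp]; field_simp) r2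
    linarith
  have hint : Integrable (fun ω => varNorm (fun x => (R.fhat ε C t ω x - fs x) / ε)
      + varNorm (fun y => (R.ghat ε C t ω y - gs y) / ε)) P := by
    refine ((hBi (t - 1)).const_mul 2).mono' hmeas.aestronglyMeasurable ?_
    filter_upwards [hbound] with ω hω
    rw [Real.norm_of_nonneg (add_nonneg (varNorm_nonneg (hfhc ω)) (varNorm_nonneg (hghc ω)))]
    exact hω
  refine ⟨hint, (integral_mono_ae hint ((hBi (t - 1)).const_mul 2) hbound).trans ?_⟩
  rw [integral_const_mul]
  linarith [hEB t ht]

end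

end COS

/-! ### The theorem: from iterations to samples. -/

/-- The offset `s` covers both usual numberings of the parameters: `η_t = t ^ b`, `b_t = t ^ (2a)`
for `s = 0`, and `η_t = (t + 1) ^ b`, `b_t = (t + 1) ^ (2a)` for `s = 1`. The constants depend
neither on `N` nor on the run (probability space, samples, compression). -/
theorem theorem2 {d : ℕ} (𝒳 : Set (EuclideanSpace ℝ (Fin d))) (h𝒳 : IsCompact 𝒳)
    (α β : Measure 𝒳) [IsProbabilityMeasure α] [IsProbabilityMeasure β]
    (C : 𝒳 → 𝒳 → ℝ) (L : ℝ≥0) (hC : LipschitzWith L (Function.uncurry C))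
    (ε : ℝ) (hε : 0 < ε)
    (fs gs : 𝒳 → ℝ) (hopt : COS.IsOptimalPotentials ε C α β fs gs)
    (a b : ℝ) (hb : -1 < b) (hb' : b < -(1 / 2)) (hab : 1 < a - b)
    (ζ : ℝ) (hζ : 0 < ζ) (K : ℝ) (s : ℕ) :
    ∃ c : ℝ, 0 < c ∧ ∃ A : ℝ, 0 < A ∧ ∃ B : ℝ, 0 < B ∧
      ∀ (Ω : Type*) [MeasurableSpace Ω] (P : Measure Ω) [IsProbabilityMeasure P]
        (R : COS.Run α β (COS.stepSize b s) (COS.batchSize a s) (COS.compressionSize a b ζ s) P),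
        R.CompressionErrorBound ε C ζ K →
        ∀ N : ℕ, 1 ≤ N →
          Integrable (R.errorAt ε C fs gs N) P ∧
          ∫ ω, R.errorAt ε C fs gs N ω ∂P
            ≤ A * (Real.exp (-c * (N : ℝ) ^ ((b + 1) / (2 * a + 1)))
                + (N : ℝ) ^ (-(a / (2 * a + 1)))) ∧
          A * (Real.exp (-c * (N : ℝ) ^ ((b + 1) / (2 * a + 1)))
                + (N : ℝ) ^ (-(a / (2 * a + 1))))
            ≤ B * (N : ℝ) ^ (-(a / (2 * a + 1))) := by
  have ha : 0 < a := by linarith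
  have : CompactSpace 𝒳 := isCompact_iff_compactSpace.1 h𝒳
  obtain ⟨D, hD, hX⟩ := COS.exists_hasDyadicNets 𝒳 h𝒳.isBounded
  obtain ⟨A, hA, hrate⟩ := COS.exists_error_rate hD hX hC hε hopt.continuous_left
    hopt.continuous_right hopt.left_eq hopt.right_eq hb hb' hab hζ K s
  obtain ⟨E, hE, hexp⟩ := COS.exists_exp_neg_rpow_le (γ := (b + 1) / (2 * a + 1))
    (q := a / (2 * a + 1)) (div_pos (by linarith) (by linarith))
  set S := (2 * ((s : ℝ) + 1) ^ (2 * a)) ^ (a / (2 * a + 1))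
  have hS : 0 < S := by positivity
  -- Any positive c would do: the polynomial term alone bounds the error, and the exponential is a
  -- nonnegative addition that is itself O(N^(-a/(2a+1))).
  refine ⟨1, one_pos, A * S, by positivity, A * S * (E + 1), by positivity,
    fun Ω _ P _ R hR N hN => ?_⟩
  have hr := hrate Ω P R hR _ (COS.one_le_firstIter a s N)
  have hN0 : 0 ≤ (N : ℝ) ^ (-(a / (2 * a + 1))) := by positivity
  refine ⟨hr.1, hr.2.trans ?_, ?_⟩
  · calc A * (COS.Run.firstIter (COS.batchSize a s) N : ℝ) ^ (-a)
        ≤ A * (S * (N : ℝ) ^ (-(a / (2 * a + 1)))) := by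
          gcongr
          exact COS.firstIter_rpow_le ha s hN
      _ = A * S * (N : ℝ) ^ (-(a / (2 * a + 1))) := by ring
      _ ≤ _ := by
          gcongr
          exact le_add_of_nonneg_left (Real.exp_pos _).le
  · rw [mul_assoc (A * S)]
    gcongr
    linarith [hexp N hN]
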